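/- **Theorem (barren plateau for deep circuits, single mode).** Consider one qubit and one bosonic mode with annihilation operator $m$, $[m,m^\dagger]=1$, and displacement operators $D(\beta)=\exp(\beta m^\dagger-\beta^* m)$. For $L\ge 1$ let $$U(x)=\prod_{\ell=1}^{L}U_{\rm ECD}(\beta_\ell)\,U_{\rm R}(\theta_\ell,\phi_\ell)\quad(\ell=1\text{ acting first}),$$ $$U_{\rm ECD}(\beta)=D(\beta)\otimes|1\rangle\langle 0|+D(-\beta)\otimes|0\rangle\langle 1|,\qquad U_{\rm R}(\theta,\phi)=\exp\!\left[-\tfrac{i\theta}{2}(\cos\phi\,\sigma^x+\sin\phi\,\sigma^y)\right],$$ be drawn from the energy-regularized ensemble $\mathcal U_{E,L,1}$ with $E>0$: all parameters are independent, the $\theta_\ell,\phi_\ell$ are uniform on $[0,2\pi)$, and each $\beta_\ell$ is a centred complex Gaussian whose real and imaginary parts are independent with variance $E/(2L)$. Let $|\psi\rangle$ be a pure Gaussian state $D(\gamma)R(\tau)S(\zeta)|0\rangle$, with $\gamma\in\mathbb C$, $\tau,\zeta\in\mathbb R$, $R(\tau)=e^{-i\tau m^\dagger m}$, $S(\zeta)=e^{\zeta(m^2-m^{\dagger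 2})/2}$, or a Fock state $|n\rangle$, $n\in\mathbb N$, and let $$\mathcal C(x)=\mathrm{Tr}\!\left[O\,U(x)\rho_0U(x)^\dagger\right],\qquad O=|0\rangle\langle 0|\otimes|\psi\rangle\langle\psi|,$$ where $\rho_0$ is the pure state $|0\rangle\otimes|0\rangle$ (qubit in $|0\rangle$, mode in the vacuum). 1. For all $E>0$, $L\ge1$ and $1\le k\le L$, the partial derivative $\partial_{\theta_k}\mathcal C$ exists everywhere, is square-integrable over the ensemble, and has mean zero. 2. For $\kappa>0$ let $\ell_c(E)=\log(\kappa E)/\log(4/3)$ be the critical depth. For each such $\psi$ and every $\kappa>0$ there are constants $c,C,E_0>0$ such that for all $E\ge E_0$, all integers $L\ge \ell_c(E)$ and all $1\le k\le L$, $$\frac{c}{E^2}\;\le\;\mathrm{Var}\left[\partial_{\theta_k}\mathcal C\right]\;\le\;\frac{C}{E^2}.$$ -/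

import Mathlib

open MeasureTheory ProbabilityTheory
open scoped ComplexConjugate ENNReal

noncomputable section

/-!
### One bosonic mode

The mode is realised on the Segal-Bargmann space: states are (entire) functions of `z : ℂ`, with
inner product `⟨F|G⟩ = π⁻¹ ∫ conj (F z) G z exp (-|z|²) d²z`, annihilation operator `m = d/dz` and
creation operator `m† = z`. So `[m, m†] = 1`, and the vacuum is the constant function `1`.
-/

/-- A (wave function of a) state of one bosonic mode. -/
abbrev ModeState : Type := ℂ → ℂ

/-- The inner product `⟨F|G⟩` of one bosonic mode, antilinear in the first argument. -/
def modeInner (F G : ModeState) : ℂ :=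
  ∫ z : ℂ, conj (F z) * G z * ((Real.exp (-‖z‖ ^ 2) / Real.pi : ℝ) : ℂ)

/-- The annihilation operator `m`. -/
def annihilation (F : ModeState) : ModeState := deriv F

/-- The creation operator `m†`. -/
def creation (F : ModeState) : ModeState := fun z => z * F z

/-- The vacuum state `|0⟩` of the mode. -/
def vacuum : ModeState := fun _ => 1

/-- The number state `|n⟩ = (m†)ⁿ |0⟩ / √(n!)`. -/
def fockState (n : ℕ) : ModeState :=
  fun z => (creation^[n] vacuum) z / ((Real.sqrt (n.factorial : ℝ) : ℝ) : ℂ)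

/-- The displacement operator
`D(β) = exp (β m† - β* m) = exp (-|β|² / 2) exp (β m†) exp (-β* m)`. -/
def displacement (β : ℂ) (F : ModeState) : ModeState :=
  fun z => Complex.exp (β * z - ((‖β‖ ^ 2 / 2 : ℝ) : ℂ)) * F (z - conj β)

/-- The phase rotation `R(τ) = exp (-i τ m† m)`, which multiplies `|n⟩` by `exp (-i n τ)`. -/
def phaseRotation (τ : ℝ) (F : ModeState) : ModeState :=
  fun z => F (Complex.exp (-(Complex.I * τ)) * z)

/-- The squeezed vacuum `S(ζ)|0⟩`, with `S(ζ) = exp (ζ (m² - m†²) / 2)`. -/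
def squeezedVacuum (ζ : ℝ) : ModeState :=
  fun z => ((1 / Real.sqrt (Real.cosh ζ) : ℝ) : ℂ) *
    Complex.exp (-((Real.tanh ζ : ℝ) : ℂ) * z ^ 2 / 2)

/-- `t ↦ D(tβ)F` solves `u' = (β m† - β* m) u`, `u 0 = F`. -/
theorem hasDerivAt_displacement (β : ℂ) (F : ModeState) (hF : Differentiable ℂ F) (t : ℝ) (z : ℂ) :
    displacement ((0 : ℝ) * β) F = F ∧
    HasDerivAt (fun s : ℝ => displacement (s * β) F z)
      (β * creation (displacement (t * β) F) z
        - conj β * annihilation (displacement (t * β) F) z) t := by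
  have hD : ∀ (s : ℝ) (w : ℂ), displacement (s * β) F w =
      Complex.exp ((s : ℂ) * β * w - (s : ℂ) ^ 2 * (β * conj β / 2)) *
        F (w - (s : ℂ) * conj β) := by
    intro s w
    have hn : ((‖(s : ℂ) * β‖ ^ 2 / 2 : ℝ) : ℂ) = (s : ℂ) ^ 2 * (β * conj β / 2) := by
      rw [Complex.mul_conj, norm_mul, mul_pow, ← Complex.normSq_eq_norm_sq β, Complex.norm_real,
        Real.norm_eq_abs, sq_abs]
      push_cast
      ring
    simp only [displacement, hn, map_mul, Complex.conj_ofReal]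
  refine ⟨by funext w; simp [displacement], ?_⟩
  have h1 : HasDerivAt (fun s : ℝ => (s : ℂ)) 1 t := Complex.ofRealCLM.hasDerivAt
  have he := ((((h1.mul_const β).mul_const z).sub
    ((h1.pow 2).mul_const (β * conj β / 2))).cexp).mul
    ((hF (z - (t : ℂ) * conj β)).hasDerivAt.comp t ((h1.mul_const (conj β)).const_sub z))
  have hz : deriv (displacement (t * β) F) z = _ :=
    (((((hasDerivAt_id z).const_mul ((t : ℂ) * β)).sub_const
      ((t : ℂ) ^ 2 * (β * conj β / 2))).cexp).mul
      ((hF (z - (t : ℂ) * conj β)).hasDerivAt.comp z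
        ((hasDerivAt_id z).sub_const ((t : ℂ) * conj β)))).congr_of_eventuallyEq
      (Filter.Eventually.of_forall fun w => hD t w) |>.deriv
  refine (he.congr_of_eventuallyEq
    (Filter.Eventually.of_forall fun s => hD s z)).congr_deriv ?_
  simp only [creation, annihilation, hz, hD, Function.comp_apply, id, Pi.pow_apply, Pi.sub_apply]
  push_cast
  ring

/-- `τ ↦ R(τ)F` solves `u' = -i m† m u`, `u 0 = F`. -/
theorem hasDerivAt_phaseRotation (F : ModeState) (hF : Differentiable ℂ F) (τ : ℝ) (z : ℂ) :
    phaseRotation 0 F = F ∧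
    HasDerivAt (fun s : ℝ => phaseRotation s F z)
      (-(Complex.I * creation (annihilation (phaseRotation τ F)) z)) τ := by
  refine ⟨by funext w; simp [phaseRotation], ?_⟩
  have h1 : HasDerivAt (fun s : ℝ => (s : ℂ)) 1 τ := Complex.ofRealCLM.hasDerivAt
  have hz : deriv (phaseRotation τ F) z = _ :=
    ((hF (Complex.exp (-(Complex.I * τ)) * z)).hasDerivAt.comp z
      ((hasDerivAt_id z).const_mul (Complex.exp (-(Complex.I * τ))))).deriv
  have he := (hF (Complex.exp (-(Complex.I * τ)) * z)).hasDerivAt.comp τ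
    (((h1.const_mul Complex.I).neg.cexp).mul_const z)
  refine HasDerivAt.congr_deriv he ?_
  simp only [creation, annihilation, hz, Pi.neg_apply]
  ring

/-- `ζ ↦ S(ζ)|0⟩` solves `u' = (m² - m†²) u / 2`, `u 0 = |0⟩`. -/
theorem hasDerivAt_squeezedVacuum (ζ : ℝ) (z : ℂ) :
    squeezedVacuum 0 = vacuum ∧
    HasDerivAt (fun s : ℝ => squeezedVacuum s z)
      ((annihilation (annihilation (squeezedVacuum ζ)) z
        - creation (creation (squeezedVacuum ζ)) z) / 2) ζ := by
  refine ⟨by funext w; simp [squeezedVacuum, vacuum], ?_⟩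
  have hp := Real.cosh_pos ζ
  have hd : ∀ w, HasDerivAt (squeezedVacuum ζ)
      (-((Real.tanh ζ : ℝ) : ℂ) * w * squeezedVacuum ζ w) w := by
    intro w
    refine (((((hasDerivAt_id w).pow 2).const_mul (-((Real.tanh ζ : ℝ) : ℂ))).div_const
      2).cexp.const_mul ((1 / Real.sqrt (Real.cosh ζ) : ℝ) : ℂ)).congr_deriv ?_
    simp only [squeezedVacuum, id, Pi.pow_apply]
    push_cast
    ring
  have hd2 : deriv (deriv (squeezedVacuum ζ)) z = -((Real.tanh ζ : ℝ) : ℂ) * squeezedVacuum ζ z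
      + -((Real.tanh ζ : ℝ) : ℂ) * z * (-((Real.tanh ζ : ℝ) : ℂ) * z * squeezedVacuum ζ z) := by
    rw [show deriv (squeezedVacuum ζ) = fun w => -((Real.tanh ζ : ℝ) : ℂ) * w * squeezedVacuum ζ w
      from funext fun w => (hd w).deriv]
    refine (((hasDerivAt_id z).const_mul (-((Real.tanh ζ : ℝ) : ℂ))).mul (hd z)).deriv.trans ?_
    simp only [id]
    ring
  have hc : HasDerivAt (fun s : ℝ => ((1 / Real.sqrt (Real.cosh s) : ℝ) : ℂ))
      ((-(Real.tanh ζ / 2) * (1 / Real.sqrt (Real.cosh ζ)) : ℝ) : ℂ) ζ := by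
    have h := (((Real.hasDerivAt_cosh ζ).sqrt hp.ne').fun_inv (Real.sqrt_pos.2 hp).ne').ofReal_comp
    simp only [← one_div] at h
    refine h.congr_deriv ?_
    congr 1
    have hs := Real.sq_sqrt hp.le
    have hs0 := (Real.sqrt_pos.2 hp).ne'
    rw [Real.tanh_eq_sinh_div_cosh, hs]
    field_simp
  have ht : HasDerivAt (fun s : ℝ => ((Real.tanh s : ℝ) : ℂ))
      ((1 - Real.tanh ζ ^ 2 : ℝ) : ℂ) ζ := by
    have h : HasDerivAt Real.tanh (1 - Real.tanh ζ ^ 2) ζ := by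
      have h := (Real.hasDerivAt_sinh ζ).fun_div (Real.hasDerivAt_cosh ζ) hp.ne'
      rw [show Real.tanh = fun x => Real.sinh x / Real.cosh x from
        funext Real.tanh_eq_sinh_div_cosh]
      refine h.congr_deriv ?_
      field_simp
    exact h.ofReal_comp
  refine (hc.mul (((ht.neg.mul_const (z ^ 2)).div_const 2).cexp)).congr_deriv ?_
  simp only [annihilation, creation, hd2, squeezedVacuum, Pi.neg_apply]
  push_cast
  ring

/-- The pure one-mode Gaussian state `D(γ) R(τ) S(ζ) |0⟩`. -/
def gaussianState (γ : ℂ) (τ ζ : ℝ) : ModeState :=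
  displacement γ (phaseRotation τ (squeezedVacuum ζ))

/-!
### One qubit and one mode
-/

/-- A state of the qubit and the mode: `Ψ = |0⟩ ⊗ Ψ 0 + |1⟩ ⊗ Ψ 1`. -/
abbrev JointState : Type := Fin 2 → ModeState

/-- The inner product of the qubit-mode system. -/
def jointInner (Ψ Φ : JointState) : ℂ := ∑ a, modeInner (Ψ a) (Φ a)

/-- The initial state `|0⟩ ⊗ |0⟩`. -/
def initialState : JointState := ![vacuum, fun _ => 0]

/-- The Pauli matrix `σˣ`. -/
def pauliX : Matrix (Fin 2) (Fin 2) ℂ := !![0, 1; 1, 0]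

/-- The Pauli matrix `σʸ`. -/
def pauliY : Matrix (Fin 2) (Fin 2) ℂ := !![0, -Complex.I; Complex.I, 0]

/-- The qubit rotation `U_R(θ, φ) = exp (-i (θ / 2) (cos φ σˣ + sin φ σʸ))`. -/
def qubitRotation (θ φ : ℝ) : Matrix (Fin 2) (Fin 2) ℂ :=
  NormedSpace.exp ((-(Complex.I * (θ / 2))) •
    (((Real.cos φ : ℝ) : ℂ) • pauliX + ((Real.sin φ : ℝ) : ℂ) • pauliY))

/-- A qubit operator acting on the qubit-mode system. -/
def applyQubit (A : Matrix (Fin 2) (Fin 2) ℂ) (Ψ : JointState) : JointState :=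
  fun a z => ∑ b, A a b * Ψ b z

/-- The echoed conditional displacement `D(β) ⊗ |1⟩⟨0| + D(-β) ⊗ |0⟩⟨1|`. -/
def ecd (β : ℂ) (Ψ : JointState) : JointState :=
  ![displacement (-β) (Ψ 1), displacement β (Ψ 0)]

/-- The parameters `(β, θ, φ)` of an `L`-layer circuit on one qubit and one mode. -/
abbrev CircuitParams (L : ℕ) : Type := (Fin L → ℂ) × (Fin L → ℝ) × (Fin L → ℝ)

/-- The `L`-layer circuit `U = ∏ₗ U_ECD(βₗ) U_R(θₗ, φₗ)`; the first layer acts first. -/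
def circuit : (L : ℕ) → CircuitParams L → JointState → JointState
  | 0, _, Ψ => Ψ
  | L + 1, x, Ψ =>
      ecd (x.1 (Fin.last L))
        (applyQubit (qubitRotation (x.2.1 (Fin.last L)) (x.2.2 (Fin.last L)))
          (circuit L (fun i => x.1 i.castSucc, fun i => x.2.1 i.castSucc,
            fun i => x.2.2 i.castSucc) Ψ))

/-- The observable `O = |0⟩⟨0| ⊗ |ψ⟩⟨ψ|` for the preparation of the mode state `ψ`. -/
def targetObservable (ψ : ModeState) (Ψ : JointState) : JointState :=
  ![fun z => modeInner ψ (Ψ 0) * ψ z, fun _ => 0]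

/-- The cost function `C(x) = Tr[O U(x) ρ₀ U(x)†] = ⟨Ψ|O|Ψ⟩`, `Ψ = U(x)(|0⟩ ⊗ |0⟩)`. -/
def cost (ψ : ModeState) {L : ℕ} (x : CircuitParams L) : ℝ :=
  (jointInner (circuit L x initialState)
    (targetObservable ψ (circuit L x initialState))).re

/-- The cost as a function of the `k`-th rotation angle `θₖ`, the other parameters being those
of `x`. -/
def costAlong (ψ : ModeState) {L : ℕ} (k : Fin L) (x : CircuitParams L) (t : ℝ) : ℝ :=
  cost ψ ((x.1, Function.update x.2.1 k t, x.2.2) : CircuitParams L)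

/-- The partial derivative `∂C/∂θₖ` at `x`. -/
def costGradient (ψ : ModeState) {L : ℕ} (k : Fin L) (x : CircuitParams L) : ℝ :=
  deriv (costAlong ψ k x) (x.2.1 k)

/-!
### The energy-regularized ensemble
-/

/-- The centred complex Gaussian distribution of variance `v`: real and imaginary parts are
independent with variance `v / 2`. -/
def complexGaussian (v : ℝ) : Measure ℂ :=
  ((gaussianReal 0 (v / 2).toNNReal).prod (gaussianReal 0 (v / 2).toNNReal)).map
    (fun p : ℝ × ℝ => (⟨p.1, p.2⟩ : ℂ))

/-- The uniform distribution on `[0, 2π)`. -/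
def uniformAngle : Measure ℝ := ProbabilityTheory.cond volume (Set.Ico 0 (2 * Real.pi))

/-- The law of the parameters in the energy-regularized ensemble of `L`-layer one-mode circuits
of energy `E`: all parameters are independent, each `βₗ` is complex Gaussian of variance `E / L`,
and all angles are uniform on `[0, 2π)`. -/
def circuitEnsemble (E : ℝ) (L : ℕ) : Measure (CircuitParams L) :=
  (Measure.pi fun _ : Fin L => complexGaussian (E / L)).prod
    ((Measure.pi fun _ : Fin L => uniformAngle).prod (Measure.pi fun _ : Fin L => uniformAngle))

/-- The critical depth `ℓ_c(E) = log (κ E) / log (4 / 3)`, `κ` being an order-one constant. -/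
def criticalDepth (κ E : ℝ) : ℝ := Real.log (κ * E) / Real.log (4 / 3)

end

/-! As a function of the two angles of one layer, every amplitude of the circuit is cos(θ/2) u +
sin(θ/2) (cos φ v + sin φ w), so the cost is a trigonometric polynomial of degree one in θ. Its
θ-derivative therefore has mean zero. Averaged over the two angles, the squared derivative is at
most the mean of the squared cost (`integral_rotationSlope_sq_le`) and at least 1/18 of the square
of the mean cost (`integral_norm_sq_rotationAmplitude_sq_le`). The variance thus lies between (mean
of C)²/18 and the mean of C².

Lower bound. On average the qubit is equidistributed and the mode performs a random walk, whose
total displacement is Gaussian of variance E for every depth. The mean cost is half the integral of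
|⟨ψ|D(β)|0⟩|² against this law (`integral_layersCost`), which is at least of order 1/E because the
density is about 1/(πE) near the origin. No lower bound on the depth enters here.

Upper bound. Since ψ has room to spare below the growth exp(|z|²/2), C² is bounded by a Gaussian
average of the squared Husimi density of the circuit state, and it suffices to bound the mean of
that square at each point by O(1/E²). The square is a double integral of characteristic functions at
points ξ₁, ξ₂. Averaging one layer closes on three bilinear expressions: the parallel, antiparallel
and cross parts. The sum s = ξ₁ + ξ₂ is conserved. In t = (ξ₁ - ξ₂)/2 a layer multiplies the
parallel part by Q = exp(-v|s|²), multiplies the antiparallel part by a Gaussian, and convolves the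
cross part with a Gaussian. The cross part stays the planar Fourier transform of the antiparallel
part, so all is encoded in a pair (W, p) of radial functions, finite sums of exponentials in w =
2|t|², with the Fourier transform acting as `hankel` (`meanPart_eq_eval`).

On such pairs the averaged rotation and the averaged displacement are symmetric contractions, and
two mechanisms force decay. An uncertainty principle (`form_self_le_even_add_loss`) gives
exponential decay at the rate min(1 - Q², τ, 1) up to a constant (`pairing_layer_self_le`). A Nash
inequality, fed with sup bounds that come from |χ| ≤ 1, gives a squared norm of order 1/(τn)
(`pairing_excursion_le`). The component that never leaves W is only multiplied by 3Q/4 per layer,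
and (3/4)^L ≤ 1/(κE) is exactly the critical depth. Splitting the evolution into two halves by
symmetry gives a factor 1/E (`abs_form_ground_evolve_le_of_bounded`); the decay in s, on the scale
E^(-1/2), gives the second 1/E upon integration over the plane (`integral_displacementBound`). -/

noncomputable section

/-! ### Exponential sums: inner product, Hankel transform and damping. -/

/-- Finite real combinations of the functions `w ↦ exp (-s w)`, `s > 0`, of `w ≥ 0`. -/
abbrev ExpSum : Type := {s : ℝ // 0 < s} →₀ ℝ

namespace ExpSum

/-- The value at `w`. -/
def eval (w : ℝ) : ExpSum →ₗ[ℝ] ℝ := Finsupp.linearCombination ℝ fun s => Real.exp (-(s : ℝ) * w)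

/-- The inner product of `L²(0, ∞)`. -/
def form : ExpSum →ₗ[ℝ] ExpSum →ₗ[ℝ] ℝ :=
  Finsupp.linearCombination ℝ fun s => Finsupp.linearCombination ℝ fun t => 1 / ((s : ℝ) + t)

/-- The Hankel transform, the radial part of the Fourier transform of the plane. -/
def hankel : ExpSum →ₗ[ℝ] ExpSum :=
  Finsupp.linearCombination ℝ fun s =>
    Finsupp.single ⟨1 / (4 * s), by have := s.2; positivity⟩ (1 / (2 * s))

/-- Multiplication by `exp (-τ w)`. -/
def damp (τ : {s : ℝ // 0 < s}) : ExpSum →ₗ[ℝ] ExpSum :=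
  Finsupp.linearCombination ℝ fun s => Finsupp.single ⟨s + τ, add_pos s.2 τ.2⟩ 1

/-- The value at `0`. -/
def total : ExpSum →ₗ[ℝ] ℝ := Finsupp.linearCombination ℝ fun _ => 1

/-- Minus the derivative. -/
def negDeriv : ExpSum →ₗ[ℝ] ExpSum :=
  Finsupp.linearCombination ℝ fun s => Finsupp.single s (s : ℝ)

/-- The resolvent `(1 - d/dw)⁻¹`. -/
def resolvent : ExpSum →ₗ[ℝ] ExpSum :=
  Finsupp.linearCombination ℝ fun s => Finsupp.single s (1 / ((s : ℝ) + 1))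

variable (f g : ExpSum)

/-- Two bilinear expressions agree once they agree on the exponentials. -/
theorem bilin_ext {φ χ : ExpSum →ₗ[ℝ] ExpSum →ₗ[ℝ] ℝ}
    (h : ∀ s t, φ (Finsupp.single s 1) (Finsupp.single t 1)
      = χ (Finsupp.single s 1) (Finsupp.single t 1)) : φ = χ := by
  refine Finsupp.lhom_ext' fun s => LinearMap.ext_ring ?_
  exact Finsupp.lhom_ext' fun t => LinearMap.ext_ring (h s t)

theorem form_single (s t : {s : ℝ // 0 < s}) (a b : ℝ) :
    form (Finsupp.single s a) (Finsupp.single t b) = a * b / ((s : ℝ) + t) := by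
  simp [form, Finsupp.linearCombination_single]
  ring

theorem eval_single (s : {s : ℝ // 0 < s}) (a w : ℝ) :
    eval w (Finsupp.single s a) = a * Real.exp (-(s : ℝ) * w) := by
  simp [eval, Finsupp.linearCombination_single]

theorem hankel_single (s : {s : ℝ // 0 < s}) (a : ℝ) :
    hankel (Finsupp.single s a)
      = Finsupp.single ⟨1 / (4 * s), by have := s.2; positivity⟩ (a * (1 / (2 * s))) := by
  rw [hankel, Finsupp.linearCombination_single, Finsupp.smul_single, smul_eq_mul]

theorem damp_single (τ s : {s : ℝ // 0 < s}) (a : ℝ) :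
    damp τ (Finsupp.single s a) = Finsupp.single ⟨s + τ, add_pos s.2 τ.2⟩ a := by
  simp [damp, Finsupp.linearCombination_single]

theorem form_comm : form f g = form g f := by
  have : form = form.flip := bilin_ext fun s t => by
    simp only [LinearMap.flip_apply, form_single]; rw [add_comm]
  conv_lhs => rw [this]
  rfl

/-- Plancherel's identity, which on exponentials is the algebraic identity 1/(4st) · 1/(1/(4s) +
1/(4t)) = 1/(s + t). Together with `hankel_hankel`, which rests on the involution s ↦ 1/(4s), it
makes `hankel` a self-adjoint unitary with eigenvalues ±1. -/
theorem form_hankel_hankel : form (hankel f) (hankel g) = form f g := by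
  have : (form.compl₁₂ hankel hankel) = form := bilin_ext fun s t => by
    have hs := s.2
    have ht := t.2
    simp only [LinearMap.compl₁₂_apply, form_single, hankel_single]
    field_simp
    ring
  exact LinearMap.congr_fun₂ this f g

theorem hankel_hankel : hankel (hankel f) = f := by
  have : hankel ∘ₗ hankel = LinearMap.id := by
    refine Finsupp.lhom_ext' fun s => LinearMap.ext_ring ?_
    have hs := s.2
    simp only [LinearMap.comp_apply, Finsupp.lsingle_apply, hankel_single, LinearMap.id_apply]
    congr 1
    · apply Subtype.ext; simp; field_simp
    · field_simp; norm_num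
  exact LinearMap.congr_fun this f

theorem form_hankel_left : form (hankel f) g = form f (hankel g) := by
  conv_lhs => rw [← hankel_hankel g]
  exact form_hankel_hankel _ _

theorem form_damp_left (τ) : form (damp τ f) g = form f (damp τ g) := by
  have : (form.compl₁₂ (damp τ) LinearMap.id) = form.compl₁₂ LinearMap.id (damp τ) :=
    bilin_ext fun s t => by
      simp only [LinearMap.compl₁₂_apply, form_single, damp_single, LinearMap.id_apply]
      congr 1
      ring
  exact LinearMap.congr_fun₂ this f g

theorem eval_damp (τ : {s : ℝ // 0 < s}) (w : ℝ) :
    eval w (damp τ f) = Real.exp (-(τ : ℝ) * w) * eval w f := by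
  have : eval w ∘ₗ damp τ = Real.exp (-(τ : ℝ) * w) • eval w := by
    refine Finsupp.lhom_ext' fun s => LinearMap.ext_ring ?_
    simp only [LinearMap.comp_apply, Finsupp.lsingle_apply, damp_single, eval_single,
      LinearMap.smul_apply, smul_eq_mul, one_mul]
    rw [← Real.exp_add]
    congr 1
    ring
  exact LinearMap.congr_fun this f

/-- The bridge from the algebraic `form` to integrals. Positivity of `form` and every pointwise
estimate enter through it. -/
theorem integrable_eval_mul_eval_and_form_eq :
    IntegrableOn (fun w => eval w f * eval w g) (Set.Ioi 0) ∧
      form f g = ∫ w in Set.Ioi (0 : ℝ), eval w f * eval w g := by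
  induction f using Finsupp.induction_linear with
  | zero => simp
  | add f₁ f₂ h₁ h₂ =>
    simp only [map_add, add_mul, LinearMap.add_apply]
    exact ⟨h₁.1.add h₂.1, by rw [integral_add h₁.1 h₂.1, h₁.2, h₂.2]⟩
  | single s a =>
    induction g using Finsupp.induction_linear with
    | zero => simp
    | add f₁ f₂ h₁ h₂ =>
      simp only [map_add, mul_add]
      exact ⟨h₁.1.add h₂.1, by rw [integral_add h₁.1 h₂.1, h₁.2, h₂.2]⟩
    | single t b =>
      have hst : 0 < (s : ℝ) + t := add_pos s.2 t.2
      have h : (fun w => eval w (Finsupp.single s a) * eval w (Finsupp.single t b))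
          = fun w => a * b * Real.exp (-((s : ℝ) + t) * w) := by
        funext w
        rw [eval_single, eval_single, mul_mul_mul_comm, ← Real.exp_add]
        congr 2
        ring
      rw [h, form_single]
      refine ⟨(integrableOn_exp_mul_Ioi (by linarith) 0).const_mul _, ?_⟩
      rw [integral_const_mul, integral_exp_mul_Ioi (by linarith)]
      simp only [mul_zero, Real.exp_zero]
      field_simp

theorem form_self_nonneg : 0 ≤ form f f := by
  rw [(integrable_eval_mul_eval_and_form_eq f f).2]
  exact integral_nonneg fun w => mul_self_nonneg _

theorem form_sq_le : form f g ^ 2 ≤ form f f * form g g := by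
  have h := LinearMap.BilinForm.apply_mul_apply_le_of_forall_zero_le form form_self_nonneg f g
  rw [form_comm g f] at h
  nlinarith [h]

theorem form_add_self_le : form (f + g) (f + g) ≤ 2 * form f f + 2 * form g g := by
  have h := form_self_nonneg (f - g)
  simp only [map_add, map_sub, LinearMap.add_apply, LinearMap.sub_apply, form_comm g f] at *
  linarith

theorem form_hankel_self_le : form f (hankel f) ≤ form f f := by
  have h := form_self_nonneg (f - hankel f)
  simp only [map_sub, LinearMap.sub_apply, form_hankel_hankel, form_comm (hankel f) f] at h
  linarith

theorem neg_form_self_le : -form f f ≤ form f (hankel f) := by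
  have h := form_self_nonneg (f + hankel f)
  simp only [map_add, LinearMap.add_apply, form_hankel_hankel, form_comm (hankel f) f] at h
  linarith

/-- The loss of the squared norm under damping. -/
def loss (τ : {s : ℝ // 0 < s}) : ℝ := form f f - form (damp τ f) (damp τ f)

theorem integrable_sq : IntegrableOn (fun w => eval w f ^ 2) (Set.Ioi 0) := by
  simpa only [sq] using (integrable_eval_mul_eval_and_form_eq f f).1

theorem form_self_eq : form f f = ∫ w in Set.Ioi (0 : ℝ), eval w f ^ 2 := by
  simpa only [sq] using (integrable_eval_mul_eval_and_form_eq f f).2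

theorem integrable_loss (τ : {s : ℝ // 0 < s}) :
    IntegrableOn (fun w => (1 - Real.exp (-(τ : ℝ) * w) ^ 2) * eval w f ^ 2) (Set.Ioi 0) := by
  refine ((integrable_sq f).sub (integrable_sq (damp τ f))).congr_fun (fun w _ => ?_)
    measurableSet_Ioi
  simp only [eval_damp, Pi.sub_apply]
  ring

theorem loss_eq (τ : {s : ℝ // 0 < s}) :
    loss f τ = ∫ w in Set.Ioi (0 : ℝ), (1 - Real.exp (-(τ : ℝ) * w) ^ 2) * eval w f ^ 2 := by
  rw [loss, form_self_eq, form_self_eq, ← integral_sub (integrable_sq f) (integrable_sq _)]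
  refine integral_congr_ae (ae_of_all _ fun w => ?_)
  simp only [eval_damp]
  ring

theorem exp_neg_mul_le_one (τ : {s : ℝ // 0 < s}) {w : ℝ} (hw : 0 < w) :
    Real.exp (-(τ : ℝ) * w) ≤ 1 := by
  have := τ.2
  rw [Real.exp_le_one_iff]
  nlinarith [mul_pos this hw]

theorem loss_nonneg (τ : {s : ℝ // 0 < s}) : 0 ≤ loss f τ := by
  rw [loss_eq]
  refine setIntegral_nonneg measurableSet_Ioi fun w hw => mul_nonneg ?_ (sq_nonneg _)
  have h := exp_neg_mul_le_one τ hw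
  have h0 := Real.exp_pos (-(τ : ℝ) * w)
  nlinarith

/-- The function τ ↦ 1 - exp(-2τw) is increasing, which settles τ ≥ 1, and concave with value 0 at
0, which settles τ ≤ 1. -/
theorem min_mul_loss_one_le (τ : {s : ℝ // 0 < s}) :
    min (τ : ℝ) 1 * loss f ⟨1, one_pos⟩ ≤ loss f τ := by
  rw [loss_eq, loss_eq, ← integral_const_mul]
  refine setIntegral_mono_on ((integrable_loss f _).const_mul _) (integrable_loss f _)
    measurableSet_Ioi fun w hw => ?_
  rw [← mul_assoc]
  refine mul_le_mul_of_nonneg_right ?_ (sq_nonneg _)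
  have hw : 0 < w := hw
  have hτ := τ.2
  simp only [← Real.exp_nat_mul]
  push_cast
  have h1 : Real.exp (2 * (-1 * w)) ≤ 1 := Real.exp_le_one_iff.2 (by linarith)
  rcases le_total (1 : ℝ) τ with h | h
  · rw [min_eq_right h]
    have : Real.exp (2 * (-(τ : ℝ) * w)) ≤ Real.exp (2 * (-1 * w)) :=
      Real.exp_le_exp.2 (by nlinarith)
    linarith
  · rw [min_eq_left h]
    have := convexOn_exp.2 (Set.mem_univ (0 : ℝ)) (Set.mem_univ (2 * (-1 * w)))
      (sub_nonneg.2 h) hτ.le (by ring)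
    simp only [smul_eq_mul, mul_zero, zero_add, Real.exp_zero, mul_one] at this
    rw [show 2 * (-(τ : ℝ) * w) = τ * (2 * (-1 * w)) by ring]
    linarith

/-- A Nash inequality: high frequencies are damped, low ones are controlled by a sup norm. -/
theorem nash (τ : {s : ℝ // 0 < s}) {R S : ℝ} (hR : 0 < R)
    (hS : ∀ w, 0 < w → |eval w f| ≤ S) :
    (1 - Real.exp (-(τ : ℝ) * R) ^ 2) * (form f f - R * S ^ 2) ≤ loss f τ := by
  have hτ := τ.2
  have hi : IntegrableOn ((Set.Iic R).indicator fun _ => S ^ 2) (Set.Ioi 0) := by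
    rw [IntegrableOn, integrable_indicator_iff measurableSet_Iic, IntegrableOn,
      Measure.restrict_restrict measurableSet_Iic]
    refine integrableOn_const ?_
    rw [Set.Iic_inter_Ioi]
    simp
  have hv : ∫ w in Set.Ioi (0 : ℝ), (Set.Iic R).indicator (fun _ => S ^ 2) w = R * S ^ 2 := by
    rw [setIntegral_indicator measurableSet_Iic, Set.inter_comm, Set.Iic_inter_Ioi,
      setIntegral_const]
    simp [hR.le]
  rw [form_self_eq, ← hv, ← integral_sub (integrable_sq f) hi, loss_eq, ← integral_const_mul]
  refine setIntegral_mono_on (((integrable_sq f).sub hi).const_mul _) (integrable_loss f _)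
    measurableSet_Ioi fun w hw => ?_
  have hw : 0 < w := hw
  have hR1 := exp_neg_mul_le_one τ hR
  have hR0 := Real.exp_pos (-(τ : ℝ) * R)
  have hw1 := exp_neg_mul_le_one τ hw
  have hw0 := Real.exp_pos (-(τ : ℝ) * w)
  have hA : 0 ≤ 1 - Real.exp (-(τ : ℝ) * R) ^ 2 := by nlinarith
  have hB : 0 ≤ 1 - Real.exp (-(τ : ℝ) * w) ^ 2 := by nlinarith
  -- Below R the sup bound makes the left integrand nonpositive; above R the indicator vanishes and
  -- the damping factor is at least its value at R.
  by_cases h : w ≤ R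
  · rw [Set.indicator_of_mem (show w ∈ Set.Iic R from h)]
    have : eval w f ^ 2 ≤ S ^ 2 := sq_le_sq' (by linarith [(abs_le.1 (hS w hw)).1])
      (abs_le.1 (hS w hw)).2
    exact (mul_nonpos_of_nonneg_of_nonpos hA (by linarith)).trans (mul_nonneg hB (sq_nonneg _))
  · rw [Set.indicator_of_notMem (show w ∉ Set.Iic R from h), sub_zero]
    refine mul_le_mul_of_nonneg_right ?_ (sq_nonneg _)
    have : Real.exp (-(τ : ℝ) * w) ≤ Real.exp (-(τ : ℝ) * R) := Real.exp_le_exp.2 (by nlinarith)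
    nlinarith

/-! ### An uncertainty principle for the Hankel transform. -/

theorem total_single (s : {s : ℝ // 0 < s}) (a : ℝ) : total (Finsupp.single s a) = a := by
  simp [total, Finsupp.linearCombination_single]

theorem negDeriv_single (s : {s : ℝ // 0 < s}) (a : ℝ) :
    negDeriv (Finsupp.single s a) = Finsupp.single s (a * s) := by
  rw [negDeriv, Finsupp.linearCombination_single, Finsupp.smul_single, smul_eq_mul]

theorem resolvent_single (s : {s : ℝ // 0 < s}) (a : ℝ) :
    resolvent (Finsupp.single s a) = Finsupp.single s (a * (1 / ((s : ℝ) + 1))) := by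
  rw [resolvent, Finsupp.linearCombination_single, Finsupp.smul_single, smul_eq_mul]

/-- With g the resolvent of f one has f = g - g'. Expanding the square and integrating -2gg' to
g(0)² gives ‖f‖² = g(0)² + ‖g‖² + ‖g'‖². -/
theorem form_resolvent_self_le : form (resolvent f) (resolvent f) ≤ form f f := by
  have : form = (LinearMap.mul ℝ ℝ).compl₁₂ (total ∘ₗ resolvent) (total ∘ₗ resolvent)
      + form.compl₁₂ resolvent resolvent
      + form.compl₁₂ (negDeriv ∘ₗ resolvent) (negDeriv ∘ₗ resolvent) := bilin_ext fun s t => by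
    have hs := s.2
    have ht := t.2
    simp only [LinearMap.add_apply, LinearMap.compl₁₂_apply, LinearMap.comp_apply, form_single,
      resolvent_single, negDeriv_single, total_single, LinearMap.mul_apply']
    field_simp
    ring
  have h := LinearMap.congr_fun₂ this f f
  simp only [LinearMap.add_apply, LinearMap.compl₁₂_apply, LinearMap.comp_apply,
    LinearMap.mul_apply'] at h
  have h1 := form_self_nonneg (negDeriv (resolvent f))
  have h2 := mul_self_nonneg (total (resolvent f))
  linarith

/-- Put a = s + 1 and b = t + 1. The left pairing of two exponentials is 2/(4ab + 1), which equals
1/(2ab) - (1/4) · (1/(ab)) · 2/(4ab + 1). The first term is half a rank-one square; the second is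
the same pairing at the resolvent of f, with coefficient -1/4. Since `hankel`, damping and the
resolvent are contractions, only -‖f‖²/4 can be lost. So a damped function cannot be nearly odd
under the Hankel transform. -/
theorem form_damp_hankel_damp_ge :
    -(form f f / 4) ≤ form (damp ⟨1, one_pos⟩ f) (hankel (damp ⟨1, one_pos⟩ f)) := by
  set D := damp ⟨1, one_pos⟩ with hD
  have : form.compl₁₂ D (hankel ∘ₗ D)
      = (1 / 2 : ℝ) • (LinearMap.mul ℝ ℝ).compl₁₂ (total ∘ₗ resolvent) (total ∘ₗ resolvent)
      - (1 / 4 : ℝ) • form.compl₁₂ (D ∘ₗ resolvent) (hankel ∘ₗ D ∘ₗ resolvent) :=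
    bilin_ext fun s t => by
      have hs := s.2
      have ht := t.2
      simp only [hD, LinearMap.sub_apply, LinearMap.smul_apply, smul_eq_mul,
        LinearMap.compl₁₂_apply, LinearMap.comp_apply, form_single, hankel_single, damp_single,
        resolvent_single, total_single, LinearMap.mul_apply']
      field_simp
      ring
  have h := LinearMap.congr_fun₂ this f f
  simp only [LinearMap.sub_apply, LinearMap.smul_apply, smul_eq_mul, LinearMap.compl₁₂_apply,
    LinearMap.comp_apply, LinearMap.mul_apply'] at h
  have h1 := form_hankel_self_le (D (resolvent f))
  have h2 := loss_nonneg (resolvent f) ⟨1, one_pos⟩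
  have h3 := form_resolvent_self_le f
  have h4 := mul_self_nonneg (total (resolvent f))
  rw [loss] at h2
  linarith

/-- An uncertainty principle: a function close to an odd one is damped. -/
theorem form_self_le_even_add_loss :
    form f f ≤ form (f + hankel f) (f + hankel f) + 10 * loss f ⟨1, one_pos⟩ := by
  set e := damp ⟨1, one_pos⟩ f with he
  set r := f - e with hr
  have hf : f = e + r := by rw [hr]; abel
  have h1 := form_damp_hankel_damp_ge f
  rw [← he] at h1
  have hrr : form r r ≤ loss f ⟨1, one_pos⟩ := by
    rw [loss_eq, form_self_eq]
    refine setIntegral_mono_on (integrable_sq r) (integrable_loss f _)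
      measurableSet_Ioi fun w hw => ?_
    have h1 := exp_neg_mul_le_one ⟨1, one_pos⟩ hw
    have h0 := Real.exp_pos (-(((⟨1, one_pos⟩ : {s : ℝ // 0 < s}) : ℝ)) * w)
    rw [hr, he, map_sub, eval_damp]
    have : 0 ≤ eval w f ^ 2 := sq_nonneg _
    nlinarith [mul_nonneg (mul_nonneg h0.le (sub_nonneg.2 h1)) this]
  have hee : form e e ≤ form f f := by
    have := loss_nonneg f ⟨1, one_pos⟩
    rw [loss] at this
    linarith
  have hcs := form_sq_le e (hankel r)
  rw [form_hankel_hankel] at hcs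
  have hr1 := neg_form_self_le r
  -- In ⟨f, Hf⟩ the three terms are at least -‖f‖²/4, -2(‖f‖²/8 + 2‖r‖²) and -‖r‖², in total -‖f‖²/2
  -- - 5‖r‖². This is where the factor 10 in front of the loss comes from.
  have hff : form f (hankel f) = form e (hankel e) + 2 * form e (hankel r) + form r (hankel r) := by
    conv_lhs => rw [hf]
    simp only [map_add, LinearMap.add_apply, ← form_hankel_left r e, form_comm (hankel r) e]
    ring
  have hsum : form (f + hankel f) (f + hankel f) = 2 * form f f + 2 * form f (hankel f) := by
    simp only [map_add, LinearMap.add_apply, form_hankel_hankel, form_comm (hankel f) f]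
    ring
  have hx := form_self_nonneg f
  have hy := form_self_nonneg r
  have hcs' : form e (hankel r) ^ 2 ≤ form f f * form r r := hcs.trans (by gcongr)
  -- Weighted arithmetic-geometric mean inequality: √(xy) ≤ x/8 + 2y.
  have hlow : -(form f f / 8 + 2 * form r r) ≤ form e (hankel r) := by
    refine (abs_le_of_sq_le_sq' (hcs'.trans ?_) (by positivity)).1
    nlinarith [sq_nonneg (form f f / 8 - 2 * form r r)]
  rw [hsum, hff]
  linarith

end ExpSum

/-! ### The averaged layer as a contraction on pairs of radial functions. -/

namespace ExpSum

/-- The component of a pair `(W, p)` that the averaged rotation contracts. -/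
def defect : ExpSum × ExpSum →ₗ[ℝ] ExpSum :=
  LinearMap.fst ℝ _ _ - LinearMap.snd ℝ _ _ - hankel ∘ₗ LinearMap.snd ℝ _ _

/-- The averaged qubit rotation. -/
def rotate : ExpSum × ExpSum →ₗ[ℝ] ExpSum × ExpSum :=
  (LinearMap.fst ℝ _ _ - (1 / 4 : ℝ) • defect).prod (LinearMap.snd ℝ _ _ + (1 / 4 : ℝ) • defect)

/-- The averaged conditional displacement. -/
def displace (Q : ℝ) (τ : {s : ℝ // 0 < s}) : ExpSum × ExpSum →ₗ[ℝ] ExpSum × ExpSum :=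
  (Q • LinearMap.fst ℝ _ _).prod (damp τ ∘ₗ LinearMap.snd ℝ _ _)

/-- One averaged layer. -/
def layer (Q : ℝ) (τ : {s : ℝ // 0 < s}) : ExpSum × ExpSum →ₗ[ℝ] ExpSum × ExpSum :=
  displace Q τ ∘ₗ rotate

/-- The inner product of pairs `(W, p)`. -/
def pairing (u v : ExpSum × ExpSum) : ℝ := form u.1 v.1 / 2 + form u.2 v.2

/-- The initial pair: both modes are in the vacuum. -/
def ground : ExpSum × ExpSum := (Finsupp.single ⟨1 / 2, by norm_num⟩ 1, 0)

/-- The pair after `n` averaged layers. -/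
def evolve (Q : ℝ) (τ : {s : ℝ // 0 < s}) (n : ℕ) : ExpSum × ExpSum := (layer Q τ)^[n] ground

theorem defect_apply (u : ExpSum × ExpSum) : defect u = u.1 - u.2 - hankel u.2 := rfl

theorem rotate_fst (u : ExpSum × ExpSum) : (rotate u).1 = u.1 - (1 / 4 : ℝ) • defect u := rfl

theorem rotate_snd (u : ExpSum × ExpSum) : (rotate u).2 = u.2 + (1 / 4 : ℝ) • defect u := rfl

theorem displace_fst (Q : ℝ) (τ) (u : ExpSum × ExpSum) : (displace Q τ u).1 = Q • u.1 := rfl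

theorem displace_snd (Q : ℝ) (τ) (u : ExpSum × ExpSum) : (displace Q τ u).2 = damp τ u.2 := rfl

theorem layer_fst (Q : ℝ) (τ) (u : ExpSum × ExpSum) : (layer Q τ u).1 = Q • (rotate u).1 := rfl

theorem layer_snd (Q : ℝ) (τ) (u : ExpSum × ExpSum) : (layer Q τ u).2 = damp τ (rotate u).2 := rfl

theorem evolve_zero (Q : ℝ) (τ) : evolve Q τ 0 = ground := rfl

theorem evolve_succ (Q : ℝ) (τ) (n : ℕ) : evolve Q τ (n + 1) = layer Q τ (evolve Q τ n) :=
  Function.iterate_succ_apply' _ _ _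

variable {Q : ℝ} {τ : {s : ℝ // 0 < s}} {u v : ExpSum × ExpSum}

/-- Evenness of the first component under `hankel` is the standing invariant of the evolution. It
makes the defect even, which the symmetry of `rotate` requires. -/
theorem hankel_defect (hu : hankel u.1 = u.1) : hankel (defect u) = defect u := by
  rw [defect_apply, map_sub, map_sub, hu, hankel_hankel]
  abel

theorem hankel_rotate_fst (hu : hankel u.1 = u.1) : hankel (rotate u).1 = (rotate u).1 := by
  rw [rotate_fst, map_sub, map_smul, hankel_defect hu, hu]

theorem hankel_layer_fst (hu : hankel u.1 = u.1) : hankel (layer Q τ u).1 = (layer Q τ u).1 := by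
  rw [layer_fst, map_smul, hankel_rotate_fst hu]

theorem hankel_ground_fst : hankel ground.1 = ground.1 := by
  rw [ground, hankel_single]
  congr 1
  · apply Subtype.ext; norm_num
  · norm_num

theorem hankel_evolve_fst (n : ℕ) : hankel (evolve Q τ n).1 = (evolve Q τ n).1 := by
  induction n with
  | zero => exact hankel_ground_fst
  | succ n ih => rw [evolve_succ]; exact hankel_layer_fst ih

theorem pairing_comm (u v : ExpSum × ExpSum) : pairing u v = pairing v u := by
  rw [pairing, pairing, form_comm, form_comm v.2]

theorem pairing_self_nonneg (u : ExpSum × ExpSum) : 0 ≤ pairing u u := by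
  have := form_self_nonneg u.1
  have := form_self_nonneg u.2
  rw [pairing]
  positivity

/-- The pairing is half the L² inner product of the triples (W, p, Hp), as p and Hp have equal
norms. On these triples the rotation is I - nnᵀ/4 with n = (1, -1, -1), and the defect is the
component along n; symmetry is then visible. -/
theorem pairing_rotate_left (hu : hankel u.1 = u.1) :
    pairing (rotate u) v = pairing u v - form (defect u) (defect v) / 8 := by
  have h : form (defect u) v.2 = form (defect u) (hankel v.2) := by
    conv_lhs => rw [← hankel_defect hu]
    rw [form_hankel_left]
  simp only [pairing, rotate_fst, rotate_snd, defect_apply v, map_sub, map_add, map_smul,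
    LinearMap.sub_apply, LinearMap.add_apply, LinearMap.smul_apply, smul_eq_mul]
  linarith

theorem pairing_rotate_comm (hv : hankel v.1 = v.1) (hu : hankel u.1 = u.1) :
    pairing (rotate u) v = pairing u (rotate v) := by
  rw [pairing_comm u, pairing_rotate_left hu, pairing_rotate_left hv, pairing_comm,
    form_comm]

/-- The constant is 5/32 = 2 · 1/8 - (1/16)(1/2 + 1): twice the first-order term of
`pairing_rotate_left`, less the squared norm of the correction. -/
theorem pairing_rotate_self (hu : hankel u.1 = u.1) :
    pairing (rotate u) (rotate u) = pairing u u - 5 / 32 * form (defect u) (defect u) := by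
  have h : form (defect u) u.2 = form (defect u) (hankel u.2) := by
    conv_lhs => rw [← hankel_defect hu]
    rw [form_hankel_left]
  have h1 : form (defect u) (defect u)
      = form (defect u) u.1 - form (defect u) u.2 - form (defect u) (hankel u.2) := by
    conv_lhs => rw [defect_apply u, map_sub, map_sub, ← defect_apply u]
  simp only [pairing, rotate_fst, rotate_snd, map_sub, map_add, map_smul,
    LinearMap.sub_apply, LinearMap.add_apply, LinearMap.smul_apply, smul_eq_mul,
    form_comm u.1 (defect u), form_comm u.2 (defect u)]
  linarith

theorem pairing_rotate_self_le (hu : hankel u.1 = u.1) :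
    pairing (rotate u) (rotate u) ≤ pairing u u := by
  rw [pairing_rotate_self hu]
  linarith [form_self_nonneg (defect u)]

theorem pairing_displace (u v : ExpSum × ExpSum) :
    pairing (displace Q τ u) v = pairing u (displace Q τ v) := by
  simp only [pairing, displace_fst, displace_snd, map_smul, LinearMap.smul_apply, form_damp_left]

theorem pairing_layer_self (hu : hankel u.1 = u.1) :
    pairing (layer Q τ u) (layer Q τ u) = pairing u u - 5 / 32 * form (defect u) (defect u)
      - (1 - Q ^ 2) / 2 * form (rotate u).1 (rotate u).1 - loss (rotate u).2 τ := by
  rw [← pairing_rotate_self hu, loss]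
  simp only [pairing, layer_fst, layer_snd, map_smul, LinearMap.smul_apply, smul_eq_mul]
  ring

theorem rotate_fst_eq_add (hu : hankel u.1 = u.1) : (rotate u).1
    = (rotate u).2 + hankel (rotate u).2 + (1 / 4 : ℝ) • defect u := by
  have : u.1 = defect u + u.2 + hankel u.2 := by rw [defect_apply]; abel
  rw [rotate_fst, rotate_snd, map_add, map_smul, hankel_defect hu]
  conv_lhs => rw [this]
  module

/-- The rate at which a layer contracts. -/
def rate (Q : ℝ) (τ : {s : ℝ // 0 < s}) : ℝ := min (1 - Q ^ 2) (min (τ : ℝ) 1)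

/-- A layer loses norm in three ways: through the defect, through the factor Q on W, and through the
damping of p. A vector avoiding all three losses would have small defect and small W, so that its p
would be nearly odd, yet undamped; the uncertainty principle forbids this. -/
theorem pairing_layer_self_le (hQ : 0 ≤ Q) (hQ1 : Q ≤ 1) (hu : hankel u.1 = u.1) :
    pairing (layer Q τ u) (layer Q τ u) ≤ (1 - rate Q τ / 10) * pairing u u := by
  have hτ := τ.2
  have h1 := pairing_rotate_self hu
  rw [pairing_layer_self hu]
  have h2 := form_self_le_even_add_loss (rotate u).2
  have h3 : (rotate u).2 + hankel (rotate u).2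
      = (rotate u).1 + (-(1 / 4 : ℝ)) • defect u := by
    rw [rotate_fst_eq_add hu]; module
  have h4 := form_add_self_le (rotate u).1 ((-(1 / 4 : ℝ)) • defect u)
  rw [← h3] at h4
  simp only [map_smul, LinearMap.smul_apply, smul_eq_mul] at h4
  have h5 := min_mul_loss_one_le (rotate u).2 τ
  have hm0 : 0 ≤ rate Q τ := le_min (by nlinarith) (le_min hτ.le one_pos.le)
  have hm1 : rate Q τ ≤ 1 - Q ^ 2 := min_le_left _ _
  have hm2 : rate Q τ ≤ min (τ : ℝ) 1 := min_le_right _ _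
  have hm3 : rate Q τ ≤ 1 := hm2.trans (min_le_right _ _)
  have hd := form_self_nonneg (defect u)
  have hw := form_self_nonneg (rotate u).1
  have hl := loss_nonneg (rotate u).2 ⟨1, one_pos⟩
  -- After the rotation, p + Hp = W - d/4 with d the old defect. Hence ‖p‖² ≤ 2‖W‖² + ‖d‖²/8 + 10 ·
  -- loss, and each of the three terms here is covered, with the factor rate/10, by one of the three
  -- losses.
  have hN : pairing u u ≤ 5 / 2 * form (rotate u).1 (rotate u).1
      + 9 / 32 * form (defect u) (defect u) + 10 * loss (rotate u).2 ⟨1, one_pos⟩ := by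
    rw [pairing] at h1
    linarith
  have e1 := mul_le_mul_of_nonneg_right hm1 hw
  have e2 := mul_le_mul_of_nonneg_right hm2 hl
  have e3 := mul_le_mul_of_nonneg_right hm3 hd
  have e4 := mul_le_mul_of_nonneg_left hN hm0
  have e5 : 0 ≤ (1 - Q ^ 2) * form (rotate u).1 (rotate u).1 := mul_nonneg (by nlinarith) hw
  nlinarith

/-- A discrete form of N' ≤ -c τ N², which makes τN decay like 1/n. The bound on τN is the range in
which the damping factor in `nash` is still comparable to its linearization τR. -/
theorem pairing_layer_self_le_of_eval_le {S : ℝ} (hS : 0 < S) (hQ : 0 ≤ Q) (hQ1 : Q ≤ 1)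
    (hu : hankel u.1 = u.1) (hb : ∀ w, 0 < w → |eval w (rotate u).2| ≤ S)
    (hz : (τ : ℝ) * pairing u u ≤ 5 * S ^ 2) :
    pairing (layer Q τ u) (layer Q τ u)
      ≤ pairing u u - (τ : ℝ) * pairing u u ^ 2 / (100 * S ^ 2) := by
  have hτ := τ.2
  set N := pairing u u with hN
  -- The cutoff R below is proportional to the squared norm and must be positive, so norm zero is
  -- treated apart.
  rcases (pairing_self_nonneg u).eq_or_lt with h0 | h0
  · have := pairing_layer_self_le (τ := τ) hQ hQ1 hu
    rw [← h0, mul_zero] at this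
    rw [hN, ← h0]
    simpa using this
  rw [pairing_layer_self hu, ← hN]
  have hd := form_self_nonneg (defect u)
  have hw := form_self_nonneg (rotate u).1
  have h1 := pairing_rotate_self hu
  have h4 := form_add_self_le ((rotate u).2 + hankel (rotate u).2) ((1 / 4 : ℝ) • defect u)
  rw [← rotate_fst_eq_add hu] at h4
  have h5 := form_add_self_le (rotate u).2 (hankel (rotate u).2)
  rw [form_hankel_hankel] at h5
  simp only [map_smul, LinearMap.smul_apply, smul_eq_mul] at h4
  have hle : N ≤ 5 * form (rotate u).2 (rotate u).2
      + 7 / 32 * form (defect u) (defect u) := by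
    rw [pairing, ← hN] at h1
    linarith
  -- Up to the defect, ‖p‖² ≥ N/5. This cutoff concedes R S² = N/10 to low w, half of that, so the
  -- other half is damped.
  set R := N / (10 * S ^ 2) with hR
  have hR0 : 0 < R := by positivity
  have hn := nash (rotate u).2 τ hR0 hb
  set m := 1 - Real.exp (-(τ : ℝ) * R) ^ 2 with hm
  have hm1 : m ≤ 1 := by rw [hm]; nlinarith [sq_nonneg (Real.exp (-(τ : ℝ) * R))]
  have hx : (τ : ℝ) * R ≤ 1 / 2 := by
    rw [hR, ← mul_div_assoc, div_le_iff₀ (by positivity)]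
    linarith
  have hm2 : (τ : ℝ) * R ≤ m := by
    have hx0 : 0 < (τ : ℝ) * R := by positivity
    have : Real.exp (-(τ : ℝ) * R) ^ 2 * (1 + 2 * ((τ : ℝ) * R)) ≤ 1 := by
      rw [← Real.exp_nat_mul]
      have := Real.add_one_le_exp (2 * ((τ : ℝ) * R))
      calc _ ≤ Real.exp (((2 : ℕ) : ℝ) * (-(τ : ℝ) * R)) * Real.exp (2 * ((τ : ℝ) * R)) := by
            gcongr; linarith
        _ = 1 := by rw [← Real.exp_add]; simp
    have h0 : 0 ≤ Real.exp (-(τ : ℝ) * R) ^ 2 := by positivity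
    rw [hm]
    nlinarith [mul_nonneg hx0.le (sub_nonneg.2 hx)]
  have hRS : R * S ^ 2 = N / 10 := by rw [hR]; field_simp
  rw [hRS] at hn
  have hm0 : 0 ≤ m := le_trans (by positivity) hm2
  have hkey : m * (N / 10) ≤ 5 / 32 * form (defect u) (defect u) + loss (rotate u).2 τ := by
    have e1 := mul_le_mul_of_nonneg_left hle hm0
    have e2 := mul_le_mul_of_nonneg_right hm1 hd
    nlinarith
  have h6 : (τ : ℝ) * R * (N / 10) ≤ m * (N / 10) := by gcongr
  have h7 : (τ : ℝ) * R * (N / 10) = (τ : ℝ) * N ^ 2 / (100 * S ^ 2) := by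
    rw [hR]; field_simp; ring
  have h8 : 0 ≤ (1 - Q ^ 2) / 2 * form (rotate u).1 (rotate u).1 :=
    mul_nonneg (by nlinarith) hw
  linarith

end ExpSum

/-! ### Decay of the averaged evolution. -/

namespace ExpSum

/-- `pairing` as a bilinear form. -/
def pairingForm : LinearMap.BilinForm ℝ (ExpSum × ExpSum) :=
  (1 / 2 : ℝ) • form.compl₁₂ (LinearMap.fst ℝ _ _) (LinearMap.fst ℝ _ _)
    + form.compl₁₂ (LinearMap.snd ℝ _ _) (LinearMap.snd ℝ _ _)

theorem pairingForm_apply (u v : ExpSum × ExpSum) : pairingForm u v = pairing u v := by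
  simp only [pairingForm, pairing, LinearMap.add_apply, LinearMap.smul_apply,
    LinearMap.compl₁₂_apply, smul_eq_mul]
  change 1 / 2 * form u.1 v.1 + form u.2 v.2 = _
  ring

/-- The norm of a pair. -/
def size (u : ExpSum × ExpSum) : ℝ := √(pairing u u)

theorem size_nonneg (u : ExpSum × ExpSum) : 0 ≤ size u := Real.sqrt_nonneg _

theorem size_sq (u : ExpSum × ExpSum) : size u ^ 2 = pairing u u :=
  Real.sq_sqrt (pairing_self_nonneg u)

theorem abs_pairing_le (u v : ExpSum × ExpSum) : |pairing u v| ≤ size u * size v := by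
  have h := LinearMap.BilinForm.apply_mul_apply_le_of_forall_zero_le pairingForm
    (fun x => by rw [pairingForm_apply]; exact pairing_self_nonneg x) u v
  simp only [pairingForm_apply, pairing_comm v u, ← size_sq] at h
  refine abs_le_of_sq_le_sq ?_ (mul_nonneg (size_nonneg u) (size_nonneg v))
  nlinarith

theorem size_add_le (u v : ExpSum × ExpSum) : size (u + v) ≤ size u + size v := by
  have h : pairing (u + v) (u + v) = pairing u u + 2 * pairing u v + pairing v v := by
    simp only [← pairingForm_apply, map_add, LinearMap.add_apply]
    rw [pairingForm_apply v u, pairing_comm v u, ← pairingForm_apply]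
    ring
  rw [size, Real.sqrt_le_left (add_nonneg (size_nonneg u) (size_nonneg v)), h, ← size_sq,
    ← size_sq]
  nlinarith [le_of_abs_le (abs_pairing_le u v)]

theorem size_smul {c : ℝ} (hc : 0 ≤ c) (u : ExpSum × ExpSum) : size (c • u) = c * size u := by
  have h : pairing (c • u) (c • u) = c ^ 2 * pairing u u := by
    simp only [← pairingForm_apply, map_smul, LinearMap.smul_apply, smul_eq_mul]
    ring
  rw [size, h, Real.sqrt_mul (sq_nonneg c), Real.sqrt_sq hc, size]

variable {Q : ℝ} {τ : {s : ℝ // 0 < s}} {u v : ExpSum × ExpSum}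

theorem rate_nonneg (hQ : 0 ≤ Q) (hQ1 : Q ≤ 1) : 0 ≤ rate Q τ :=
  le_min (by nlinarith) (le_min τ.2.le one_pos.le)

theorem rate_le_one : rate Q τ ≤ 1 := (min_le_right _ _).trans (min_le_right _ _)

/-- The halving of the rate comes from the square root: 1 - r/10 ≤ exp(-r/20)². -/
theorem size_layer_le (hQ : 0 ≤ Q) (hQ1 : Q ≤ 1) (hu : hankel u.1 = u.1) :
    size (layer Q τ u) ≤ Real.exp (-(rate Q τ / 20)) * size u := by
  rw [size, Real.sqrt_le_left (mul_nonneg (Real.exp_pos _).le (size_nonneg u)), mul_pow, size_sq,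
    ← Real.exp_nat_mul]
  refine (pairing_layer_self_le hQ hQ1 hu).trans ?_
  refine mul_le_mul_of_nonneg_right ?_ (pairing_self_nonneg u)
  have := Real.add_one_le_exp (((2 : ℕ) : ℝ) * -(rate Q τ / 20))
  push_cast at *
  linarith

theorem hankel_iterate_fst (hu : hankel u.1 = u.1) (m : ℕ) :
    hankel ((layer Q τ)^[m] u).1 = ((layer Q τ)^[m] u).1 := by
  induction m with
  | zero => exact hu
  | succ m ih => rw [Function.iterate_succ_apply']; exact hankel_layer_fst ih

theorem size_iterate_le (hQ : 0 ≤ Q) (hQ1 : Q ≤ 1) (hu : hankel u.1 = u.1) (m : ℕ) :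
    size ((layer Q τ)^[m] u) ≤ Real.exp (-(rate Q τ * m / 20)) * size u := by
  induction m with
  | zero => simp
  | succ m ih =>
    rw [Function.iterate_succ_apply']
    refine (size_layer_le hQ hQ1 (hankel_iterate_fst hu m)).trans ?_
    refine (mul_le_mul_of_nonneg_left ih (Real.exp_pos _).le).trans_eq ?_
    rw [← mul_assoc, ← Real.exp_add]
    congr 2
    push_cast
    ring

theorem size_ground_sq : size ground ^ 2 = 1 / 2 := by
  rw [size_sq, pairing, ground, form_single]
  norm_num

/-- The part of the evolution that leaves the first component in the first layer. -/
def excursion (Q : ℝ) (τ : {s : ℝ // 0 < s}) (n : ℕ) : ExpSum × ExpSum :=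
  evolve Q τ (n + 1) - (3 / 4 * Q) • evolve Q τ n

/-- The excursion obeys the same linear recursion as the evolution, but starts in the second
component and already damped. This is needed because τ may be large, in which case the ground pair
violates the smallness condition of the Nash step, whereas the first excursion satisfies it
(`pairing_excursion_zero_le`). -/
theorem excursion_succ (n : ℕ) : excursion Q τ (n + 1) = layer Q τ (excursion Q τ n) := by
  rw [excursion, excursion, map_sub, map_smul, ← evolve_succ, ← evolve_succ]

theorem excursion_add (n m : ℕ) :
    excursion Q τ (n + m) = (layer Q τ)^[m] (excursion Q τ n) := by
  induction m with
  | zero => rfl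
  | succ m ih => rw [← add_assoc, excursion_succ, ih, Function.iterate_succ_apply']

theorem hankel_excursion_fst (n : ℕ) : hankel (excursion Q τ n).1 = (excursion Q τ n).1 := by
  rw [excursion, Prod.fst_sub, Prod.smul_fst, map_sub, map_smul, hankel_evolve_fst,
    hankel_evolve_fst]

theorem pairing_excursion_zero_le :
    (τ : ℝ) * pairing (excursion Q τ 0) (excursion Q τ 0) ≤ 1 := by
  have hτ := τ.2
  have hd : defect ground = ground.1 := by simp [defect_apply, ground]
  -- As p = 0 at the start, the defect is all of W. One rotation keeps 3/4 of W, which is what the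
  -- subtraction removes, and sends 1/4 to p.
  have h1 : (excursion Q τ 0).1 = 0 := by
    rw [excursion, Prod.fst_sub, Prod.smul_fst, evolve_succ, evolve_zero, layer_fst, rotate_fst, hd]
    module
  have h2 : (excursion Q τ 0).2 = (1 / 4 : ℝ) • damp τ ground.1 := by
    rw [excursion, Prod.snd_sub, Prod.smul_snd, evolve_succ, evolve_zero, layer_snd, rotate_snd,
      hd, show ground.2 = 0 from rfl]
    simp
  rw [pairing, h1, h2, ground, damp_single]
  simp only [map_smul, LinearMap.smul_apply, form_single, smul_eq_mul, map_zero]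
  rw [zero_div, zero_add, ← sub_nonneg]
  have : 1 - (τ : ℝ) * (1 / 4 * (1 / 4 * (1 * 1 / (1 / 2 + (τ : ℝ) + (1 / 2 + (τ : ℝ))))))
      = (16 + 31 * τ) / (16 + 32 * τ) := by field_simp; ring
  rw [this]
  positivity

/-- The functions of the evolution are bounded by `3`. -/
def BoundedEvolution (Q : ℝ) (τ : {s : ℝ // 0 < s}) : Prop :=
  ∀ n w, 0 < w → |eval w (evolve Q τ n).1| ≤ 3 ∧ |eval w (evolve Q τ n).2| ≤ 3 ∧
    |eval w (hankel (evolve Q τ n).2)| ≤ 3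

/-- The rotated p is (3/4) p + (1/4) W - (1/4) Hp, hence at most 15/4 in absolute value; the
subtracted term adds at most 3/4 of this, and the sum is below 7. -/
theorem abs_eval_rotate_excursion_le (hb : BoundedEvolution Q τ) (hQ : 0 ≤ Q) (hQ1 : Q ≤ 1) (n : ℕ)
    {w : ℝ} (hw : 0 < w) :
    |eval w (rotate (excursion Q τ n)).2| ≤ 7 := by
  have h : ∀ n, |eval w (rotate (evolve Q τ n)).2| ≤ 15 / 4 := fun n => by
    have h1 := abs_le.1 (hb n w hw).1
    have h2 := abs_le.1 (hb n w hw).2.1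
    have h3 := abs_le.1 (hb n w hw).2.2
    rw [rotate_snd, defect_apply]
    simp only [map_add, map_smul, map_sub, smul_eq_mul]
    rw [abs_le]
    constructor <;> linarith
  have h1 := abs_le.1 (h (n + 1))
  have h2 : |Q * eval w (rotate (evolve Q τ n)).2| ≤ 15 / 4 := by
    rw [abs_mul, abs_of_nonneg hQ]
    nlinarith [h n, abs_nonneg (eval w (rotate (evolve Q τ n)).2)]
  have h2 := abs_le.1 h2
  rw [excursion, map_sub, map_smul, Prod.snd_sub, Prod.smul_snd, map_sub, map_smul, smul_eq_mul,
    abs_le]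
  constructor <;> linarith

/-- With z the squared norm times τ, the Nash step at S = 7 reads z' ≤ z - z²/4900, since 4900 = 100
· 7². Such a sequence is at most 4900/(n + 1). -/
theorem pairing_excursion_le (hb : BoundedEvolution Q τ) (hQ : 0 ≤ Q) (hQ1 : Q ≤ 1) (n : ℕ) :
    (τ : ℝ) * pairing (excursion Q τ n) (excursion Q τ n) ≤ 1 ∧
      (τ : ℝ) * pairing (excursion Q τ n) (excursion Q τ n) ≤ 4900 / (n + 1) := by
  have hτ := τ.2
  induction n with
  | zero =>
    have := pairing_excursion_zero_le (Q := Q) (τ := τ)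
    exact ⟨this, this.trans (by norm_num)⟩
  | succ n ih =>
    have h := pairing_layer_self_le_of_eval_le (τ := τ) (S := 7) (by norm_num) hQ hQ1
      (hankel_excursion_fst n)
      (fun w hw => abs_eval_rotate_excursion_le hb hQ hQ1 n hw)
      (ih.1.trans (by norm_num))
    rw [← excursion_succ] at h
    set z := (τ : ℝ) * pairing (excursion Q τ n) (excursion Q τ n) with hz
    have hz0 : 0 ≤ z := mul_nonneg hτ.le (pairing_self_nonneg _)
    have h' : (τ : ℝ) * pairing (excursion Q τ (n + 1)) (excursion Q τ (n + 1))
        ≤ z - z ^ 2 / 4900 := by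
      refine (mul_le_mul_of_nonneg_left h hτ.le).trans_eq ?_
      rw [hz]
      ring
    refine ⟨h'.trans (by nlinarith [ih.1, sq_nonneg z]), h'.trans ?_⟩
    have h2 := ih.2
    push_cast
    rw [le_div_iff₀ (by positivity)] at h2 ⊢
    have hn : (0 : ℝ) ≤ n := Nat.cast_nonneg n
    nlinarith [mul_nonneg hz0 (sub_nonneg.2 h2), mul_nonneg hz0 hn,
      mul_nonneg hz0 (mul_nonneg hz0 hn)]

/-- The first half of the layers is spent on the Nash decay, the second half on the exponential
contraction, which leaves half of the exponent. The constant 172 exceeds √(4 · 4900) = 140. -/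
theorem size_excursion_le (hb : BoundedEvolution Q τ) (hQ : 0 ≤ Q) (hQ1 : Q ≤ 1) (n : ℕ) :
    size (excursion Q τ n) ≤ Real.exp (-(rate Q τ * n / 40)) * (172 / √((τ : ℝ) * (n + 3))) := by
  have hτ := τ.2
  have hr := rate_nonneg (τ := τ) hQ hQ1
  obtain ⟨m, k, hn, hmk, hkm⟩ : ∃ m k : ℕ, n = m + k ∧ m ≤ k ∧ k ≤ m + 1 :=
    ⟨n / 2, n - n / 2, by omega, by omega, by omega⟩
  have h := size_iterate_le (τ := τ) hQ hQ1 (hankel_excursion_fst (Q := Q) (τ := τ) m) k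
  rw [← excursion_add, ← hn] at h
  have h1 := (pairing_excursion_le hb hQ hQ1 m).2
  refine h.trans ?_
  have hnR : (n : ℝ) = m + k := by exact_mod_cast hn
  have hmkR : (m : ℝ) ≤ k := by exact_mod_cast hmk
  have hkmR : (k : ℝ) ≤ m + 1 := by exact_mod_cast hkm
  have hm0 : (0 : ℝ) ≤ m := Nat.cast_nonneg m
  refine mul_le_mul (Real.exp_le_exp.2 ?_) ?_ (size_nonneg _) (Real.exp_pos _).le
  · nlinarith
  · rw [size, Real.sqrt_le_left (by positivity), div_pow, Real.sq_sqrt (by positivity),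
      le_div_iff₀ (by positivity)]
    rw [le_div_iff₀ (by positivity)] at h1
    have h0 := pairing_self_nonneg (excursion Q τ m)
    have : (n : ℝ) + 3 ≤ 4 * (m + 1) := by linarith
    calc _ = (τ * pairing (excursion Q τ m) (excursion Q τ m)) * (n + 3) := by ring
      _ ≤ (τ * pairing (excursion Q τ m) (excursion Q τ m)) * (4 * (m + 1)) := by gcongr
      _ ≤ _ := by linarith

/-- The evolution is a geometric sum, with ratio 3Q/4, of excursions; convolving n^(-1/2) with a
geometric sequence preserves its order. -/
theorem size_evolve_le (hb : BoundedEvolution Q τ) (hQ : 0 ≤ Q) (hQ1 : Q ≤ 1) (n : ℕ) :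
    size (evolve Q τ n)
      ≤ Real.exp (-(rate Q τ * n / 40)) * ((3 / 4) ^ n + 3000 / √((τ : ℝ) * (n + 3))) := by
  have hτ := τ.2
  have hr := rate_nonneg (τ := τ) hQ hQ1
  induction n with
  | zero =>
    have : size ground ≤ 1 := by nlinarith [size_ground_sq, size_nonneg ground]
    rw [evolve_zero]
    simp only [Nat.cast_zero, mul_zero, zero_div, neg_zero, Real.exp_zero, one_mul, pow_zero]
    have : 0 ≤ 3000 / √((τ : ℝ) * (0 + 3)) := by positivity
    linarith
  | succ n ih =>
    have h : evolve Q τ (n + 1) = excursion Q τ n + (3 / 4 * Q) • evolve Q τ n := by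
      rw [excursion]; abel
    rw [h]
    refine (size_add_le _ _).trans ?_
    rw [size_smul (by positivity)]
    have h1 := size_excursion_le hb hQ hQ1 n
    set r := rate Q τ with hrdef
    have hr1 : r ≤ 1 := rate_le_one
    have hQr : Q ≤ Real.exp (-(r / 40)) := by
      have : r ≤ 1 - Q ^ 2 := min_le_left _ _
      have := Real.add_one_le_exp (-(r / 40))
      nlinarith
    have he : Real.exp (-(r * n / 40)) ≤ 40 / 39 * Real.exp (-(r * (n + 1) / 40)) := by
      rw [show -(r * n / 40) = r / 40 + -(r * (n + 1) / 40) by ring, Real.exp_add]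
      gcongr
      have h := Real.add_one_le_exp (-(r / 40))
      have h2 : Real.exp (r / 40) * Real.exp (-(r / 40)) = 1 := by rw [← Real.exp_add]; simp
      nlinarith [Real.exp_pos (r / 40), Real.exp_pos (-(r / 40))]
    -- The shift by 3 keeps the ratio of consecutive square roots below 6/5, so that 3/4 · 6/5 < 1
    -- and the induction closes: (40/39) · 172 · (6/5) + (9/10) · 3000 ≤ 3000.
    have hs : 1 / √((τ : ℝ) * (n + 3)) ≤ 6 / 5 * (1 / √((τ : ℝ) * ((n + 1 : ℕ) + 3))) := by
      push_cast
      rw [← mul_div_assoc, div_le_div_iff₀ (by positivity) (by positivity), mul_one, one_mul,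
        Real.sqrt_le_left (by positivity), mul_pow, Real.sq_sqrt (by positivity)]
      nlinarith [mul_nonneg hτ.le (Nat.cast_nonneg (α := ℝ) n)]
    set a := Real.exp (-(r * (n + 1) / 40)) with ha
    set x := 1 / √((τ : ℝ) * (n + 3)) with hx
    set y := 1 / √((τ : ℝ) * ((n + 1 : ℕ) + 3)) with hy
    have ha0 : 0 < a := Real.exp_pos _
    have hx0 : 0 ≤ x := by positivity
    rw [div_eq_mul_one_div (3000 : ℝ), ← hx] at ih
    rw [div_eq_mul_one_div (172 : ℝ), ← hx] at h1
    rw [div_eq_mul_one_div (3000 : ℝ), ← hy]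
    push_cast
    rw [← ha]
    have e1 : Real.exp (-(r * n / 40)) * (172 * x) ≤ 40 / 39 * a * (172 * x) := by gcongr
    have e2 : 3 / 4 * Q * size (evolve Q τ n)
        ≤ 3 / 4 * a * ((3 / 4) ^ n + 3000 * x) := by
      have h0 := size_nonneg (evolve Q τ n)
      calc _ ≤ 3 / 4 * Real.exp (-(r / 40))
            * (Real.exp (-(r * n / 40)) * ((3 / 4) ^ n + 3000 * x)) := by gcongr
        _ = 3 / 4 * (Real.exp (-(r / 40)) * Real.exp (-(r * n / 40)))
            * ((3 / 4) ^ n + 3000 * x) := by ring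
        _ = _ := by rw [← Real.exp_add, ha]; congr 3; ring
    have e3 : a * x ≤ a * (6 / 5 * y) := by gcongr
    rw [pow_succ]
    nlinarith

/-- Both factors of a layer are symmetric for the pairing, so a layers can be moved to the left
argument. This turns one inner product into a product of two norms, each after about half of the
layers. -/
theorem form_ground_evolve (a b : ℕ) :
    form ground.1 (evolve Q τ (a + b + 1)).1
      = 2 * Q * pairing (rotate (evolve Q τ a)) (evolve Q τ b) := by
  have h : ∀ a b, pairing (rotate (evolve Q τ a)) (evolve Q τ b)
      = pairing (rotate ground) (evolve Q τ (a + b)) := by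
    intro a
    induction a with
    | zero => intro b; rw [zero_add, evolve_zero]
    | succ a ih =>
      intro b
      rw [show a + 1 + b = a + (b + 1) by ring, ← ih, evolve_succ, evolve_succ,
        pairing_rotate_comm (hankel_evolve_fst b) (hankel_layer_fst (hankel_evolve_fst a))]
      exact pairing_displace _ _
  rw [h, pairing_rotate_comm (hankel_evolve_fst _) hankel_ground_fst, evolve_succ, layer_fst,
    pairing, show ground.2 = 0 from rfl]
  simp only [map_smul, smul_eq_mul, map_zero, LinearMap.zero_apply]
  ring

theorem abs_form_ground_evolve_le (hQ : 0 ≤ Q) (a b : ℕ) :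
    |form ground.1 (evolve Q τ (a + b + 1)).1|
      ≤ 2 * Q * (size (evolve Q τ a) * size (evolve Q τ b)) := by
  rw [form_ground_evolve, abs_mul, abs_of_nonneg (by positivity)]
  refine mul_le_mul_of_nonneg_left ((abs_pairing_le _ _).trans ?_) (by positivity)
  exact mul_le_mul_of_nonneg_right (Real.sqrt_le_sqrt (pairing_rotate_self_le
    (hankel_evolve_fst a))) (size_nonneg _)

/-- Uses the contraction alone and no sup bound; it serves total displacements s with |s| ≥ 1. -/
theorem abs_form_ground_evolve_le_exp (hQ : 0 ≤ Q) (hQ1 : Q ≤ 1) (n : ℕ) :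
    |form ground.1 (evolve Q τ (n + 1)).1| ≤ Q * Real.exp (-(rate Q τ * n / 20)) := by
  have h := abs_form_ground_evolve_le (τ := τ) hQ 0 n
  rw [zero_add] at h
  refine h.trans ?_
  have h1 := size_iterate_le (τ := τ) hQ hQ1 hankel_ground_fst n
  rw [evolve_zero]
  calc _ ≤ 2 * Q * (size ground * (Real.exp (-(rate Q τ * n / 20)) * size ground)) := by
        have := size_nonneg ground
        gcongr
        exact h1
    _ = 2 * Q * (Real.exp (-(rate Q τ * n / 20)) * size ground ^ 2) := by ring
    _ = _ := by rw [size_ground_sq]; ring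

/-- Both halves have size of order E^(-1/2): the geometric part because (3/4)^m is about the square
root of (3/4)^(n+1), the Nash part because τm is of order E. -/
theorem abs_form_ground_evolve_le_of_bounded
    (hb : BoundedEvolution Q τ) (hQ : 0 ≤ Q) (hQ1 : Q ≤ 1) (n : ℕ) {K E : ℝ} (hE : 0 < E) (hK : 0 ≤ K)
    (hn : (3 / 4) ^ (n + 1) ≤ K / E) (hτ : (τ : ℝ) * (n + 1) = 2 * E) :
    |form ground.1 (evolve Q τ (n + 1)).1|
      ≤ 2 * (4 / 3 * √K + 3000) ^ 2 / E * (Q * Real.exp (-(rate Q τ * n / 40))) := by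
  have hτ0 := τ.2
  obtain ⟨a, b, hab, h1, h2⟩ : ∃ a b : ℕ, n = a + b ∧ a ≤ b ∧ b ≤ a + 1 :=
    ⟨n / 2, n - n / 2, by omega, by omega, by omega⟩
  have key : ∀ m : ℕ, n ≤ 2 * m + 1 →
      (3 / 4 : ℝ) ^ m + 3000 / √((τ : ℝ) * (m + 3)) ≤ (4 / 3 * √K + 3000) / √E := by
    intro m hm
    rw [add_div]
    have hmR : (n : ℝ) ≤ 2 * m + 1 := by exact_mod_cast hm
    refine add_le_add ?_ (div_le_div_of_nonneg_left (by norm_num) (by positivity)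
      (Real.sqrt_le_sqrt ?_))
    · rw [mul_div_assoc, ← Real.sqrt_div hK]
      -- Since n + 1 ≤ 2m + 2, two factors 3/4 are borrowed; they cost 16/9, hence the 4/3 in front
      -- of √K.
      have h3 : ((3 / 4 : ℝ) ^ m) ^ 2 ≤ 16 / 9 * (K / E) := by
        calc ((3 / 4 : ℝ) ^ m) ^ 2 = 16 / 9 * (3 / 4) ^ (2 * m + 2) := by
              rw [← pow_mul, pow_add, mul_comm m]; ring
          _ ≤ 16 / 9 * (3 / 4) ^ (n + 1) := by
              refine mul_le_mul_of_nonneg_left ?_ (by norm_num)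
              exact pow_le_pow_of_le_one (by norm_num) (by norm_num) (by omega)
          _ ≤ _ := by gcongr
      refine le_of_sq_le_sq ?_ (by positivity)
      rw [mul_pow, Real.sq_sqrt (by positivity)]
      linarith
    · nlinarith
  rw [hab]
  have hE' : √E * √E = E := Real.mul_self_sqrt hE.le
  have hsE : 0 < √E := Real.sqrt_pos.2 hE
  refine (abs_form_ground_evolve_le hQ a b).trans ?_
  have ha := (size_evolve_le hb hQ hQ1 a).trans
    (mul_le_mul_of_nonneg_left (key a (by omega)) (Real.exp_pos _).le)
  have hb := (size_evolve_le hb hQ hQ1 b).trans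
    (mul_le_mul_of_nonneg_left (key b (by omega)) (Real.exp_pos _).le)
  calc _ ≤ 2 * Q * ((Real.exp (-(rate Q τ * a / 40)) * ((4 / 3 * √K + 3000) / √E))
        * (Real.exp (-(rate Q τ * b / 40)) * ((4 / 3 * √K + 3000) / √E))) := by
        have := size_nonneg (evolve Q τ b)
        gcongr
    _ = 2 * (4 / 3 * √K + 3000) ^ 2 / (√E * √E)
        * (Q * (Real.exp (-(rate Q τ * a / 40)) * Real.exp (-(rate Q τ * b / 40)))) := by
        ring
    _ = _ := by
        rw [hE', ← Real.exp_add]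
        congr 3
        push_cast
        ring

end ExpSum

/-! ### Gaussian integrals over the plane -/

theorem cexp_gaussian_eq (a : ℝ) (b c : ℂ) (x : Fin 2 → ℝ) :
    Complex.exp (-(a : ℂ) * (‖Complex.measurableEquivPi.symm x‖ : ℂ) ^ 2
        + b * Complex.measurableEquivPi.symm x
        + c * conj (Complex.measurableEquivPi.symm x))
      = Complex.exp (-(a : ℂ) * ∑ i, (x i : ℂ) ^ 2
        + ∑ i, (![b + c, Complex.I * (b - c)] i) * x i) := by
  have h : Complex.measurableEquivPi.symm x = x 0 + x 1 * Complex.I := by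
    simp [Complex.measurableEquivPi]
  have h2 : (‖Complex.measurableEquivPi.symm x‖ : ℂ) ^ 2 = (x 0 : ℂ) ^ 2 + (x 1 : ℂ) ^ 2 := by
    rw [← Complex.mul_conj', h]
    simp only [map_add, map_mul, Complex.conj_ofReal, Complex.conj_I]
    linear_combination -(x 1 : ℂ) ^ 2 * Complex.I_sq
  rw [h2, h]
  congr 1
  simp only [Fin.sum_univ_two, Matrix.cons_val_zero, Matrix.cons_val_one, map_add, map_mul,
    Complex.conj_ofReal, Complex.conj_I]
  ring

theorem integrable_cexp_gaussian {a : ℝ} (ha : 0 < a) (b c : ℂ) :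
    Integrable fun z : ℂ => Complex.exp (-(a : ℂ) * (‖z‖ : ℂ) ^ 2 + b * z + c * conj z) := by
  rw [← (Complex.volume_preserving_equiv_pi.symm _).integrable_comp_emb
    (MeasurableEquiv.measurableEmbedding _)]
  refine (GaussianFourier.integrable_cexp_neg_mul_sum_add (b := (a : ℂ)) (by simpa using ha)
    (![b + c, Complex.I * (b - c)])).congr (ae_of_all _ fun x => ?_)
  exact (cexp_gaussian_eq a b c x).symm

theorem integral_cexp_gaussian {a : ℝ} (ha : 0 < a) (b c : ℂ) :
    ∫ z : ℂ, Complex.exp (-(a : ℂ) * (‖z‖ : ℂ) ^ 2 + b * z + c * conj z)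
      = Real.pi / a * Complex.exp (b * c / a) := by
  rw [← (Complex.volume_preserving_equiv_pi.symm _).integral_comp
    (MeasurableEquiv.measurableEmbedding _)]
  simp_rw [cexp_gaussian_eq]
  rw [GaussianFourier.integral_cexp_neg_mul_sum_add (b := (a : ℂ)) (by simpa using ha)]
  have ha' : (a : ℂ) ≠ 0 := by exact_mod_cast ha.ne'
  simp only [Fintype.card_fin, Nat.cast_ofNat, Fin.sum_univ_two, Matrix.cons_val_zero,
    Matrix.cons_val_one]
  rw [show (2 : ℂ) / 2 = 1 by norm_num, Complex.cpow_one]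
  congr 2
  field_simp
  linear_combination (b - c) ^ 2 * Complex.I_sq

theorem integrable_exp_neg_mul_sq_norm {a : ℝ} (ha : 0 < a) :
    Integrable fun z : ℂ => Real.exp (-a * ‖z‖ ^ 2) := by
  refine (integrable_cexp_gaussian ha 0 0).norm.congr (ae_of_all _ fun z => ?_)
  simp only [zero_mul, add_zero]
  rw [Complex.norm_exp]
  norm_cast

theorem integral_exp_neg_mul_sq_norm {a : ℝ} (ha : 0 < a) :
    ∫ z : ℂ, Real.exp (-a * ‖z‖ ^ 2) = Real.pi / a := by
  have h := integral_cexp_gaussian ha 0 0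
  simp only [zero_mul, add_zero, zero_div, Complex.exp_zero, mul_one] at h
  have h2 : (fun z : ℂ => Complex.exp (-(a : ℂ) * (‖z‖ : ℂ) ^ 2))
      = fun z : ℂ => ((Real.exp (-a * ‖z‖ ^ 2) : ℝ) : ℂ) := by
    funext z; push_cast; rfl
  rw [h2, integral_complex_ofReal] at h
  exact_mod_cast h

/-! ### The distribution of the displacements -/

/-- The density of `complexGaussian v`. -/
def complexGaussianPDF (v : ℝ) (z : ℂ) : ℝ := Real.exp (-(1 / v) * ‖z‖ ^ 2) / (Real.pi * v)

instance (v : ℝ) : IsProbabilityMeasure (complexGaussian v) :=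
  Measure.isProbabilityMeasure_map (by
    refine Measurable.aemeasurable ?_
    exact Complex.measurableEquivRealProd.symm.measurable)

theorem integral_complexGaussian {E : Type*} [NormedAddCommGroup E] [NormedSpace ℝ E] {v : ℝ}
    (hv : 0 < v) (f : ℂ → E) :
    ∫ z, f z ∂(complexGaussian v) = ∫ z, complexGaussianPDF v z • f z := by
  have hv2 : (v / 2).toNNReal ≠ 0 := by
    rw [Ne, Real.toNNReal_eq_zero]; linarith
  have hm : Measurable fun z : ℝ × ℝ => gaussianPDF 0 (v / 2).toNNReal z.1
      * gaussianPDF 0 (v / 2).toNNReal z.2 :=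
    ((measurable_gaussianPDF _ _).comp measurable_fst).mul
      ((measurable_gaussianPDF _ _).comp measurable_snd)
  have h1 : complexGaussian v = ((gaussianReal 0 (v / 2).toNNReal).prod
      (gaussianReal 0 (v / 2).toNNReal)).map Complex.measurableEquivRealProd.symm := rfl
  rw [h1, integral_map_equiv, gaussianReal_of_var_ne_zero _ hv2,
    prod_withDensity (measurable_gaussianPDF _ _) (measurable_gaussianPDF _ _),
    integral_withDensity_eq_integral_toReal_smul
      hm
      (ae_of_all _ fun p => ENNReal.mul_lt_top ENNReal.ofReal_lt_top ENNReal.ofReal_lt_top),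
    ← (Complex.volume_preserving_equiv_real_prod.symm _).integral_comp
      (MeasurableEquiv.measurableEmbedding _)]
  refine integral_congr_ae (ae_of_all _ fun p => ?_)
  simp only
  congr 1
  rw [ENNReal.toReal_mul, gaussianPDF_def, ENNReal.toReal_ofReal (gaussianPDFReal_nonneg _ _ _),
    ENNReal.toReal_ofReal (gaussianPDFReal_nonneg _ _ _), gaussianPDFReal_def]
  have hc : (((v / 2).toNNReal : NNReal) : ℝ) = v / 2 := Real.coe_toNNReal _ (by linarith)
  have hn : ‖Complex.measurableEquivRealProd.symm p‖ ^ 2 = p.1 ^ 2 + p.2 ^ 2 := by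
    rw [← Complex.normSq_eq_norm_sq, Complex.normSq_apply]
    simp [Complex.measurableEquivRealProd]
    ring
  simp only [hc, complexGaussianPDF, hn]
  rw [show 2 * Real.pi * (v / 2) = Real.pi * v by ring]
  have hs : √(Real.pi * v) * √(Real.pi * v) = Real.pi * v :=
    Real.mul_self_sqrt (by positivity)
  rw [mul_mul_mul_comm, ← mul_inv, hs, ← Real.exp_add,
    div_eq_inv_mul (Real.exp (-(1 / v) * (p.1 ^ 2 + p.2 ^ 2)))]
  congr 2
  field_simp
  ring

theorem integral_cexp_complexGaussian {v : ℝ} (hv : 0 < v) (b c : ℂ) :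
    ∫ z, Complex.exp (b * z + c * conj z) ∂(complexGaussian v) = Complex.exp (v * (b * c)) := by
  rw [integral_complexGaussian hv]
  have h := integral_cexp_gaussian (one_div_pos.2 hv) b c
  have hv' : (v : ℂ) ≠ 0 := by exact_mod_cast hv.ne'
  have hp : (Real.pi : ℂ) ≠ 0 := by exact_mod_cast Real.pi_ne_zero
  have : (fun z => complexGaussianPDF v z • Complex.exp (b * z + c * conj z))
      = fun z => (1 / (Real.pi * v) : ℂ) *
        Complex.exp (-((1 / v : ℝ) : ℂ) * (‖z‖ : ℂ) ^ 2 + b * z + c * conj z) := by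
    funext z
    rw [complexGaussianPDF, Complex.real_smul, add_assoc,
      Complex.exp_add (-((1 / v : ℝ) : ℂ) * (‖z‖ : ℂ) ^ 2)]
    push_cast
    ring
  rw [this, integral_const_mul, h]
  push_cast
  field_simp

/-- The heat flow of a Gaussian. It is the effect of one layer on the cross part, whose argument is
shifted by twice the displacement. -/
theorem integral_exp_norm_add_complexGaussian {v s : ℝ} (hv : 0 < v) (hs : 0 < s) (t : ℂ) :
    ∫ z, Real.exp (-s * ‖t + 2 * z‖ ^ 2) ∂(complexGaussian v)
      = 1 / (1 + 4 * s * v) * Real.exp (-(s / (1 + 4 * s * v)) * ‖t‖ ^ 2) := by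
  have ha : 0 < 4 * s + 1 / v := by positivity
  have h := integral_cexp_gaussian ha (-2 * s * conj t) (-2 * s * t)
  rw [integral_complexGaussian hv]
  have hz : ∀ z, complexGaussianPDF v z • Real.exp (-s * ‖t + 2 * z‖ ^ 2)
      = (1 / (Real.pi * v) * Real.exp (-s * ‖t‖ ^ 2)) * (Complex.exp (-((4 * s + 1 / v : ℝ) : ℂ)
        * (‖z‖ : ℂ) ^ 2 + (-2 * s * conj t) * z + (-2 * s * t) * conj z)).re := by
    intro z
    have e1 : -((4 * s + 1 / v : ℝ) : ℂ) * (‖z‖ : ℂ) ^ 2 + (-2 * s * conj t) * z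
        + (-2 * s * t) * conj z
        = ((-(4 * s + 1 / v) * ‖z‖ ^ 2 - s * (‖t + 2 * z‖ ^ 2 - ‖t‖ ^ 2 - 4 * ‖z‖ ^ 2) : ℝ) : ℂ) := by
      push_cast
      rw [← Complex.mul_conj' (t + 2 * z), ← Complex.mul_conj' t, ← Complex.mul_conj' z]
      simp only [map_add, map_mul, Complex.conj_ofNat]
      ring
    rw [e1, Complex.exp_ofReal_re, complexGaussianPDF, smul_eq_mul, div_mul_eq_mul_div,
      ← Real.exp_add, mul_assoc, ← Real.exp_add, div_mul_eq_mul_div, one_mul]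
    congr 2
    ring
  simp_rw [hz]
  rw [integral_const_mul]
  have hre : ∫ z : ℂ, (Complex.exp (-((4 * s + 1 / v : ℝ) : ℂ)
        * (‖z‖ : ℂ) ^ 2 + (-2 * s * conj t) * z + (-2 * s * t) * conj z)).re
      = Real.pi / (4 * s + 1 / v) * Real.exp (4 * s ^ 2 * ‖t‖ ^ 2 / (4 * s + 1 / v)) := by
    have h3 := integral_re (integrable_cexp_gaussian ha (-2 * s * conj t) (-2 * s * t))
    simp only [RCLike.re_to_complex] at h3
    rw [h3, h, show (-2 * s * conj t) * (-2 * s * t) / ((4 * s + 1 / v : ℝ) : ℂ)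
      = ((4 * s ^ 2 * ‖t‖ ^ 2 / (4 * s + 1 / v) : ℝ) : ℂ) by
        push_cast
        rw [← Complex.mul_conj' t]
        ring, show (Real.pi : ℂ) / ((4 * s + 1 / v : ℝ) : ℂ)
      = ((Real.pi / (4 * s + 1 / v) : ℝ) : ℂ) by push_cast; ring, ← Complex.ofReal_exp,
      ← Complex.ofReal_mul, Complex.ofReal_re]
  rw [hre, show -(s / (1 + 4 * s * v)) * ‖t‖ ^ 2
    = -s * ‖t‖ ^ 2 + 4 * s ^ 2 * ‖t‖ ^ 2 / (4 * s + 1 / v) by field_simp; ring, Real.exp_add]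
  field_simp
  ring

theorem complexGaussian_conv {v w : ℝ} (hv : 0 < v) (hw : 0 < w) :
    Measure.conv (complexGaussian v) (complexGaussian w) = complexGaussian (v + w) := by
  have h : ∀ u : ℝ, 0 < u → ∀ t : ℂ, charFun (complexGaussian u) t
      = Complex.exp (u * (Complex.I * conj t / 2 * (Complex.I * t / 2))) := by
    intro u hu t
    rw [charFun_apply, ← integral_cexp_complexGaussian hu]
    refine integral_congr_ae (ae_of_all _ fun z => ?_)
    simp only
    congr 1
    rw [Complex.inner, Complex.re_eq_add_conj]
    simp only [map_mul, Complex.conj_conj]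
    ring
  refine Measure.ext_of_charFun (funext fun t => ?_)
  rw [charFun_conv, h v hv, h w hw, h _ (add_pos hv hw), ← Complex.exp_add]
  congr 1
  push_cast
  ring

theorem integral_neg_complexGaussian {E : Type*} [NormedAddCommGroup E] [NormedSpace ℝ E] {v : ℝ}
    (hv : 0 < v) (f : ℂ → E) :
    ∫ z, f (-z) ∂(complexGaussian v) = ∫ z, f z ∂(complexGaussian v) := by
  rw [integral_complexGaussian hv, integral_complexGaussian hv,
    ← integral_neg_eq_self (fun z => complexGaussianPDF v z • f z)]
  simp only [complexGaussianPDF, norm_neg]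

/-! ### The distribution of the angles -/

instance : IsProbabilityMeasure uniformAngle := by
  refine cond_isProbabilityMeasure_of_finite ?_ ?_ <;>
    simp [Real.pi_pos, ENNReal.mul_eq_top]

theorem integral_uniformAngle {E : Type*} [NormedAddCommGroup E] [NormedSpace ℝ E] (f : ℝ → E) :
    ∫ θ, f θ ∂uniformAngle = (2 * Real.pi)⁻¹ • ∫ θ in (0 : ℝ)..2 * Real.pi, f θ := by
  have hp := Real.pi_pos
  rw [uniformAngle, ProbabilityTheory.cond, integral_smul_measure,
    intervalIntegral.integral_of_le (by positivity), integral_Ico_eq_integral_Ioc]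
  congr 1
  rw [Real.volume_Ico, sub_zero, ENNReal.toReal_inv, ENNReal.toReal_ofReal (by positivity)]

instance (E : ℝ) (L : ℕ) : IsProbabilityMeasure (circuitEnsemble E L) := by
  unfold circuitEnsemble
  infer_instance

/-! ### Inner products of one mode -/

/-- The squared modulus grows more slowly than `exp ‖z‖²`. -/
def Moderate (F : ModeState) : Prop :=
  Continuous F ∧ ∃ C t : ℝ, 0 ≤ C ∧ 0 ≤ t ∧ t < 1 ∧
    ∀ z, ‖F z‖ ^ 2 ≤ C * Real.exp (t * ‖z‖ ^ 2)

/-- The span of the coherent states. -/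
def coherentSpan : Submodule ℂ ModeState :=
  Submodule.span ℂ (Set.range fun α : ℂ => fun z : ℂ => Complex.exp (α * z))

/-- The Gaussian weight of the Segal-Bargmann space. -/
def bargmannWeight (z : ℂ) : ℝ := Real.exp (-‖z‖ ^ 2) / Real.pi

theorem modeInner_eq (F G : ModeState) :
    modeInner F G = ∫ z : ℂ, conj (F z) * G z * (bargmannWeight z : ℂ) := rfl

theorem bargmannWeight_pos (z : ℂ) : 0 < bargmannWeight z := by
  have := Real.pi_pos
  unfold bargmannWeight
  positivity

theorem continuous_bargmannWeight : Continuous bargmannWeight := by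
  unfold bargmannWeight
  fun_prop

theorem Moderate.integrable_sq {F : ModeState} (hF : Moderate F) :
    Integrable fun z => ‖F z‖ ^ 2 * bargmannWeight z := by
  obtain ⟨hc, C, t, hC, -, ht, hb⟩ := hF
  refine ((integrable_exp_neg_mul_sq_norm (sub_pos.2 ht)).const_mul (C / Real.pi)).mono'
    ((hc.norm.pow 2).mul continuous_bargmannWeight).aestronglyMeasurable
    (ae_of_all _ fun z => ?_)
  rw [Real.norm_of_nonneg (mul_nonneg (sq_nonneg _) (bargmannWeight_pos z).le)]
  refine (mul_le_mul_of_nonneg_right (hb z) (bargmannWeight_pos z).le).trans_eq ?_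
  rw [bargmannWeight, mul_assoc, ← mul_div_assoc, ← Real.exp_add, div_mul_eq_mul_div,
    ← mul_div_assoc]
  congr 3
  ring

theorem norm_conj_mul_mul_weight_le (F G : ModeState) (z : ℂ) :
    ‖conj (F z) * G z * (bargmannWeight z : ℂ)‖
      ≤ (‖F z‖ ^ 2 * bargmannWeight z + ‖G z‖ ^ 2 * bargmannWeight z) / 2 := by
  have hw := (bargmannWeight_pos z).le
  rw [norm_mul, norm_mul, RCLike.norm_conj, Complex.norm_of_nonneg hw]
  nlinarith [mul_nonneg (sq_nonneg (‖F z‖ - ‖G z‖)) hw]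

theorem Moderate.integrable {F G : ModeState} (hF : Moderate F) (hG : Moderate G) :
    Integrable fun z => conj (F z) * G z * (bargmannWeight z : ℂ) :=
  ((hF.integrable_sq.add hG.integrable_sq).div_const 2).mono'
    (((Complex.continuous_conj.comp hF.1).mul hG.1).mul
      (Complex.continuous_ofReal.comp continuous_bargmannWeight)).aestronglyMeasurable
    (ae_of_all _ fun z => norm_conj_mul_mul_weight_le F G z)

theorem modeInner_add_right {F G₁ G₂ : ModeState} (hF : Moderate F) (h₁ : Moderate G₁)
    (h₂ : Moderate G₂) : modeInner F (G₁ + G₂) = modeInner F G₁ + modeInner F G₂ := by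
  simp only [modeInner_eq]
  rw [← integral_add (hF.integrable h₁) (hF.integrable h₂)]
  refine integral_congr_ae (ae_of_all _ fun z => ?_)
  simp only [Pi.add_apply]
  ring

theorem modeInner_smul_right (c : ℂ) (F G : ModeState) :
    modeInner F (c • G) = c * modeInner F G := by
  simp only [modeInner_eq]
  rw [← integral_const_mul]
  refine integral_congr_ae (ae_of_all _ fun z => ?_)
  simp only [Pi.smul_apply, smul_eq_mul]
  ring

theorem conj_modeInner (F G : ModeState) : conj (modeInner F G) = modeInner G F := by
  simp only [modeInner_eq]
  rw [← integral_conj]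
  refine integral_congr_ae (ae_of_all _ fun z => ?_)
  simp only [map_mul, Complex.conj_conj, Complex.conj_ofReal]
  ring

theorem modeInner_self (F : ModeState) :
    modeInner F F = ((∫ z, ‖F z‖ ^ 2 * bargmannWeight z : ℝ) : ℂ) := by
  rw [modeInner_eq, ← integral_complex_ofReal]
  refine integral_congr_ae (ae_of_all _ fun z => ?_)
  simp only [Complex.ofReal_mul, Complex.ofReal_pow]
  rw [Complex.conj_mul']

theorem modeInner_self_re_nonneg (F : ModeState) : 0 ≤ (modeInner F F).re := by
  rw [modeInner_self, Complex.ofReal_re]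
  exact integral_nonneg fun z => mul_nonneg (sq_nonneg _) (bargmannWeight_pos z).le

theorem norm_modeInner_le {F G : ModeState} (hF : Moderate F) (hG : Moderate G) :
    ‖modeInner F G‖ ≤ ((modeInner F F).re + (modeInner G G).re) / 2 := by
  rw [modeInner_self, modeInner_self, Complex.ofReal_re, Complex.ofReal_re,
    ← integral_add hF.integrable_sq hG.integrable_sq, ← integral_div]
  exact norm_integral_le_of_norm_le ((hF.integrable_sq.add hG.integrable_sq).div_const 2)
    (ae_of_all _ fun z => norm_conj_mul_mul_weight_le F G z)

/-! ### Displacements -/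

/-- The phase of the composition law of displacements. -/
def weylPhase (γ β : ℂ) : ℂ := Complex.exp ((γ * conj β - conj γ * β) / 2)

theorem norm_weylPhase (γ β : ℂ) : ‖weylPhase γ β‖ = 1 := by
  rw [weylPhase, Complex.norm_exp]
  simp

theorem continuous_weylPhase : Continuous fun p : ℂ × ℂ => weylPhase p.1 p.2 := by
  unfold weylPhase
  fun_prop

theorem displacement_add (β : ℂ) (F G : ModeState) :
    displacement β (F + G) = displacement β F + displacement β G := by
  funext z
  simp only [displacement, Pi.add_apply]
  ring

theorem displacement_smul (β c : ℂ) (F : ModeState) :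
    displacement β (c • F) = c • displacement β F := by
  funext z
  simp only [displacement, Pi.smul_apply, smul_eq_mul]
  ring

theorem displacement_zero (F : ModeState) : displacement 0 F = F := by
  funext z
  simp [displacement]

theorem displacement_displacement (γ β : ℂ) (F : ModeState) :
    displacement γ (displacement β F) = weylPhase γ β • displacement (γ + β) F := by
  funext z
  simp only [displacement, Pi.smul_apply, smul_eq_mul, weylPhase]
  rw [← mul_assoc, ← mul_assoc, ← Complex.exp_add, ← Complex.exp_add]
  congr 1
  · congr 1
    push_cast
    rw [← Complex.mul_conj' γ, ← Complex.mul_conj' β, ← Complex.mul_conj' (γ + β)]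
    simp only [map_add]
    ring
  · rw [map_add]
    congr 1
    ring

theorem weylPhase_neg_self (γ : ℂ) : weylPhase γ (-γ) = 1 := by
  rw [weylPhase, map_neg, show γ * -conj γ - conj γ * -γ = 0 by ring, zero_div, Complex.exp_zero]

theorem displacement_displacement_neg (γ : ℂ) (F : ModeState) :
    displacement γ (displacement (-γ) F) = F := by
  rw [displacement_displacement, weylPhase_neg_self, one_smul, add_neg_cancel, displacement_zero]

theorem conj_displacement_mul_displacement (β : ℂ) (F G : ModeState) (z : ℂ) :
    conj (displacement β F z) * displacement β G z * (bargmannWeight z : ℂ)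
      = conj (F (z - conj β)) * G (z - conj β) * (bargmannWeight (z - conj β) : ℂ) := by
  have h : conj (Complex.exp (β * z - ((‖β‖ ^ 2 / 2 : ℝ) : ℂ)))
      * Complex.exp (β * z - ((‖β‖ ^ 2 / 2 : ℝ) : ℂ)) * (bargmannWeight z : ℂ)
      = (bargmannWeight (z - conj β) : ℂ) := by
    rw [bargmannWeight, bargmannWeight, ← Complex.exp_conj]
    push_cast
    rw [← mul_div_assoc, ← Complex.exp_add, ← Complex.exp_add, ← Complex.mul_conj' z,
      ← Complex.mul_conj' (z - conj β)]
    congr 2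
    simp only [map_sub, map_mul, map_div₀, Complex.conj_ofNat,
      Complex.conj_conj, ← Complex.mul_conj' β]
    ring
  rw [← h]
  simp only [displacement, map_mul]
  ring

theorem modeInner_displacement (β : ℂ) (F G : ModeState) :
    modeInner (displacement β F) (displacement β G) = modeInner F G := by
  simp only [modeInner_eq, conj_displacement_mul_displacement]
  exact integral_sub_right_eq_self
    (fun z => conj (F z) * G z * (bargmannWeight z : ℂ)) (conj β)

theorem modeInner_displacement_right (β : ℂ) (F G : ModeState) :
    modeInner F (displacement β G) = modeInner (displacement (-β) F) G := by
  conv_lhs => rw [← displacement_displacement_neg β F]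
  exact modeInner_displacement β _ _

theorem continuous_displacement {F : ModeState} (hc : Continuous F) (β : ℂ) :
    Continuous (displacement β F) :=
  (by fun_prop : Continuous fun z : ℂ => Complex.exp (β * z - ((‖β‖ ^ 2 / 2 : ℝ) : ℂ))).mul
    (hc.comp (continuous_id.sub continuous_const))

theorem differentiable_displacement {F : ModeState} (hd : Differentiable ℂ F) (β : ℂ) :
    Differentiable ℂ (displacement β F) :=
  (by fun_prop : Differentiable ℂ fun z : ℂ => Complex.exp (β * z - ((‖β‖ ^ 2 / 2 : ℝ) : ℂ))).mul
    (hd.comp (differentiable_id.sub_const _))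

theorem Moderate.displacement {F : ModeState} (hF : Moderate F) (β : ℂ) :
    Moderate (displacement β F) := by
  obtain ⟨hc, C, t, hC, ht0, ht, hb⟩ := hF
  refine ⟨continuous_displacement hc β, C * Real.exp (‖β‖ ^ 2),
    (1 + t) / 2, by positivity, by linarith, by linarith, fun z => ?_⟩
  have h1 : ‖_root_.displacement β F z‖ ^ 2 * bargmannWeight z
      = ‖F (z - conj β)‖ ^ 2 * bargmannWeight (z - conj β) := by
    have := conj_displacement_mul_displacement β F F z
    rw [Complex.conj_mul', Complex.conj_mul'] at this
    exact_mod_cast this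
  have hw := bargmannWeight_pos z
  refine le_of_mul_le_mul_right ?_ hw
  rw [h1]
  refine (mul_le_mul_of_nonneg_right (hb _) (bargmannWeight_pos _).le).trans ?_
  rw [bargmannWeight, bargmannWeight, mul_assoc, mul_assoc, mul_assoc, ← mul_div_assoc,
    ← mul_div_assoc, ← mul_div_assoc, ← mul_div_assoc, ← Real.exp_add, ← Real.exp_add,
    ← Real.exp_add, ← mul_div_assoc]
  refine div_le_div_of_nonneg_right (mul_le_mul_of_nonneg_left (Real.exp_le_exp.2 ?_) hC)
    Real.pi_pos.le
  have h2 : ‖z‖ ≤ ‖z - conj β‖ + ‖β‖ := by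
    have := norm_add_le (z - conj β) (conj β)
    rwa [sub_add_cancel, RCLike.norm_conj] at this
  have h3 : ‖z‖ ^ 2 ≤ (‖z - conj β‖ + ‖β‖) ^ 2 := by gcongr
  nlinarith [sq_nonneg (‖z - conj β‖ - ‖β‖), mul_nonneg ht0 (sq_nonneg ‖β‖)]

/-! ### The span of the coherent states -/

theorem exp_mem_coherentSpan (α : ℂ) : (fun z => Complex.exp (α * z)) ∈ coherentSpan :=
  Submodule.subset_span ⟨α, rfl⟩

theorem vacuum_mem_coherentSpan : vacuum ∈ coherentSpan := by
  convert exp_mem_coherentSpan 0 using 1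
  funext z
  simp [vacuum]

theorem displacement_exp (β α : ℂ) : displacement β (fun z => Complex.exp (α * z))
    = Complex.exp (-((‖β‖ ^ 2 / 2 : ℝ) : ℂ) - α * conj β) • fun z => Complex.exp ((α + β) * z) := by
  funext z
  simp only [displacement, Pi.smul_apply, smul_eq_mul, ← Complex.exp_add]
  congr 1
  ring

theorem displacement_mem_coherentSpan (β : ℂ) {F : ModeState} (hF : F ∈ coherentSpan) :
    displacement β F ∈ coherentSpan := by
  induction hF using Submodule.span_induction with
  | mem F h =>
    obtain ⟨α, rfl⟩ := h
    rw [displacement_exp]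
    exact Submodule.smul_mem _ _ (exp_mem_coherentSpan _)
  | zero =>
    convert Submodule.zero_mem coherentSpan using 1
    funext z
    simp [displacement]
  | add F G _ _ hF hG => rw [displacement_add]; exact Submodule.add_mem _ hF hG
  | smul c F _ hF => rw [displacement_smul]; exact Submodule.smul_mem _ _ hF

theorem moderate_of_mem_coherentSpan {F : ModeState} (hF : F ∈ coherentSpan) : Moderate F := by
  suffices h : Continuous F ∧ ∃ C : ℝ, 0 ≤ C ∧ ∀ z, ‖F z‖ ^ 2 ≤ C * Real.exp (1 / 2 * ‖z‖ ^ 2) by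
    obtain ⟨hc, C, hC, hb⟩ := h
    exact ⟨hc, C, 1 / 2, hC, by norm_num, by norm_num, hb⟩
  induction hF using Submodule.span_induction with
  | mem F h =>
    obtain ⟨α, rfl⟩ := h
    refine ⟨by fun_prop, Real.exp (2 * ‖α‖ ^ 2), (Real.exp_pos _).le, fun z => ?_⟩
    rw [Complex.norm_exp, ← Real.exp_nat_mul, ← Real.exp_add]
    refine Real.exp_le_exp.2 ?_
    have h := (Complex.re_le_norm (α * z)).trans_eq (norm_mul _ _)
    push_cast
    nlinarith [sq_nonneg (2 * ‖α‖ - ‖z‖)]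
  | zero => exact ⟨continuous_zero, 0, le_rfl, fun z => by simp⟩
  | add F G _ _ hF hG =>
    obtain ⟨hc, C, hC, hb⟩ := hF
    obtain ⟨hc', C', hC', hb'⟩ := hG
    refine ⟨hc.add hc', 2 * C + 2 * C', by positivity, fun z => ?_⟩
    have h1 : ‖F z + G z‖ ^ 2 ≤ (‖F z‖ + ‖G z‖) ^ 2 := by gcongr; exact norm_add_le _ _
    rw [Pi.add_apply]
    nlinarith [hb z, hb' z, sq_nonneg (‖F z‖ - ‖G z‖)]
  | smul c F _ hF =>
    obtain ⟨hc, C, hC, hb⟩ := hF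
    refine ⟨hc.const_smul c, ‖c‖ ^ 2 * C, by positivity, fun z => ?_⟩
    rw [Pi.smul_apply, norm_smul, mul_pow, mul_assoc]
    gcongr
    exact hb z

theorem modeInner_exp (α α' ξ : ℂ) :
    modeInner (fun z => Complex.exp (α * z)) (displacement ξ fun z => Complex.exp (α' * z))
      = Complex.exp (-((‖ξ‖ ^ 2 / 2 : ℝ) : ℂ) - α' * conj ξ + conj α * (α' + ξ)) := by
  rw [displacement_exp, modeInner_smul_right, modeInner_eq]
  have h := integral_cexp_gaussian one_pos (α' + ξ) (conj α)
  have h2 : (fun z : ℂ => conj (Complex.exp (α * z)) * Complex.exp ((α' + ξ) * z)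
      * (bargmannWeight z : ℂ)) = fun z => (Real.pi : ℂ)⁻¹ * Complex.exp (-((1 : ℝ) : ℂ)
        * (‖z‖ : ℂ) ^ 2 + (α' + ξ) * z + conj α * conj z) := by
    funext z
    rw [← Complex.exp_conj, bargmannWeight, ← Complex.exp_add]
    push_cast
    rw [← mul_div_assoc, ← Complex.exp_add, div_eq_inv_mul]
    congr 2
    rw [map_mul]
    ring
  rw [h2, integral_const_mul, h, Complex.exp_add]
  have hp : (Real.pi : ℂ) ≠ 0 := by exact_mod_cast Real.pi_ne_zero
  push_cast
  field_simp

/-- The phase with which the displacement `ξ` enters the projection on a coherent state. -/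
def coherentPhase (z ξ : ℂ) : ℂ := Complex.exp (conj ξ * conj z - ξ * z)

theorem norm_coherentPhase (z ξ : ℂ) : ‖coherentPhase z ξ‖ = 1 := by
  rw [coherentPhase, Complex.norm_exp]
  simp

theorem continuous_coherentPhase (z : ℂ) : Continuous (coherentPhase z) := by
  unfold coherentPhase
  fun_prop

/-- The Weyl expansion of the projection on a coherent state. -/
theorem conj_mul_eq_integral_modeInner {F G : ModeState} (hF : F ∈ coherentSpan)
    (hG : G ∈ coherentSpan) (z : ℂ) :
    (Integrable fun ξ : ℂ => (Real.exp (-(1 / 2) * ‖ξ‖ ^ 2) : ℂ) * coherentPhase z ξ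
      * modeInner F (displacement ξ G)) ∧
    conj (F z) * G z * (bargmannWeight z : ℂ) = (Real.pi : ℂ)⁻¹ * (Real.pi : ℂ)⁻¹ *
      ∫ ξ : ℂ, (Real.exp (-(1 / 2) * ‖ξ‖ ^ 2) : ℂ) * coherentPhase z ξ
        * modeInner F (displacement ξ G) := by
  have hp : (Real.pi : ℂ) ≠ 0 := by exact_mod_cast Real.pi_ne_zero
  induction hG using Submodule.span_induction with
  | mem G h =>
    obtain ⟨α', rfl⟩ := h
    induction hF using Submodule.span_induction with
    | mem F h =>
      obtain ⟨α, rfl⟩ := h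
      -- On coherent states both sides are explicit Gaussian integrals; the general case follows by
      -- sesquilinearity.
      have h2 : (fun ξ : ℂ => (Real.exp (-(1 / 2) * ‖ξ‖ ^ 2) : ℂ) * coherentPhase z ξ
          * modeInner (fun z => Complex.exp (α * z))
            (displacement ξ fun z => Complex.exp (α' * z)))
          = fun ξ => Complex.exp (conj α * α') * Complex.exp (-((1 : ℝ) : ℂ) * (‖ξ‖ : ℂ) ^ 2
            + (conj α - z) * ξ + (conj z - α') * conj ξ) := by
        funext ξ
        rw [modeInner_exp, coherentPhase]
        push_cast
        rw [← Complex.exp_add, ← Complex.exp_add, ← Complex.exp_add]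
        congr 1
        ring
      rw [h2]
      refine ⟨(integrable_cexp_gaussian one_pos _ _).const_mul _, ?_⟩
      rw [integral_const_mul, integral_cexp_gaussian one_pos, ← Complex.exp_conj, bargmannWeight]
      push_cast
      rw [← Complex.mul_conj' z]
      field_simp
      rw [← Complex.exp_add, ← Complex.exp_add, ← Complex.exp_add]
      congr 1
      rw [map_mul]
      ring
    | zero => simp [modeInner_eq]
    | add F₁ F₂ hm₁ hm₂ h₁ h₂ =>
      have hi : ∀ ξ, modeInner (F₁ + F₂) (displacement ξ fun z => Complex.exp (α' * z))
          = modeInner F₁ (displacement ξ fun z => Complex.exp (α' * z))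
            + modeInner F₂ (displacement ξ fun z => Complex.exp (α' * z)) := fun ξ => by
        have hd := moderate_of_mem_coherentSpan
          (displacement_mem_coherentSpan ξ (exp_mem_coherentSpan α'))
        rw [← conj_modeInner, modeInner_add_right hd (moderate_of_mem_coherentSpan hm₁)
          (moderate_of_mem_coherentSpan hm₂), map_add, conj_modeInner, conj_modeInner]
      simp only [hi, mul_add]
      refine ⟨h₁.1.add h₂.1, ?_⟩
      rw [integral_add h₁.1 h₂.1, mul_add, ← h₁.2, ← h₂.2, Pi.add_apply, map_add]
      ring
    | smul c F _ h =>
      have hi : ∀ ξ, modeInner (c • F) (displacement ξ fun z => Complex.exp (α' * z))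
          = conj c * modeInner F (displacement ξ fun z => Complex.exp (α' * z)) := fun ξ => by
        rw [← conj_modeInner, modeInner_smul_right, map_mul, conj_modeInner]
      simp only [hi, mul_left_comm _ (conj c)]
      refine ⟨h.1.const_mul _, ?_⟩
      rw [integral_const_mul, mul_left_comm, ← h.2, Pi.smul_apply, smul_eq_mul, map_mul]
      ring
  | zero =>
    have h0 : ∀ ξ, displacement ξ 0 = 0 := fun ξ => by funext w; simp [displacement]
    simp [h0, modeInner_eq]
  | add G₁ G₂ hm₁ hm₂ h₁ h₂ =>
    have hi : ∀ ξ, modeInner F (displacement ξ (G₁ + G₂))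
        = modeInner F (displacement ξ G₁) + modeInner F (displacement ξ G₂) := fun ξ => by
      rw [displacement_add, modeInner_add_right (moderate_of_mem_coherentSpan hF)
        (moderate_of_mem_coherentSpan (displacement_mem_coherentSpan ξ hm₁))
        (moderate_of_mem_coherentSpan (displacement_mem_coherentSpan ξ hm₂))]
    simp only [hi, mul_add]
    refine ⟨h₁.1.add h₂.1, ?_⟩
    rw [integral_add h₁.1 h₂.1, mul_add, ← h₁.2, ← h₂.2, Pi.add_apply]
    ring
  | smul c G _ h =>
    have hi : ∀ ξ, modeInner F (displacement ξ (c • G)) = c * modeInner F (displacement ξ G) :=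
      fun ξ => by rw [displacement_smul, modeInner_smul_right]
    simp only [hi, mul_left_comm _ c]
    refine ⟨h.1.const_mul _, ?_⟩
    rw [integral_const_mul, mul_left_comm, ← h.2, Pi.smul_apply, smul_eq_mul]
    ring

/-! ### The reproducing property -/

theorem integral_bargmannWeight : ∫ z, bargmannWeight z = 1 := by
  have h := integral_exp_neg_mul_sq_norm one_pos
  simp only [neg_mul, one_mul, div_one] at h
  simp only [bargmannWeight, integral_div, h]
  exact div_self Real.pi_ne_zero

/-- The weight is rotation invariant, so the integral may be averaged over rotations of the
argument; by the mean value property each circle average of F is F 0. The growth bound in `Moderate`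
justifies Fubini's theorem. -/
theorem integral_mul_bargmannWeight {F : ModeState} (hF : Moderate F) (hd : Differentiable ℂ F) :
    ∫ z : ℂ, F z * (bargmannWeight z : ℂ) = F 0 := by
  have hrot : ∀ θ : ℝ, ∫ z : ℂ, F (circleMap 0 1 θ * z) * (bargmannWeight z : ℂ)
      = ∫ z : ℂ, F z * (bargmannWeight z : ℂ) := fun θ => by
    have hu : ‖circleMap 0 1 θ‖ = 1 := by simp
    have h := (rotation ⟨circleMap 0 1 θ, mem_sphere_zero_iff_norm.2 hu⟩).measurePreserving
      |>.integral_comp (rotation _).toHomeomorph.measurableEmbedding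
        (fun z => F z * (bargmannWeight z : ℂ))
    rw [← h]
    refine integral_congr_ae (ae_of_all _ fun z => ?_)
    have hz : rotation ⟨circleMap 0 1 θ, mem_sphere_zero_iff_norm.2 hu⟩ z = circleMap 0 1 θ * z :=
      rfl
    simp only [hz, bargmannWeight, norm_mul, hu, one_mul]
  have hmean : ∀ z : ℂ, ∫ θ in Set.Ioc 0 (2 * Real.pi), F (circleMap 0 1 θ * z) * (bargmannWeight z : ℂ)
      = 2 * Real.pi * F 0 * (bargmannWeight z : ℂ) := fun z => by
    rw [← intervalIntegral.integral_of_le (by positivity)]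
    have h := ((hd.comp (differentiable_id.mul_const z)).diffContOnCl
      (s := Metric.ball 0 |1|)).circleAverage
    rw [Real.circleAverage_def] at h
    simp only [Function.comp_apply, id, zero_mul] at h
    rw [intervalIntegral.integral_mul_const, ← h, Complex.real_smul]
    have := Complex.ofReal_ne_zero.2 Real.pi_ne_zero
    push_cast
    have h2 : (2 * Real.pi : ℂ) ≠ 0 := mul_ne_zero two_ne_zero this
    rw [mul_inv_cancel_left₀ h2]
  have hint : Integrable (Function.uncurry fun (θ : ℝ) (z : ℂ) =>
      F (circleMap 0 1 θ * z) * (bargmannWeight z : ℂ))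
      ((volume.restrict (Set.Ioc 0 (2 * Real.pi))).prod volume) := by
    obtain ⟨hc, C, t, hC, ht0, ht, hb⟩ := hF
    have hi := (((integrable_exp_neg_mul_sq_norm (sub_pos.2 ht)).const_mul C).add
      (integrable_exp_neg_mul_sq_norm one_pos)).div_const (2 * Real.pi)
    refine (hi.comp_snd (volume.restrict (Set.Ioc 0 (2 * Real.pi)))).mono'
      (((hc.comp (by fun_prop)).mul (Complex.continuous_ofReal.comp
        (continuous_bargmannWeight.comp continuous_snd))).aestronglyMeasurable)
      (ae_of_all _ fun p => ?_)
    obtain ⟨θ, z⟩ := p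
    have h1 := hb (circleMap 0 1 θ * z)
    have hu : ‖circleMap 0 1 θ‖ = 1 := by simp
    rw [norm_mul (circleMap 0 1 θ), hu, one_mul] at h1
    simp only [Function.uncurry, norm_mul, Complex.norm_of_nonneg (bargmannWeight_pos z).le,
      Pi.add_apply]
    rw [show -(1 - t) * ‖z‖ ^ 2 = t * ‖z‖ ^ 2 + -‖z‖ ^ 2 by ring, Real.exp_add, neg_one_mul,
      bargmannWeight]
    set N := ‖F (circleMap 0 1 θ * z)‖
    have h2 : N ≤ (C * Real.exp (t * ‖z‖ ^ 2) + 1) / 2 := by nlinarith [sq_nonneg (N - 1)]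
    refine (mul_le_mul_of_nonneg_right h2 (bargmannWeight_pos z).le).trans_eq ?_
    rw [bargmannWeight]
    have := Real.pi_ne_zero
    field_simp
  have h := integral_integral_swap hint
  simp only [hrot, hmean] at h
  rw [integral_const, integral_const_mul, integral_complex_ofReal,
    integral_bargmannWeight, Complex.real_smul] at h
  simp only [measureReal_restrict_apply_univ, Real.volume_real_Ioc_of_le Real.two_pi_pos.le,
    sub_zero] at h
  push_cast at h
  have h2 : (2 * Real.pi : ℂ) ≠ 0 := by simp
  exact mul_left_cancel₀ h2 (by rw [h]; simp)

theorem modeInner_vacuum {F : ModeState} (hF : Moderate F) (hd : Differentiable ℂ F) :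
    modeInner F vacuum = conj (F 0) := by
  rw [← conj_modeInner, modeInner_eq, ← integral_mul_bargmannWeight hF hd]
  congr 1
  refine integral_congr_ae (ae_of_all _ fun z => ?_)
  simp [vacuum]

/-- Coherent states evaluate entire functions. This formula gives continuity, boundedness and
non-vanishing of the overlaps. -/
theorem modeInner_displacement_vacuum {F : ModeState} (hF : Moderate F) (hd : Differentiable ℂ F)
    (γ : ℂ) : modeInner F (displacement γ vacuum)
      = ((Real.exp (-(‖γ‖ ^ 2 / 2)) : ℝ) : ℂ) * conj (F (conj γ)) := by
  rw [modeInner_displacement_right, modeInner_vacuum (hF.displacement _)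
    (differentiable_displacement hd _)]
  simp only [displacement, map_mul, ← Complex.exp_conj]
  simp [Complex.conj_ofNat]

/-! ### Independent layers -/

/-- The parameters `(β, θ, φ)` of one layer. -/
abbrev LayerParams : Type := ℂ × ℝ × ℝ

/-- The law of the parameters of one layer. -/
def layerLaw (v : ℝ) : Measure LayerParams :=
  (complexGaussian v).prod (uniformAngle.prod uniformAngle)

instance (v : ℝ) : IsProbabilityMeasure (layerLaw v) := by
  unfold layerLaw
  infer_instance

/-- The law of the parameters of `L` independent layers. -/
def layersLaw (v : ℝ) (L : ℕ) : Measure (Fin L → LayerParams) := Measure.pi fun _ => layerLaw v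

instance (v : ℝ) (L : ℕ) : IsProbabilityMeasure (layersLaw v L) := by
  unfold layersLaw
  infer_instance

/-- The circuit parameters with given layers. -/
def toCircuitParams {L : ℕ} (y : Fin L → LayerParams) : CircuitParams L :=
  (fun i => (y i).1, fun i => (y i).2.1, fun i => (y i).2.2)

/-- The layers of given circuit parameters. -/
def ofCircuitParams {L : ℕ} (x : CircuitParams L) : Fin L → LayerParams :=
  fun i => (x.1 i, x.2.1 i, x.2.2 i)

theorem continuous_ofCircuitParams {L : ℕ} :
    Continuous (ofCircuitParams : CircuitParams L → Fin L → LayerParams) := by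
  unfold ofCircuitParams
  fun_prop

theorem measurePreserving_toCircuitParams (E : ℝ) (L : ℕ) :
    MeasurePreserving toCircuitParams (layersLaw (E / L) L) (circuitEnsemble E L) :=
  ((MeasurePreserving.id _).prod
    (measurePreserving_arrowProdEquivProdArrow ℝ ℝ (Fin L) (fun _ => uniformAngle)
      fun _ => uniformAngle)).comp
    (measurePreserving_arrowProdEquivProdArrow ℂ (ℝ × ℝ) (Fin L)
      (fun _ => complexGaussian (E / L)) fun _ => uniformAngle.prod uniformAngle)

theorem Continuous.integrable_of_bounded {X V : Type*} [TopologicalSpace X]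
    [SecondCountableTopology X] [MeasurableSpace X] [BorelSpace X] [NormedAddCommGroup V]
    {μ : Measure X} [IsFiniteMeasure μ] {f : X → V} (hf : Continuous f) {C : ℝ}
    (hb : ∀ x, ‖f x‖ ≤ C) : Integrable f μ :=
  Integrable.of_bound hf.aestronglyMeasurable C (ae_of_all _ hb)

section LayerIntegrals

variable {V : Type*} [NormedAddCommGroup V] [NormedSpace ℝ V]

theorem integral_circuitEnsemble {E : ℝ} {L : ℕ} {f : CircuitParams L → V} (hf : Continuous f) :
    ∫ x, f x ∂circuitEnsemble E L = ∫ y, f (toCircuitParams y) ∂layersLaw (E / L) L := by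
  rw [← (measurePreserving_toCircuitParams E L).map_eq]
  exact integral_map (measurePreserving_toCircuitParams E L).aemeasurable
    hf.aestronglyMeasurable

/-- The layers `y`, followed by the layer `p`. -/
def addLayer {L : ℕ} (y : Fin L → LayerParams) (p : LayerParams) : Fin (L + 1) → LayerParams :=
  Fin.snoc (α := fun _ => LayerParams) y p

@[simp] theorem addLayer_castSucc {L : ℕ} (y : Fin L → LayerParams) (p : LayerParams) (i : Fin L) :
    addLayer y p i.castSucc = y i := Fin.snoc_castSucc (α := fun _ => LayerParams) p y i

@[simp] theorem addLayer_last {L : ℕ} (y : Fin L → LayerParams) (p : LayerParams) :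
    addLayer y p (Fin.last L) = p := Fin.snoc_last (α := fun _ => LayerParams) p y

theorem measurePreserving_addLayer (v : ℝ) (L : ℕ) :
    MeasurePreserving (fun q : (Fin L → LayerParams) × LayerParams => addLayer q.1 q.2)
      ((layersLaw v L).prod (layerLaw v)) (layersLaw v (L + 1)) := by
  have h := (measurePreserving_piFinSuccAbove (fun _ : Fin (L + 1) => layerLaw v)
    (Fin.last L)).symm
  have h2 := h.comp (Measure.measurePreserving_swap (μ := layersLaw v L) (ν := layerLaw v))
  convert h2 using 1
  swap
  · rfl
  funext q
  change _ = Fin.insertNth (α := fun _ => LayerParams) (Fin.last L) q.2 q.1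
  rw [Fin.insertNth_last']
  rfl

/-- Resampling one of several independent layers does not change the law. This permits averaging
over the angles of layer k with everything else fixed. -/
theorem measurePreserving_updateLayer (v : ℝ) {L : ℕ} (k : Fin L) :
    MeasurePreserving (fun q : (Fin L → LayerParams) × LayerParams => Function.update q.1 k q.2)
      ((layersLaw v L).prod (layerLaw v)) (layersLaw v L) := by
  have hm : Measurable fun q : (Fin L → LayerParams) × LayerParams => Function.update q.1 k q.2 :=
    measurable_pi_iff.2 fun i => by
      rcases eq_or_ne i k with rfl | h
      · simpa using measurable_snd
      · simp only [Function.update_of_ne h]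
        exact (measurable_pi_apply i).comp measurable_fst
  refine ⟨hm, ?_⟩
  symm
  refine Measure.pi_eq fun s hs => ?_
  rw [Measure.map_apply hm (MeasurableSet.univ_pi hs)]
  have hset : (fun q : (Fin L → LayerParams) × LayerParams => Function.update q.1 k q.2) ⁻¹'
      Set.univ.pi s = (Set.univ.pi (Function.update s k Set.univ)) ×ˢ s k := by
    ext q
    simp only [Set.mem_preimage, Set.mem_pi, Set.mem_univ, true_imp_iff, Set.mem_prod]
    constructor
    · refine fun h => ⟨fun i => ?_, by simpa using h k⟩
      rcases eq_or_ne i k with rfl | hi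
      · simp
      · simpa [Function.update_of_ne hi] using h i
    · rintro ⟨h1, h2⟩ i
      rcases eq_or_ne i k with rfl | hi
      · simpa using h2
      · simpa [Function.update_of_ne hi] using h1 i
  rw [hset, Measure.prod_prod, layersLaw, Measure.pi_pi,
    ← Finset.mul_prod_erase _ _ (Finset.mem_univ k),
    ← Finset.mul_prod_erase _ (fun i => layerLaw v (s i)) (Finset.mem_univ k)]
  rw [Function.update_self, measure_univ, one_mul, mul_comm]
  congr 1
  refine Finset.prod_congr rfl fun i hi => ?_
  rw [Function.update_of_ne (Finset.ne_of_mem_erase hi)]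

theorem integral_layersLaw_succ {v : ℝ} {L : ℕ} {f : (Fin (L + 1) → LayerParams) → V}
    (hf : Integrable f (layersLaw v (L + 1))) :
    ∫ y, f y ∂layersLaw v (L + 1)
      = ∫ y, ∫ p, f (addLayer y p) ∂layerLaw v ∂layersLaw v L := by
  have hm := measurePreserving_addLayer v L
  have hi : Integrable (fun q : (Fin L → LayerParams) × LayerParams => f (addLayer q.1 q.2))
      ((layersLaw v L).prod (layerLaw v)) := hm.integrable_comp_of_integrable hf
  rw [← integral_prod _ hi]
  conv_lhs => rw [← hm.map_eq]
  exact integral_map hm.aemeasurable (by rw [hm.map_eq]; exact hf.aestronglyMeasurable)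

theorem integral_layersLaw_update {v : ℝ} {L : ℕ} (k : Fin L) {f : (Fin L → LayerParams) → V}
    (hf : Integrable f (layersLaw v L)) :
    ∫ y, f y ∂layersLaw v L
      = ∫ y, ∫ p, f (Function.update y k p) ∂layerLaw v ∂layersLaw v L := by
  have hm := measurePreserving_updateLayer v k
  have hi : Integrable (fun q : (Fin L → LayerParams) × LayerParams =>
      f (Function.update q.1 k q.2)) ((layersLaw v L).prod (layerLaw v)) :=
    hm.integrable_comp_of_integrable hf
  rw [← integral_prod _ hi]
  conv_lhs => rw [← hm.map_eq]
  exact integral_map hm.aemeasurable (by rw [hm.map_eq]; exact hf.aestronglyMeasurable)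

theorem integral_layerLaw {v : ℝ} {f : LayerParams → V} (hf : Integrable f (layerLaw v)) :
    ∫ p, f p ∂layerLaw v = ∫ β, ∫ q, f (β, q) ∂uniformAngle.prod uniformAngle
      ∂complexGaussian v := integral_prod _ hf

/-! ### Averages over the angles -/

theorem integral_uniformAngle_cos (n : ℕ) : ∫ θ, Real.cos ((n + 1 : ℕ) * θ) ∂uniformAngle = 0 := by
  rw [integral_uniformAngle, intervalIntegral.integral_comp_mul_left Real.cos (by positivity),
    integral_cos, mul_zero, Real.sin_zero,
    show ((n + 1 : ℕ) : ℝ) * (2 * Real.pi) = ((2 * (n + 1) : ℕ) : ℝ) * Real.pi by push_cast; ring,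
    Real.sin_nat_mul_pi]
  simp

theorem integral_uniformAngle_sin (n : ℕ) : ∫ θ, Real.sin ((n + 1 : ℕ) * θ) ∂uniformAngle = 0 := by
  rw [integral_uniformAngle, intervalIntegral.integral_comp_mul_left Real.sin (by positivity),
    integral_sin, mul_zero, Real.cos_zero, Real.cos_nat_mul_two_pi]
  simp

/-- The frequencies 1, 2 and 4 are all that occur: 1 and 2 from first-order polynomials in one angle
and their squares, 4 from squares of expressions of frequency 2 in φ. -/
theorem integral_uniformAngle_trig (a b₁ c₁ b₂ c₂ b₄ c₄ : V) [CompleteSpace V] :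
    ∫ θ, (a + (Real.cos θ • b₁ + Real.sin θ • c₁) + (Real.cos (2 * θ) • b₂ + Real.sin (2 * θ) • c₂)
      + (Real.cos (4 * θ) • b₄ + Real.sin (4 * θ) • c₄)) ∂uniformAngle = a := by
  have hc : ∀ n : ℝ, ∀ b : V, Integrable (fun θ => Real.cos (n * θ) • b) uniformAngle :=
    fun n b => (by fun_prop : Continuous fun θ => Real.cos (n * θ) • b).integrable_of_bounded
      (C := ‖b‖) fun θ => by
        rw [norm_smul]
        exact mul_le_of_le_one_left (norm_nonneg _) (Real.abs_cos_le_one _)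
  have hs : ∀ n : ℝ, ∀ b : V, Integrable (fun θ => Real.sin (n * θ) • b) uniformAngle :=
    fun n b => (by fun_prop : Continuous fun θ => Real.sin (n * θ) • b).integrable_of_bounded
      (C := ‖b‖) fun θ => by
        rw [norm_smul]
        exact mul_le_of_le_one_left (norm_nonneg _) (Real.abs_sin_le_one _)
  have hc1 := hc 1 b₁
  have hs1 := hs 1 c₁
  simp only [one_mul] at hc1 hs1
  have e1 := integral_uniformAngle_cos 0
  have e2 := integral_uniformAngle_cos 1
  have e4 := integral_uniformAngle_cos 3
  have f1 := integral_uniformAngle_sin 0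
  have f2 := integral_uniformAngle_sin 1
  have f4 := integral_uniformAngle_sin 3
  norm_num at e1 e2 e4 f1 f2 f4
  have i1 : Integrable (fun θ => Real.cos θ • b₁ + Real.sin θ • c₁) uniformAngle := hc1.add hs1
  have i2 : Integrable (fun θ => Real.cos (2 * θ) • b₂ + Real.sin (2 * θ) • c₂) uniformAngle :=
    (hc 2 b₂).add (hs 2 c₂)
  have i4 : Integrable (fun θ => Real.cos (4 * θ) • b₄ + Real.sin (4 * θ) • c₄) uniformAngle :=
    (hc 4 b₄).add (hs 4 c₄)
  have i0 : Integrable (fun θ => a + (Real.cos θ • b₁ + Real.sin θ • c₁)) uniformAngle :=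
    (integrable_const a).add i1
  have i3 : Integrable (fun θ => a + (Real.cos θ • b₁ + Real.sin θ • c₁)
      + (Real.cos (2 * θ) • b₂ + Real.sin (2 * θ) • c₂)) uniformAngle := i0.add i2
  rw [integral_add i3 i4, integral_add i0 i2, integral_add (integrable_const a) i1,
    integral_add hc1 hs1, integral_add (hc 2 b₂) (hs 2 c₂), integral_add (hc 4 b₄) (hs 4 c₄)]
  simp only [integral_smul_const, e1, e2, e4, f1, f2, f4, zero_smul, add_zero, integral_const,
    probReal_univ, one_smul]

end LayerIntegrals

/-! ### One rotation -/

/-- An amplitude, as a function of the angles of one rotation. -/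
def rotationAmplitude (u v w : ℂ) (θ φ : ℝ) : ℂ :=
  Real.cos (θ / 2) * u + Real.sin (θ / 2) * (Real.cos φ * v + Real.sin φ * w)

/-- The derivative of `‖rotationAmplitude u v w θ φ‖ ^ 2` in `θ`. -/
def rotationSlope (u v w : ℂ) (θ φ : ℝ) : ℝ :=
  -Real.sin θ * ((‖u‖ ^ 2 - ‖Real.cos φ * v + Real.sin φ * w‖ ^ 2) / 2)
    + Real.cos θ * (conj u * (Real.cos φ * v + Real.sin φ * w)).re

theorem norm_sq_rotationAmplitude (u v w : ℂ) (θ φ : ℝ) :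
    ‖rotationAmplitude u v w θ φ‖ ^ 2
      = (‖u‖ ^ 2 + ‖Real.cos φ * v + Real.sin φ * w‖ ^ 2) / 2
        + Real.cos θ * ((‖u‖ ^ 2 - ‖Real.cos φ * v + Real.sin φ * w‖ ^ 2) / 2)
        + Real.sin θ * (conj u * (Real.cos φ * v + Real.sin φ * w)).re := by
  set q : ℂ := Real.cos φ * v + Real.sin φ * w with hq
  rw [rotationAmplitude, ← hq]
  have h1 := Real.cos_two_mul (θ / 2)
  have h2 := Real.sin_two_mul (θ / 2)
  have h3 := Real.sin_sq_add_cos_sq (θ / 2)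
  rw [mul_div_cancel₀ θ two_ne_zero] at h1 h2
  rw [h1, h2, ← Complex.normSq_eq_norm_sq, ← Complex.normSq_eq_norm_sq,
    ← Complex.normSq_eq_norm_sq]
  simp only [Complex.normSq_apply, Complex.add_re, Complex.add_im, Complex.mul_im,
    Complex.ofReal_re, Complex.ofReal_im, Complex.mul_re, Complex.conj_re, Complex.conj_im]
  linear_combination (q.re ^ 2 + q.im ^ 2) * h3

theorem hasDerivAt_norm_sq_rotationAmplitude (u v w : ℂ) (θ φ : ℝ) :
    HasDerivAt (fun t => ‖rotationAmplitude u v w t φ‖ ^ 2) (rotationSlope u v w θ φ) θ := by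
  simp only [norm_sq_rotationAmplitude]
  exact (((Real.hasDerivAt_cos θ).mul_const _).const_add _).add ((Real.hasDerivAt_sin θ).mul_const _)

/-- The parameter-shift rule. -/
theorem rotationSlope_eq (u v w : ℂ) (θ φ : ℝ) : rotationSlope u v w θ φ
    = (‖rotationAmplitude u v w (θ + Real.pi / 2) φ‖ ^ 2
      - ‖rotationAmplitude u v w (θ - Real.pi / 2) φ‖ ^ 2) / 2 := by
  simp only [norm_sq_rotationAmplitude, rotationSlope, Real.cos_add_pi_div_two,
    Real.sin_add_pi_div_two, Real.cos_sub_pi_div_two, Real.sin_sub_pi_div_two]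
  ring

theorem integral_rotationSlope (u v w : ℂ) (φ : ℝ) :
    ∫ θ, rotationSlope u v w θ φ ∂uniformAngle = 0 := by
  refine Eq.trans ?_ (integral_uniformAngle_trig (0 : ℝ) (conj u * (Real.cos φ * v + Real.sin φ * w)).re
    (-((‖u‖ ^ 2 - ‖Real.cos φ * v + Real.sin φ * w‖ ^ 2) / 2)) 0 0 0 0)
  congr 1
  funext θ
  simp only [rotationSlope, smul_eq_mul]
  ring

theorem integral_trig_sq (m x y : ℝ) :
    ∫ θ, (m + Real.cos θ * x + Real.sin θ * y) ^ 2 ∂uniformAngle = m ^ 2 + (x ^ 2 + y ^ 2) / 2 := by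
  refine Eq.trans ?_ (integral_uniformAngle_trig (m ^ 2 + (x ^ 2 + y ^ 2) / 2) (2 * m * x) (2 * m * y)
    ((x ^ 2 - y ^ 2) / 2) (x * y) 0 0)
  congr 1
  funext θ
  simp only [smul_eq_mul]
  have h := Real.sin_sq_add_cos_sq θ
  have h4 : Real.sin θ ^ 2 = 1 - Real.cos θ ^ 2 := by linarith
  rw [Real.cos_two_mul, Real.sin_two_mul]
  ring_nf
  rw [h4]
  ring

theorem integral_rotationSlope_sq (u v w : ℂ) (φ : ℝ) :
    ∫ θ, rotationSlope u v w θ φ ^ 2 ∂uniformAngle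
      = (((‖u‖ ^ 2 - ‖Real.cos φ * v + Real.sin φ * w‖ ^ 2) / 2) ^ 2
        + (conj u * (Real.cos φ * v + Real.sin φ * w)).re ^ 2) / 2 := by
  have h := integral_trig_sq 0 (conj u * (Real.cos φ * v + Real.sin φ * w)).re
    (-((‖u‖ ^ 2 - ‖Real.cos φ * v + Real.sin φ * w‖ ^ 2) / 2))
  rw [show ∀ a b : ℝ, (a ^ 2 + b ^ 2) / 2 = 0 ^ 2 + (b ^ 2 + (-a) ^ 2) / 2 from
    fun a b => by ring, ← h]
  congr 1
  funext θ
  rw [rotationSlope]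
  ring

/-- For a first-order polynomial m + x cos θ + y sin θ the mean square is m² + (x² + y²)/2, and
differentiation only removes m². -/
theorem integral_rotationSlope_sq_le (u v w : ℂ) (φ : ℝ) :
    ∫ θ, rotationSlope u v w θ φ ^ 2 ∂uniformAngle
      ≤ ∫ θ, (‖rotationAmplitude u v w θ φ‖ ^ 2) ^ 2 ∂uniformAngle := by
  simp only [norm_sq_rotationAmplitude]
  rw [integral_trig_sq, integral_rotationSlope_sq]
  nlinarith [sq_nonneg ((‖u‖ ^ 2 + ‖Real.cos φ * v + Real.sin φ * w‖ ^ 2) / 2)]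

theorem integral_norm_sq_rotationAmplitude (u v w : ℂ) (φ : ℝ) :
    ∫ θ, ‖rotationAmplitude u v w θ φ‖ ^ 2 ∂uniformAngle
      = (‖u‖ ^ 2 + ‖Real.cos φ * v + Real.sin φ * w‖ ^ 2) / 2 := by
  simp only [norm_sq_rotationAmplitude]
  refine Eq.trans ?_ (integral_uniformAngle_trig ((‖u‖ ^ 2 + ‖Real.cos φ * v + Real.sin φ * w‖ ^ 2) / 2)
    ((‖u‖ ^ 2 - ‖Real.cos φ * v + Real.sin φ * w‖ ^ 2) / 2)
    (conj u * (Real.cos φ * v + Real.sin φ * w)).re 0 0 0 0)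
  congr 1
  funext θ
  simp only [smul_eq_mul]
  ring

theorem norm_sq_cos_mul_add_sin_mul (v w : ℂ) (φ : ℝ) :
    ‖Real.cos φ * v + Real.sin φ * w‖ ^ 2 = (‖v‖ ^ 2 + ‖w‖ ^ 2) / 2
      + Real.cos (2 * φ) * ((‖v‖ ^ 2 - ‖w‖ ^ 2) / 2) + Real.sin (2 * φ) * (conj v * w).re := by
  have h3 := Real.sin_sq_add_cos_sq φ
  rw [Real.cos_two_mul, Real.sin_two_mul, ← Complex.normSq_eq_norm_sq,
    ← Complex.normSq_eq_norm_sq, ← Complex.normSq_eq_norm_sq]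
  simp only [Complex.normSq_apply, Complex.add_re, Complex.add_im, Complex.mul_im,
    Complex.ofReal_re, Complex.ofReal_im, Complex.mul_re, Complex.conj_re, Complex.conj_im]
  linear_combination (w.re ^ 2 + w.im ^ 2) * h3

theorem integral_integral_norm_sq_rotationAmplitude (u v w : ℂ) :
    ∫ φ, ∫ θ, ‖rotationAmplitude u v w θ φ‖ ^ 2 ∂uniformAngle ∂uniformAngle
      = ‖u‖ ^ 2 / 2 + (‖v‖ ^ 2 + ‖w‖ ^ 2) / 4 := by
  simp only [integral_norm_sq_rotationAmplitude, norm_sq_cos_mul_add_sin_mul]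
  refine Eq.trans ?_ (integral_uniformAngle_trig (‖u‖ ^ 2 / 2 + (‖v‖ ^ 2 + ‖w‖ ^ 2) / 4) 0 0
    ((‖v‖ ^ 2 - ‖w‖ ^ 2) / 4) ((conj v * w).re / 2) 0 0)
  congr 1
  funext θ
  simp only [smul_eq_mul]
  ring

theorem integral_integral_rotationSlope_sq (u v w : ℂ) :
    ∫ φ, ∫ θ, rotationSlope u v w θ φ ^ 2 ∂uniformAngle ∂uniformAngle
      = ((‖u‖ ^ 2 - (‖v‖ ^ 2 + ‖w‖ ^ 2) / 2) ^ 2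
          + ((‖v‖ ^ 2 - ‖w‖ ^ 2) ^ 2 / 4 + (conj v * w).re ^ 2) / 2) / 8
        + ((conj u * v).re ^ 2 + (conj u * w).re ^ 2) / 4 := by
  simp only [integral_rotationSlope_sq, norm_sq_cos_mul_add_sin_mul]
  set P := ‖u‖ ^ 2 - (‖v‖ ^ 2 + ‖w‖ ^ 2) / 2 with hP
  set x := (‖v‖ ^ 2 - ‖w‖ ^ 2) / 2 with hx
  set y := (conj v * w).re
  set A := (conj u * v).re with hA
  set B := (conj u * w).re with hB
  refine Eq.trans ?_ (integral_uniformAngle_trig ((P ^ 2 + ((‖v‖ ^ 2 - ‖w‖ ^ 2) ^ 2 / 4 + y ^ 2) / 2) / 8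
    + (A ^ 2 + B ^ 2) / 4) 0 0 (-(P * x) / 4 + (A ^ 2 - B ^ 2) / 4) (-(P * y) / 4 + A * B / 2)
    ((x ^ 2 - y ^ 2) / 16) (x * y / 8))
  congr 1
  funext φ
  have hq : (conj u * (Real.cos φ * v + Real.sin φ * w)).re
      = Real.cos φ * A + Real.sin φ * B := by
    rw [hA, hB]
    simp only [Complex.mul_re, Complex.add_re, Complex.add_im, Complex.mul_im,
      Complex.ofReal_re, Complex.ofReal_im, Complex.conj_re, Complex.conj_im]
    ring
  rw [hq]
  simp only [smul_eq_mul]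
  have e1 : Real.sin φ ^ 2 = 1 - Real.cos φ ^ 2 := by linarith [Real.sin_sq_add_cos_sq φ]
  have e2 : Real.sin (2 * φ) ^ 2 = 1 - Real.cos (2 * φ) ^ 2 := by
    linarith [Real.sin_sq_add_cos_sq (2 * φ)]
  have e3 : Real.cos (2 * φ) = 2 * Real.cos φ ^ 2 - 1 := Real.cos_two_mul φ
  have e4 : Real.sin (2 * φ) = 2 * Real.sin φ * Real.cos φ := Real.sin_two_mul φ
  rw [show 4 * φ = 2 * (2 * φ) by ring, Real.cos_two_mul (2 * φ), Real.sin_two_mul (2 * φ)]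
  have hu : ‖u‖ ^ 2 = P + (‖v‖ ^ 2 + ‖w‖ ^ 2) / 2 := by rw [hP]; ring
  have hx2 : (‖v‖ ^ 2 - ‖w‖ ^ 2) ^ 2 / 4 = x ^ 2 := by rw [hx]; ring
  rw [hu, hx2]
  set c2 := Real.cos (2 * φ)
  set s2 := Real.sin (2 * φ)
  have f1 : (Real.cos φ * A + Real.sin φ * B) ^ 2
      = (A ^ 2 + B ^ 2) / 2 + c2 * ((A ^ 2 - B ^ 2) / 2) + s2 * (A * B) := by
    rw [e3, e4]
    linear_combination B ^ 2 * e1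
  rw [f1]
  linear_combination (y ^ 2 / 8) * e2

/-- The fluctuation of the slope controls the mean of the cost. -/
theorem integral_norm_sq_rotationAmplitude_sq_le (u v w : ℂ) :
    (∫ φ, ∫ θ, ‖rotationAmplitude u v w θ φ‖ ^ 2 ∂uniformAngle ∂uniformAngle) ^ 2
      ≤ 18 * ∫ φ, ∫ θ, rotationSlope u v w θ φ ^ 2 ∂uniformAngle ∂uniformAngle := by
  rw [integral_integral_norm_sq_rotationAmplitude, integral_integral_rotationSlope_sq]
  -- View u, v, w as vectors of the real plane and let G = vvᵀ + wwᵀ. The smallest eigenvalue of G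
  -- is at least det G / tr G. So u cannot be nearly orthogonal to both v and w unless these are
  -- nearly parallel.
  have hg : ‖u‖ ^ 2 * (‖v‖ ^ 2 * ‖w‖ ^ 2 - (conj v * w).re ^ 2)
      ≤ (‖v‖ ^ 2 + ‖w‖ ^ 2) * ((conj u * v).re ^ 2 + (conj u * w).re ^ 2) := by
    rw [← Complex.normSq_eq_norm_sq, ← Complex.normSq_eq_norm_sq, ← Complex.normSq_eq_norm_sq]
    simp only [Complex.normSq_apply, Complex.mul_re, Complex.conj_re, Complex.conj_im]
    have h1 := sq_nonneg (v.re * (u.re * v.re + u.im * v.im) + w.re * (u.re * w.re + u.im * w.im))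
    have h2 := sq_nonneg (v.im * (u.re * v.re + u.im * v.im) + w.im * (u.re * w.re + u.im * w.im))
    nlinarith [h1, h2]
  have hd : 0 ≤ ‖v‖ ^ 2 * ‖w‖ ^ 2 - (conj v * w).re ^ 2 := by
    rw [← Complex.normSq_eq_norm_sq, ← Complex.normSq_eq_norm_sq]
    simp only [Complex.normSq_apply, Complex.mul_re, Complex.conj_re, Complex.conj_im]
    nlinarith [sq_nonneg (v.re * w.im - v.im * w.re)]
  set N := (conj u * v).re ^ 2 + (conj u * w).re ^ 2
  have hN : 0 ≤ N := by positivity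
  set X := (conj v * w).re
  have hP := sq_nonneg ‖u‖
  have hV := sq_nonneg ‖v‖
  have hW := sq_nonneg ‖w‖
  generalize ‖u‖ ^ 2 = P at *
  generalize ‖v‖ ^ 2 = v₂ at *
  generalize ‖w‖ ^ 2 = w₂ at *
  obtain ⟨s, hs⟩ : ∃ s, s = (v₂ + w₂) / 2 := ⟨_, rfl⟩
  obtain ⟨Δ, hΔ⟩ : ∃ Δ, Δ = v₂ * w₂ - X ^ 2 := ⟨_, rfl⟩
  have hs0 : 0 ≤ s := by linarith
  have hΔs : Δ ≤ s ^ 2 := by rw [hΔ, hs]; nlinarith [sq_nonneg (v₂ - w₂), sq_nonneg X]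
  rw [← hΔ] at hg hd
  rw [show (v₂ - w₂) ^ 2 / 4 + X ^ 2 = s ^ 2 - Δ by rw [hs, hΔ]; ring, ← hs,
    show (v₂ + w₂) / 4 = s / 2 by rw [hs]; ring]
  rw [show v₂ + w₂ = 2 * s by rw [hs]; ring] at hg
  rcases hs0.eq_or_lt with h0 | h0
  · rw [← h0] at hΔs ⊢
    nlinarith
  · refine le_of_mul_le_mul_left ?_ (pow_pos h0 2)
    -- Once `hg` has bounded N from below, the claim is affine in Δ on [0, s²], so its endpoints
    -- suffice. At Δ = 0 it is the square (4P - 5s)²/8, which shows that 18 is sharp; at Δ = s² it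
    -- is a positive quadratic form in P and s.
    have hmix : 0 ≤ (s ^ 2 - Δ) * (4 * P - 5 * s) ^ 2 := by
      exact mul_nonneg (by linarith) (sq_nonneg _)
    have hmix2 : 0 ≤ Δ * (8 * P ^ 2 - 11 * P * s + 8 * s ^ 2) := by
      refine mul_nonneg hd ?_
      nlinarith [sq_nonneg (P - s), mul_nonneg hP h0.le]
    nlinarith [mul_le_mul_of_nonneg_left hg h0.le]

/-! ### Amplitudes of the circuit -/

/-- The generator has eigenvectors (1, ±e^{iφ}) with eigenvalues ±1, so the exponential is cos(θ/2)
- i sin(θ/2) times the generator. -/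
theorem qubitRotation_apply (θ φ : ℝ) (a b : Fin 2) : qubitRotation θ φ a b
    = rotationAmplitude ((1 : Matrix (Fin 2) (Fin 2) ℂ) a b) (((-Complex.I) • pauliX) a b)
      (((-Complex.I) • pauliY) a b) θ φ := by
  set z : ℂ := -(Complex.I * (θ / 2)) with hz
  set e : ℂ := Complex.exp (φ * Complex.I) with he
  set e' : ℂ := Complex.exp (-(φ * Complex.I)) with he'
  have hee : e * e' = 1 := by rw [he, he', ← Complex.exp_add, add_neg_cancel, Complex.exp_zero]
  have hUV : !![1, 1; e, -e] * !![1 / 2, e' / 2; 1 / 2, -(e' / 2)]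
      = (1 : Matrix (Fin 2) (Fin 2) ℂ) := by
    rw [Matrix.mul_fin_two, Matrix.one_fin_two]
    rw [show (1 : ℂ) * (1 / 2) + 1 * (1 / 2) = 1 by norm_num,
      show 1 * (e' / 2) + 1 * -(e' / 2) = 0 by ring, show e * (1 / 2) + -e * (1 / 2) = 0 by ring,
      show e * (e' / 2) + -e * -(e' / 2) = 1 by linear_combination hee]
  let U : (Matrix (Fin 2) (Fin 2) ℂ)ˣ :=
    ⟨!![1, 1; e, -e], !![1 / 2, e' / 2; 1 / 2, -(e' / 2)], hUV, mul_eq_one_comm.1 hUV⟩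
  have hdiag : ∀ v : Fin 2 → ℂ, Matrix.diagonal v = !![v 0, 0; 0, v 1] := fun v => by
    ext i j
    fin_cases i <;> fin_cases j <;> rfl
  have hce : ((Real.cos φ : ℝ) : ℂ) = (e + e') / 2 := by
    rw [Complex.ofReal_cos, Complex.cos, he, he', neg_mul]
  have hse : ((Real.sin φ : ℝ) : ℂ) = (e' - e) * Complex.I / 2 := by
    rw [Complex.ofReal_sin, Complex.sin, he, he', neg_mul]
  have hct : ((Real.cos (θ / 2) : ℝ) : ℂ) = (Complex.exp z + Complex.exp (-z)) / 2 := by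
    rw [Complex.ofReal_cos, Complex.cos, hz, add_comm]
    push_cast
    congr 3 <;> ring
  have hst : ((Real.sin (θ / 2) : ℝ) : ℂ) = (Complex.exp z - Complex.exp (-z)) * Complex.I / 2 := by
    rw [Complex.ofReal_sin, Complex.sin, hz]
    push_cast
    congr 4 <;> ring
  have hI : Complex.I * Complex.I = -1 := Complex.I_mul_I
  have hconj : (-(Complex.I * (θ / 2))) • (((Real.cos φ : ℝ) : ℂ) • pauliX
      + ((Real.sin φ : ℝ) : ℂ) • pauliY)
      = (U : Matrix (Fin 2) (Fin 2) ℂ) * Matrix.diagonal ![z, -z] * (↑U⁻¹ : Matrix _ _ ℂ) := by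
    change _ = !![1, 1; e, -e] * Matrix.diagonal ![z, -z] * !![1 / 2, e' / 2; 1 / 2, -(e' / 2)]
    rw [← hz, hce, hse, hdiag, Matrix.mul_fin_two, Matrix.mul_fin_two]
    ext i j
    fin_cases i <;> fin_cases j <;> simp [pauliX, pauliY]
    · linear_combination (z * (e - e') / 2) * hI
    · linear_combination (z * (e' - e) / 2) * hI
  rw [qubitRotation, hconj, Matrix.exp_units_conj, Matrix.exp_diagonal, rotationAmplitude, hct, hst,
    hce, hse]
  change (!![1, 1; e, -e] * Matrix.diagonal _ * !![1 / 2, e' / 2; 1 / 2, -(e' / 2)] :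
    Matrix (Fin 2) (Fin 2) ℂ) a b = _
  have hx : ∀ i, NormedSpace.exp ![z, -z] i = ![Complex.exp z, Complex.exp (-z)] i := fun i => by
    rw [Pi.coe_exp, ← Complex.exp_eq_exp_ℂ]
    fin_cases i <;> rfl
  rw [hdiag, hx, hx, Matrix.mul_fin_two, Matrix.mul_fin_two]
  fin_cases a <;> fin_cases b <;> simp [pauliX, pauliY]
  · ring
  · linear_combination ((Complex.exp z - Complex.exp (-z)) * e' / 2) * hI
  · linear_combination ((Complex.exp z - Complex.exp (-z)) * e / 2) * hI
  · linear_combination ((Complex.exp z + Complex.exp (-z)) / 2) * hee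

theorem rotationAmplitude_add_mul (u v w u' v' w' c c' : ℂ) (θ φ : ℝ) :
    rotationAmplitude u v w θ φ * c + rotationAmplitude u' v' w' θ φ * c'
      = rotationAmplitude (u * c + u' * c') (v * c + v' * c') (w * c + w' * c') θ φ := by
  simp only [rotationAmplitude]
  ring

theorem mul_rotationAmplitude (c u v w : ℂ) (θ φ : ℝ) :
    c * rotationAmplitude u v w θ φ = rotationAmplitude (c * u) (c * v) (c * w) θ φ := by
  simp only [rotationAmplitude]
  ring

theorem continuous_qubitRotation (a b : Fin 2) :
    Continuous fun p : ℝ × ℝ => qubitRotation p.1 p.2 a b := by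
  simp only [qubitRotation_apply, rotationAmplitude]
  fun_prop

theorem norm_qubitRotation_le (θ φ : ℝ) (a b : Fin 2) : ‖qubitRotation θ φ a b‖ ≤ 1 := by
  have h := Real.sin_sq_add_cos_sq (θ / 2)
  have h' := Real.sin_sq_add_cos_sq φ
  have hsq : ∀ a b : Fin 2, ‖qubitRotation θ φ a b‖ ^ 2 ≤ 1 := fun a b => by
    rw [qubitRotation_apply, rotationAmplitude, ← Complex.normSq_eq_norm_sq]
    fin_cases a <;> fin_cases b <;>
      simp [pauliX, pauliY, Complex.normSq_apply, -Complex.ofReal_cos, -Complex.ofReal_sin] <;>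
      nlinarith [sq_nonneg (Real.sin (θ / 2)), sq_nonneg (Real.cos (θ / 2))]
  have := hsq a b
  nlinarith [norm_nonneg (qubitRotation θ φ a b)]

/-- The displacement which an echoed conditional displacement applies to its output `a`. -/
def ecdShift (a : Fin 2) (β : ℂ) : ℂ := ![-β, β] a

theorem ecd_apply (β : ℂ) (Ψ : JointState) (a : Fin 2) :
    ecd β Ψ a = displacement (ecdShift a β) (Ψ (1 - a)) := by
  fin_cases a <;> rfl

theorem applyQubit_apply (A : Matrix (Fin 2) (Fin 2) ℂ) (Ψ : JointState) (a : Fin 2) :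
    applyQubit A Ψ a = A a 0 • Ψ 0 + A a 1 • Ψ 1 := by
  funext z
  simp [applyQubit, Fin.sum_univ_two]

theorem continuous_ecdShift (a : Fin 2) : Continuous (ecdShift a) := by
  fin_cases a
  · exact continuous_neg
  · exact continuous_id

/-- The state of the circuit with layers `y`. -/
def circuitState {L : ℕ} (y : Fin L → LayerParams) : JointState :=
  circuit L (toCircuitParams y) initialState

theorem circuitState_zero (y : Fin 0 → LayerParams) : circuitState y = initialState := rfl

theorem circuitState_succ {L : ℕ} (y : Fin (L + 1) → LayerParams) (a : Fin 2) :
    circuitState y a = displacement (ecdShift a (y (Fin.last L)).1)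
      (qubitRotation (y (Fin.last L)).2.1 (y (Fin.last L)).2.2 (1 - a) 0
          • circuitState (fun i => y i.castSucc) 0
        + qubitRotation (y (Fin.last L)).2.1 (y (Fin.last L)).2.2 (1 - a) 1
          • circuitState (fun i => y i.castSucc) 1) := by
  rw [← applyQubit_apply, ← ecd_apply]
  rfl

theorem initialState_mem_coherentSpan (a : Fin 2) : initialState a ∈ coherentSpan := by
  fin_cases a
  · exact vacuum_mem_coherentSpan
  · exact Submodule.zero_mem _

theorem circuitState_mem_coherentSpan {L : ℕ} (y : Fin L → LayerParams) (a : Fin 2) :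
    circuitState y a ∈ coherentSpan := by
  induction L generalizing a with
  | zero => exact initialState_mem_coherentSpan a
  | succ L ih =>
    rw [circuitState_succ]
    exact displacement_mem_coherentSpan _ (Submodule.add_mem _ (Submodule.smul_mem _ _ (ih _ _))
      (Submodule.smul_mem _ _ (ih _ _)))

/-- The overlaps `⟨ψ|D(γ)Ψₐ⟩` of the circuit states, from those of the vacuum. -/
def amplitude (h : ℂ → ℂ) : (L : ℕ) → (Fin L → LayerParams) → Fin 2 → ℂ → ℂ
  | 0, _, a, γ => if a = 0 then h γ else 0
  | L + 1, y, a, γ => weylPhase γ (ecdShift a (y (Fin.last L)).1) *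
      (qubitRotation (y (Fin.last L)).2.1 (y (Fin.last L)).2.2 (1 - a) 0
          * amplitude h L (fun i => y i.castSucc) 0 (γ + ecdShift a (y (Fin.last L)).1)
        + qubitRotation (y (Fin.last L)).2.1 (y (Fin.last L)).2.2 (1 - a) 1
          * amplitude h L (fun i => y i.castSucc) 1 (γ + ecdShift a (y (Fin.last L)).1))

theorem modeInner_displacement_circuitState {ψ : ModeState} (hψ : Moderate ψ) {L : ℕ}
    (y : Fin L → LayerParams) (a : Fin 2) (γ : ℂ) :
    modeInner ψ (displacement γ (circuitState y a))
      = amplitude (fun γ => modeInner ψ (displacement γ vacuum)) L y a γ := by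
  induction L generalizing a γ with
  | zero =>
    fin_cases a
    · rfl
    · change modeInner ψ (displacement γ fun _ => 0) = 0
      simp [displacement, modeInner]
  | succ L ih =>
    have hm : ∀ c b, Moderate (c • displacement (γ + ecdShift a (y (Fin.last L)).1)
        (circuitState (fun i => y i.castSucc) b)) := fun c b =>
      moderate_of_mem_coherentSpan (Submodule.smul_mem _ _
        (displacement_mem_coherentSpan _ (circuitState_mem_coherentSpan _ _)))
    rw [circuitState_succ, displacement_displacement, modeInner_smul_right, displacement_add,
      displacement_smul, displacement_smul, modeInner_add_right hψ (hm _ _) (hm _ _),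
      modeInner_smul_right, modeInner_smul_right, ih, ih]
    rfl

theorem cost_toCircuitParams {ψ : ModeState} (hψ : Moderate ψ) {L : ℕ} (y : Fin L → LayerParams) :
    cost ψ (toCircuitParams y)
      = ‖amplitude (fun γ => modeInner ψ (displacement γ vacuum)) L y 0 0‖ ^ 2 := by
  rw [← modeInner_displacement_circuitState hψ, displacement_zero]
  change (jointInner (circuitState y) (targetObservable ψ (circuitState y))).re = _
  have h0 : targetObservable ψ (circuitState y) 0 = modeInner ψ (circuitState y 0) • ψ := rfl
  have h1 : targetObservable ψ (circuitState y) 1 = fun _ => 0 := rfl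
  rw [jointInner, Fin.sum_univ_two, h0, h1, modeInner_smul_right, ← conj_modeInner ψ,
    Complex.mul_conj']
  have h2 : modeInner (circuitState y 1) (fun _ => 0) = 0 := by simp [modeInner]
  rw [h2, add_zero]
  exact_mod_cast Complex.ofReal_re _

theorem continuous_amplitude {h : ℂ → ℂ} (hh : Continuous h) (L : ℕ) (a : Fin 2) :
    Continuous fun q : (Fin L → LayerParams) × ℂ => amplitude h L q.1 a q.2 := by
  induction L generalizing a with
  | zero =>
    rcases eq_or_ne a 0 with rfl | ha
    · simp only [amplitude, if_true]
      exact hh.comp continuous_snd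
    · simpa [amplitude, ha] using continuous_const
  | succ L ih =>
    have hs : Continuous fun q : (Fin (L + 1) → LayerParams) × ℂ =>
        ecdShift a (q.1 (Fin.last L)).1 := (continuous_ecdShift a).comp (by fun_prop)
    have hR : ∀ b, Continuous fun q : (Fin (L + 1) → LayerParams) × ℂ =>
        qubitRotation (q.1 (Fin.last L)).2.1 (q.1 (Fin.last L)).2.2 (1 - a) b := fun b =>
      (continuous_qubitRotation (1 - a) b).comp (by fun_prop : Continuous fun
        q : (Fin (L + 1) → LayerParams) × ℂ => ((q.1 (Fin.last L)).2.1, (q.1 (Fin.last L)).2.2))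
    have hA : ∀ b, Continuous fun q : (Fin (L + 1) → LayerParams) × ℂ =>
        amplitude h L (fun i => q.1 i.castSucc) b (q.2 + ecdShift a (q.1 (Fin.last L)).1) :=
      fun b => (ih b).comp ((by fun_prop : Continuous fun q : (Fin (L + 1) → LayerParams) × ℂ =>
        fun i : Fin L => q.1 i.castSucc).prodMk (continuous_snd.add hs))
    exact (continuous_weylPhase.comp (continuous_snd.prodMk hs)).mul
      (((hR 0).mul (hA 0)).add ((hR 1).mul (hA 1)))

theorem norm_amplitude_le {h : ℂ → ℂ} {M : ℝ} (hM : ∀ γ, ‖h γ‖ ≤ M) {L : ℕ}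
    (y : Fin L → LayerParams) (a : Fin 2) (γ : ℂ) : ‖amplitude h L y a γ‖ ≤ 2 ^ L * M := by
  induction L generalizing a γ with
  | zero =>
    rw [amplitude, pow_zero, one_mul]
    split_ifs
    · exact hM γ
    · simpa using (norm_nonneg _).trans (hM 0)
  | succ L ih =>
    rw [amplitude, norm_mul, norm_weylPhase, one_mul, pow_succ]
    refine (norm_add_le _ _).trans ?_
    rw [norm_mul, norm_mul]
    have h1 := mul_le_of_le_one_left (norm_nonneg (amplitude h L (fun i => y i.castSucc) 0
      (γ + ecdShift a (y (Fin.last L)).1))) (norm_qubitRotation_le (y (Fin.last L)).2.1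
      (y (Fin.last L)).2.2 (1 - a) 0)
    have h2 := mul_le_of_le_one_left (norm_nonneg (amplitude h L (fun i => y i.castSucc) 1
      (γ + ecdShift a (y (Fin.last L)).1))) (norm_qubitRotation_le (y (Fin.last L)).2.1
      (y (Fin.last L)).2.2 (1 - a) 1)
    have h3 := ih (fun i => y i.castSucc) 0 (γ + ecdShift a (y (Fin.last L)).1)
    have h4 := ih (fun i => y i.castSucc) 1 (γ + ecdShift a (y (Fin.last L)).1)
    linarith

/-- Amplitudes are linear in the matrix of each rotation, and later layers act linearly, so the
three-term trigonometric form persists to the output. -/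
theorem exists_amplitude_update_eq (h : ℂ → ℂ) {L : ℕ} (k : Fin L) (y : Fin L → LayerParams)
    (β : ℂ) (a : Fin 2) (γ : ℂ) : ∃ u v w : ℂ, ∀ θ φ : ℝ,
      amplitude h L (Function.update y k (β, θ, φ)) a γ = rotationAmplitude u v w θ φ := by
  induction L generalizing a γ with
  | zero => exact k.elim0
  | succ L ih =>
    induction k using Fin.lastCases with
    | last =>
      simp only [amplitude, Function.update_self, qubitRotation_apply,
        Function.update_of_ne (Fin.castSucc_ne_last _), rotationAmplitude_add_mul]
      exact ⟨_, _, _, fun θ φ => mul_rotationAmplitude _ _ _ _ θ φ⟩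
    | cast k =>
      obtain ⟨u, v, w, h0⟩ := ih k (fun i => y i.castSucc) 0
        (γ + ecdShift a (y (Fin.last L)).1)
      obtain ⟨u', v', w', h1⟩ := ih k (fun i => y i.castSucc) 1
        (γ + ecdShift a (y (Fin.last L)).1)
      have hu : ∀ p, (fun i : Fin L => Function.update y k.castSucc p i.castSucc)
          = Function.update (fun i : Fin L => y i.castSucc) k p := fun p =>
        Function.update_comp_eq_of_injective y (Fin.castSucc_injective L) k p
      simp only [amplitude, Function.update_of_ne (Fin.castSucc_ne_last _).symm, hu, h0, h1]
      set R := qubitRotation (y (Fin.last L)).2.1 (y (Fin.last L)).2.2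
      set c := weylPhase γ (ecdShift a (y (Fin.last L)).1)
      refine ⟨c * (R (1 - a) 0 * u + R (1 - a) 1 * u'), c * (R (1 - a) 0 * v + R (1 - a) 1 * v'),
        c * (R (1 - a) 0 * w + R (1 - a) 1 * w'), fun θ φ => ?_⟩
      simp only [rotationAmplitude]
      ring

/-! ### The gradient of the cost -/

theorem Continuous.integrable_uniformAngle {V : Type*} [NormedAddCommGroup V] {f : ℝ → V}
    (hf : Continuous f) : Integrable f uniformAngle := by
  rw [uniformAngle, ProbabilityTheory.cond]
  refine Integrable.smul_measure ?_ (by simp [Real.pi_pos])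
  exact (hf.continuousOn.integrableOn_Icc (a := 0) (b := 2 * Real.pi)).mono_set
    Set.Ico_subset_Icc_self

theorem continuous_rotationAmplitude (u v w : ℂ) :
    Continuous fun p : ℝ × ℝ => rotationAmplitude u v w p.1 p.2 := by
  unfold rotationAmplitude
  fun_prop

theorem continuous_rotationSlope (u v w : ℂ) :
    Continuous fun p : ℝ × ℝ => rotationSlope u v w p.1 p.2 := by
  unfold rotationSlope
  fun_prop

theorem continuous_rotationAmplitude_left (u v w : ℂ) (φ : ℝ) :
    Continuous fun θ => ‖rotationAmplitude u v w θ φ‖ ^ 2 :=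
  ((continuous_rotationAmplitude u v w).comp
    (continuous_id.prodMk continuous_const)).norm.pow 2

theorem continuous_rotationSlope_left (u v w : ℂ) (φ : ℝ) :
    Continuous fun θ => rotationSlope u v w θ φ ^ 2 :=
  ((continuous_rotationSlope u v w).comp (continuous_id.prodMk continuous_const)).pow 2

/-- Averaged over the two angles the integrand is at least (c - m)², with c the conditional mean of
the cost. This linearized form can be integrated over the remaining parameters without a separate
application of Jensen's inequality. -/
theorem integral_rotationSlope_sq_sub_nonneg (u v w : ℂ) (m : ℝ) :
    0 ≤ ∫ φ, ∫ θ, (18 * rotationSlope u v w θ φ ^ 2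
      - 2 * m * ‖rotationAmplitude u v w θ φ‖ ^ 2 + m ^ 2) ∂uniformAngle ∂uniformAngle := by
  have i1 : ∀ φ, Integrable (fun θ => 18 * rotationSlope u v w θ φ ^ 2) uniformAngle :=
    fun φ => (continuous_rotationSlope_left u v w φ).integrable_uniformAngle.const_mul 18
  have i2 : ∀ φ, Integrable (fun θ => 2 * m * ‖rotationAmplitude u v w θ φ‖ ^ 2) uniformAngle :=
    fun φ => (continuous_rotationAmplitude_left u v w φ).integrable_uniformAngle.const_mul (2 * m)
  have j1 : Integrable (fun φ => 18 * ∫ θ, rotationSlope u v w θ φ ^ 2 ∂uniformAngle)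
      uniformAngle := by
    simp only [integral_rotationSlope_sq]
    exact Continuous.integrable_uniformAngle (by fun_prop)
  have j2 : Integrable (fun φ => 2 * m * ∫ θ, ‖rotationAmplitude u v w θ φ‖ ^ 2 ∂uniformAngle)
      uniformAngle := by
    simp only [integral_norm_sq_rotationAmplitude]
    exact Continuous.integrable_uniformAngle (by fun_prop)
  have e1 : ∀ φ, ∫ θ, (18 * rotationSlope u v w θ φ ^ 2
      - 2 * m * ‖rotationAmplitude u v w θ φ‖ ^ 2 + m ^ 2) ∂uniformAngle
      = 18 * ∫ θ, rotationSlope u v w θ φ ^ 2 ∂uniformAngle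
        - 2 * m * ∫ θ, ‖rotationAmplitude u v w θ φ‖ ^ 2 ∂uniformAngle + m ^ 2 := fun φ => by
    rw [integral_add (f := fun θ => 18 * rotationSlope u v w θ φ ^ 2
      - 2 * m * ‖rotationAmplitude u v w θ φ‖ ^ 2) ((i1 φ).sub (i2 φ)) (integrable_const _),
      integral_sub (i1 φ) (i2 φ), integral_const_mul, integral_const_mul, integral_const,
      probReal_univ, one_smul]
  simp only [e1]
  rw [integral_add (f := fun φ => 18 * ∫ θ, rotationSlope u v w θ φ ^ 2 ∂uniformAngle
      - 2 * m * ∫ θ, ‖rotationAmplitude u v w θ φ‖ ^ 2 ∂uniformAngle) (j1.sub j2)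
      (integrable_const _), integral_sub j1 j2, integral_const_mul, integral_const_mul,
    integral_const, probReal_univ, one_smul]
  have h3 := integral_norm_sq_rotationAmplitude_sq_le u v w
  nlinarith [sq_nonneg ((∫ φ, ∫ θ, ‖rotationAmplitude u v w θ φ‖ ^ 2
    ∂uniformAngle ∂uniformAngle) - m)]

theorem integral_layersLaw_eq_update {V : Type*} [NormedAddCommGroup V] [NormedSpace ℝ V] {v : ℝ}
    {L : ℕ} (k : Fin L) {f : (Fin L → LayerParams) → V} (hf : Continuous f) {C : ℝ}
    (hC : ∀ y, ‖f y‖ ≤ C) : ∫ y, f y ∂layersLaw v L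
      = ∫ y, ∫ β, ∫ φ, ∫ θ, f (Function.update y k (β, θ, φ)) ∂uniformAngle ∂uniformAngle
        ∂complexGaussian v ∂layersLaw v L := by
  rw [integral_layersLaw_update k (hf.integrable_of_bounded hC)]
  congr 1
  funext y
  rw [integral_layerLaw (Continuous.integrable_of_bounded (by fun_prop) fun p => hC _)]
  congr 1
  funext β
  exact integral_prod_symm (fun q : ℝ × ℝ => f (Function.update y k (β, q)))
    (Continuous.integrable_of_bounded (by fun_prop) fun p => hC _)

/-- The cost of the circuit with layers `y`. -/
def layersCost (h : ℂ → ℂ) {L : ℕ} (y : Fin L → LayerParams) : ℝ := ‖amplitude h L y 0 0‖ ^ 2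

/-- The layers `y`, with the rotation angle of the layer `k` increased by `s`. -/
def shiftAngle {L : ℕ} (k : Fin L) (s : ℝ) (y : Fin L → LayerParams) : Fin L → LayerParams :=
  Function.update y k ((y k).1, (y k).2.1 + s, (y k).2.2)

/-- The derivative of the cost in the rotation angle of the layer `k`. -/
def layersSlope (h : ℂ → ℂ) {L : ℕ} (k : Fin L) (y : Fin L → LayerParams) : ℝ :=
  (layersCost h (shiftAngle k (Real.pi / 2) y) - layersCost h (shiftAngle k (-(Real.pi / 2)) y)) / 2

theorem exists_layersCost_update_eq (h : ℂ → ℂ) {L : ℕ} (k : Fin L) (y : Fin L → LayerParams)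
    (β : ℂ) : ∃ u v w : ℂ, ∀ θ φ : ℝ,
      layersCost h (Function.update y k (β, θ, φ)) = ‖rotationAmplitude u v w θ φ‖ ^ 2 ∧
      layersSlope h k (Function.update y k (β, θ, φ)) = rotationSlope u v w θ φ := by
  obtain ⟨u, v, w, hu⟩ := exists_amplitude_update_eq h k y β 0 0
  refine ⟨u, v, w, fun θ φ => ⟨by rw [layersCost, hu], ?_⟩⟩
  rw [layersSlope, shiftAngle, shiftAngle, Function.update_idem, Function.update_idem,
    Function.update_self, layersCost, layersCost, hu, hu, rotationSlope_eq, ← sub_eq_add_neg]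

section Bounded

variable {h : ℂ → ℂ} (hh : Continuous h) {M : ℝ} (hM : ∀ γ, ‖h γ‖ ≤ M) {v : ℝ} {L : ℕ}

theorem continuous_layersCost (hh : Continuous h) :
    Continuous (layersCost h : (Fin L → LayerParams) → ℝ) :=
  ((continuous_amplitude hh L 0).comp (continuous_id.prodMk continuous_const)).norm.pow 2

theorem continuous_layersSlope (hh : Continuous h) (k : Fin L) : Continuous (layersSlope h k) := by
  have hs : ∀ s, Continuous (shiftAngle k s : (Fin L → LayerParams) → Fin L → LayerParams) :=
    fun s => by
      unfold shiftAngle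
      fun_prop
  exact (((continuous_layersCost hh).comp (hs _)).sub
    ((continuous_layersCost hh).comp (hs _))).div_const 2

theorem abs_layersCost_le (hM : ∀ γ, ‖h γ‖ ≤ M) (y : Fin L → LayerParams) :
    |layersCost h y| ≤ (2 ^ L * M) ^ 2 := by
  rw [layersCost, abs_of_nonneg (sq_nonneg _)]
  exact pow_le_pow_left₀ (norm_nonneg _) (norm_amplitude_le hM y 0 0) 2

theorem abs_layersSlope_le (hM : ∀ γ, ‖h γ‖ ≤ M) (k : Fin L) (y : Fin L → LayerParams) :
    |layersSlope h k y| ≤ (2 ^ L * M) ^ 2 := by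
  have h1 := abs_le.1 (abs_layersCost_le hM (shiftAngle k (Real.pi / 2) y))
  have h2 := abs_le.1 (abs_layersCost_le hM (shiftAngle k (-(Real.pi / 2)) y))
  rw [layersSlope, abs_le]
  constructor <;> linarith

theorem integral_layersSlope (hh : Continuous h) (hM : ∀ γ, ‖h γ‖ ≤ M) (k : Fin L) :
    ∫ y, layersSlope h k y ∂layersLaw v L = 0 := by
  rw [integral_layersLaw_eq_update k (continuous_layersSlope hh k) (abs_layersSlope_le hM k)]
  refine integral_eq_zero_of_ae (ae_of_all _ fun y => ?_)
  refine integral_eq_zero_of_ae (ae_of_all _ fun β => ?_)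
  refine integral_eq_zero_of_ae (ae_of_all _ fun φ => ?_)
  obtain ⟨u, v, w, hu⟩ := exists_layersCost_update_eq h k y β
  simp only [(hu _ _).2, integral_rotationSlope, Pi.zero_apply]

theorem integral_layersSlope_sq_le (hh : Continuous h) (hM : ∀ γ, ‖h γ‖ ≤ M) (k : Fin L) :
    ∫ y, layersSlope h k y ^ 2 ∂layersLaw v L ≤ ∫ y, layersCost h y ^ 2 ∂layersLaw v L := by
  have hc : Continuous fun y : Fin L → LayerParams => layersCost h y ^ 2 :=
    (continuous_layersCost hh).pow 2
  have hs : Continuous fun y : Fin L → LayerParams => layersSlope h k y ^ 2 :=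
    (continuous_layersSlope hh k).pow 2
  have hcb : ∀ y : Fin L → LayerParams, ‖layersCost h y ^ 2‖ ≤ ((2 ^ L * M) ^ 2) ^ 2 := fun y => by
    rw [norm_pow]
    exact pow_le_pow_left₀ (norm_nonneg _) (abs_layersCost_le hM y) 2
  have hsb : ∀ y : Fin L → LayerParams, ‖layersSlope h k y ^ 2‖ ≤ ((2 ^ L * M) ^ 2) ^ 2 :=
    fun y => by
      rw [norm_pow]
      exact pow_le_pow_left₀ (norm_nonneg _) (abs_layersSlope_le hM k y) 2
  rw [← sub_nonneg, ← integral_sub (hc.integrable_of_bounded hcb) (hs.integrable_of_bounded hsb),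
    integral_layersLaw_eq_update k (f := fun y => layersCost h y ^ 2 - layersSlope h k y ^ 2)
      (hc.sub hs) fun y => (norm_sub_le _ _).trans
      (add_le_add (hcb y) (hsb y))]
  refine integral_nonneg fun y => integral_nonneg fun β => integral_nonneg fun φ => ?_
  obtain ⟨u, v, w, hu⟩ := exists_layersCost_update_eq h k y β
  simp only [(hu _ _).2, (hu _ _).1, Pi.zero_apply]
  rw [integral_sub]
  · exact sub_nonneg.2 (integral_rotationSlope_sq_le u v w φ)
  · exact ((continuous_rotationAmplitude_left u v w φ).pow 2).integrable_uniformAngle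
  · exact (continuous_rotationSlope_left u v w φ).integrable_uniformAngle

/-- Choosing m as the overall mean in `integral_rotationSlope_sq_sub_nonneg` leaves exactly 18 times
the mean squared slope minus m². -/
theorem sq_integral_layersCost_le (hh : Continuous h) (hM : ∀ γ, ‖h γ‖ ≤ M) (k : Fin L) :
    (∫ y, layersCost h y ∂layersLaw v L) ^ 2
      ≤ 18 * ∫ y, layersSlope h k y ^ 2 ∂layersLaw v L := by
  set m := ∫ y, layersCost h y ∂layersLaw v L with hm
  have hc := continuous_layersCost (L := L) hh
  have hs : Continuous fun y : Fin L → LayerParams => layersSlope h k y ^ 2 :=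
    (continuous_layersSlope hh k).pow 2
  have hsb : ∀ y : Fin L → LayerParams, ‖layersSlope h k y ^ 2‖ ≤ ((2 ^ L * M) ^ 2) ^ 2 :=
    fun y => by
      rw [norm_pow]
      exact pow_le_pow_left₀ (norm_nonneg _) (abs_layersSlope_le hM k y) 2
  have hci : Integrable (fun y => 2 * m * layersCost h y) (layersLaw v L) :=
    (hc.integrable_of_bounded (abs_layersCost_le hM)).const_mul _
  have hsi : Integrable (fun y => 18 * layersSlope h k y ^ 2) (layersLaw v L) :=
    (hs.integrable_of_bounded hsb).const_mul _
  have key : 0 ≤ ∫ y, (18 * layersSlope h k y ^ 2 - 2 * m * layersCost h y + m ^ 2)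
      ∂layersLaw v L := by
    rw [integral_layersLaw_eq_update k
      (f := fun y => 18 * layersSlope h k y ^ 2 - 2 * m * layersCost h y + m ^ 2)
      (C := 18 * ((2 ^ L * M) ^ 2) ^ 2 + 2 * |m| * (2 ^ L * M) ^ 2 + m ^ 2)
      (((continuous_const.mul hs).sub (continuous_const.mul hc)).add continuous_const)]
    · refine integral_nonneg fun y => integral_nonneg fun β => ?_
      obtain ⟨u, v, w, hu⟩ := exists_layersCost_update_eq h k y β
      simp only [(hu _ _).2, (hu _ _).1, Pi.zero_apply]
      exact integral_rotationSlope_sq_sub_nonneg u v w m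
    · intro y
      refine (norm_add_le _ _).trans (add_le_add ((norm_sub_le _ _).trans (add_le_add ?_ ?_)) ?_)
      · rw [norm_mul, Real.norm_of_nonneg (by norm_num : (0 : ℝ) ≤ 18)]
        linarith [hsb y]
      · rw [norm_mul, norm_mul, Real.norm_of_nonneg zero_le_two, Real.norm_eq_abs]
        exact mul_le_mul_of_nonneg_left (abs_layersCost_le hM y) (by positivity)
      · rw [Real.norm_of_nonneg (sq_nonneg m)]
  rw [integral_add (f := fun y => 18 * layersSlope h k y ^ 2 - 2 * m * layersCost h y)
    (hsi.sub hci) (integrable_const _), integral_sub hsi hci, integral_const_mul,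
    integral_const_mul, integral_const, probReal_univ, one_smul, ← hm] at key
  nlinarith

end Bounded

/-! ### The mean of the cost -/

theorem integral_norm_sq_qubitRotation (c : Fin 2) (x₀ x₁ : ℂ) :
    ∫ φ, ∫ θ, ‖qubitRotation θ φ c 0 * x₀ + qubitRotation θ φ c 1 * x₁‖ ^ 2 ∂uniformAngle
      ∂uniformAngle = (‖x₀‖ ^ 2 + ‖x₁‖ ^ 2) / 2 := by
  simp only [qubitRotation_apply, rotationAmplitude_add_mul,
    integral_integral_norm_sq_rotationAmplitude]
  have hc : c = 0 ∨ c = 1 := by omega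
  rcases hc with rfl | rfl <;> simp [pauliX, pauliY] <;> ring

/-- The squared norm of the amplitudes, summed over the states of the qubit. -/
def totalAmplitude (h : ℂ → ℂ) {L : ℕ} (y : Fin L → LayerParams) (γ : ℂ) : ℝ :=
  ‖amplitude h L y 0 γ‖ ^ 2 + ‖amplitude h L y 1 γ‖ ^ 2

theorem continuous_totalAmplitude {h : ℂ → ℂ} (hh : Continuous h) (L : ℕ) :
    Continuous fun q : (Fin L → LayerParams) × ℂ => totalAmplitude h q.1 q.2 :=
  ((continuous_amplitude hh L 0).norm.pow 2).add ((continuous_amplitude hh L 1).norm.pow 2)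

theorem norm_totalAmplitude_le {h : ℂ → ℂ} {M : ℝ} (hM : ∀ γ, ‖h γ‖ ≤ M) {L : ℕ}
    (y : Fin L → LayerParams) (γ : ℂ) : ‖totalAmplitude h y γ‖ ≤ 2 * (2 ^ L * M) ^ 2 := by
  have h0 := pow_le_pow_left₀ (norm_nonneg _) (norm_amplitude_le hM y 0 γ) 2
  have h1 := pow_le_pow_left₀ (norm_nonneg _) (norm_amplitude_le hM y 1 γ) 2
  rw [totalAmplitude, Real.norm_of_nonneg (by positivity)]
  linarith

theorem integral_complexGaussian_ecdShift {v : ℝ} (hv : 0 < v) (a : Fin 2) (f : ℂ → ℝ) :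
    ∫ β, f (ecdShift a β) ∂complexGaussian v = ∫ β, f β ∂complexGaussian v := by
  fin_cases a
  · exact integral_neg_complexGaussian hv fun β => f β
  · rfl

/-- Averaging over the angles equidistributes the qubit, whichever output is measured, and the
displacement shifts the argument by a Gaussian whose sign is irrelevant. -/
theorem integral_norm_sq_amplitude_succ {h : ℂ → ℂ} (hh : Continuous h) {M : ℝ}
    (hM : ∀ γ, ‖h γ‖ ≤ M) {v : ℝ} (hv : 0 < v) (L : ℕ) (a : Fin 2) (γ : ℂ) :
    ∫ y, ‖amplitude h (L + 1) y a γ‖ ^ 2 ∂layersLaw v (L + 1)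
      = (∫ β, ∫ y, totalAmplitude h y (γ + β) ∂layersLaw v L ∂complexGaussian v) / 2 := by
  have hc : Continuous fun y : Fin (L + 1) → LayerParams => ‖amplitude h (L + 1) y a γ‖ ^ 2 :=
    ((continuous_amplitude hh (L + 1) a).comp (continuous_id.prodMk continuous_const)).norm.pow 2
  have hb : ∀ y : Fin (L + 1) → LayerParams,
      ‖‖amplitude h (L + 1) y a γ‖ ^ 2‖ ≤ (2 ^ (L + 1) * M) ^ 2 := fun y => by
    rw [Real.norm_of_nonneg (sq_nonneg _)]
    exact pow_le_pow_left₀ (norm_nonneg _) (norm_amplitude_le hM y a γ) 2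
  have hadd : Continuous fun q : (Fin L → LayerParams) × LayerParams => addLayer q.1 q.2 := by
    refine continuous_pi fun i => ?_
    induction i using Fin.lastCases with
    | last =>
      simp only [addLayer_last]
      exact continuous_snd
    | cast i =>
      simp only [addLayer_castSucc]
      fun_prop
  rw [integral_layersLaw_succ (hc.integrable_of_bounded hb), ← integral_div]
  have hinner : ∀ y : Fin L → LayerParams,
      ∫ p, ‖amplitude h (L + 1) (addLayer y p) a γ‖ ^ 2 ∂layerLaw v
        = ∫ β, totalAmplitude h y (γ + β) / 2 ∂complexGaussian v := fun y => by
    have hcy : Continuous fun p => ‖amplitude h (L + 1) (addLayer y p) a γ‖ ^ 2 :=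
      hc.comp (hadd.comp (continuous_const.prodMk continuous_id))
    rw [integral_layerLaw (hcy.integrable_of_bounded fun p => hb _),
      ← integral_complexGaussian_ecdShift hv a fun β => totalAmplitude h y (γ + β) / 2]
    congr 1
    funext β
    have hs := integral_prod_symm
      (fun q : ℝ × ℝ => ‖amplitude h (L + 1) (addLayer y (β, q)) a γ‖ ^ 2)
      ((hcy.comp (by fun_prop : Continuous fun q : ℝ × ℝ => (β, q))).integrable_of_bounded
        (μ := uniformAngle.prod uniformAngle) fun q => hb _)
    refine hs.trans ?_
    simp only [amplitude, addLayer_last, addLayer_castSucc, norm_mul, norm_weylPhase, one_mul,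
      integral_norm_sq_qubitRotation]
    rfl
  simp only [hinner]
  have hcs : Continuous fun q : (Fin L → LayerParams) × ℂ => totalAmplitude h q.1 (γ + q.2) / 2 :=
    ((continuous_totalAmplitude hh L).comp
      (continuous_fst.prodMk (continuous_const.add continuous_snd))).div_const 2
  have hbs : ∀ q : (Fin L → LayerParams) × ℂ,
      ‖totalAmplitude h q.1 (γ + q.2) / 2‖ ≤ 2 * (2 ^ L * M) ^ 2 := fun q => by
    rw [norm_div, Real.norm_ofNat]
    linarith [norm_totalAmplitude_le hM q.1 (γ + q.2),
      norm_nonneg (totalAmplitude h q.1 (γ + q.2))]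
  rw [integral_integral_swap (hcs.integrable_of_bounded hbs)]
  simp only [integral_div]

theorem integral_totalAmplitude_succ {h : ℂ → ℂ} (hh : Continuous h) {M : ℝ}
    (hM : ∀ γ, ‖h γ‖ ≤ M) {v : ℝ} (hv : 0 < v) (L : ℕ) (γ : ℂ) :
    ∫ y, totalAmplitude h y γ ∂layersLaw v (L + 1)
      = ∫ β, ∫ y, totalAmplitude h y (γ + β) ∂layersLaw v L ∂complexGaussian v := by
  have hi : ∀ a, Integrable (fun y => ‖amplitude h (L + 1) y a γ‖ ^ 2) (layersLaw v (L + 1)) :=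
    fun a => Continuous.integrable_of_bounded (C := (2 ^ (L + 1) * M) ^ 2)
      (((continuous_amplitude hh (L + 1) a).comp
        (continuous_id.prodMk continuous_const)).norm.pow 2) fun y => by
          rw [Real.norm_of_nonneg (sq_nonneg _)]
          exact pow_le_pow_left₀ (norm_nonneg _) (norm_amplitude_le hM y a γ) 2
  simp only [totalAmplitude] at *
  rw [integral_add (hi 0) (hi 1), integral_norm_sq_amplitude_succ hh hM hv,
    integral_norm_sq_amplitude_succ hh hM hv, add_halves]
  rfl

/-- Independent Gaussian shifts add up, so only the total variance matters. -/
theorem integral_totalAmplitude {h : ℂ → ℂ} (hh : Continuous h) {M : ℝ}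
    (hM : ∀ γ, ‖h γ‖ ≤ M) {v : ℝ} (hv : 0 < v) (L : ℕ) (γ : ℂ) :
    ∫ y, totalAmplitude h y γ ∂layersLaw v (L + 1)
      = ∫ β, ‖h (γ + β)‖ ^ 2 ∂complexGaussian ((L + 1 : ℕ) * v) := by
  induction L generalizing γ with
  | zero =>
    rw [integral_totalAmplitude_succ hh hM hv]
    simp [totalAmplitude, amplitude]
  | succ L ih =>
    rw [integral_totalAmplitude_succ hh hM hv]
    simp only [ih]
    have hc : Continuous fun z => ‖h (γ + z)‖ ^ 2 :=
      (hh.comp (continuous_const.add continuous_id)).norm.pow 2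
    have hconv := complexGaussian_conv hv (w := (L + 1 : ℕ) * v) (by positivity)
    rw [show ((L + 1 + 1 : ℕ) : ℝ) * v = v + (L + 1 : ℕ) * v by push_cast; ring, ← hconv,
      integral_conv]
    · simp only [add_assoc]
    · exact hc.integrable_of_bounded (C := M ^ 2) fun z => by
        rw [Real.norm_of_nonneg (sq_nonneg _)]
        exact pow_le_pow_left₀ (norm_nonneg _) (hM _) 2

theorem integral_layersCost {h : ℂ → ℂ} (hh : Continuous h) {M : ℝ}
    (hM : ∀ γ, ‖h γ‖ ≤ M) {E : ℝ} (hE : 0 < E) {L : ℕ} (k : Fin L) :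
    ∫ y, layersCost h y ∂layersLaw (E / L) L
      = (∫ β, ‖h β‖ ^ 2 ∂complexGaussian E) / 2 := by
  obtain ⟨L, rfl⟩ : ∃ n, L = n + 1 := ⟨L - 1, by have := k.pos; omega⟩
  have hv : 0 < E / (L + 1 : ℕ) := by positivity
  have h1 := integral_norm_sq_amplitude_succ hh hM hv L 0 0
  rw [← integral_totalAmplitude_succ hh hM hv, integral_totalAmplitude hh hM hv,
    mul_div_cancel₀ E (by positivity)] at h1
  simp only [zero_add] at h1
  exact h1

/-- For E ≥ 1 the density is at least exp(-|z|²)/(πE), and the integral of |h|² against exp(-|z|²)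
is positive by continuity. -/
theorem exists_le_integral_complexGaussian {h : ℂ → ℂ} (hh : Continuous h) {M : ℝ}
    (hM : ∀ γ, ‖h γ‖ ≤ M) {γ₀ : ℂ} (h0 : h γ₀ ≠ 0) :
    ∃ c : ℝ, 0 < c ∧ ∀ E : ℝ, 1 ≤ E → c / E ≤ ∫ β, ‖h β‖ ^ 2 ∂complexGaussian E := by
  have hM2 : ∀ z, ‖h z‖ ^ 2 ≤ M ^ 2 := fun z => pow_le_pow_left₀ (norm_nonneg _) (hM z) 2
  have hc : Continuous fun z : ℂ => Real.exp (-1 * ‖z‖ ^ 2) * ‖h z‖ ^ 2 :=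
    (by fun_prop : Continuous fun z : ℂ => Real.exp (-1 * ‖z‖ ^ 2)).mul (hh.norm.pow 2)
  have hint : ∀ a : ℝ, 0 < a → Integrable fun z : ℂ => Real.exp (-a * ‖z‖ ^ 2) * ‖h z‖ ^ 2 :=
    fun a ha => (integrable_exp_neg_mul_sq_norm ha).mul_bdd (c := M ^ 2)
      (hh.norm.pow 2).aestronglyMeasurable (ae_of_all _ fun z => by
        rw [Real.norm_of_nonneg (sq_nonneg _)]
        exact hM2 z)
  have hpos : 0 < ∫ z : ℂ, Real.exp (-1 * ‖z‖ ^ 2) * ‖h z‖ ^ 2 := by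
    rw [integral_pos_iff_support_of_nonneg (fun z => by positivity) (hint 1 one_pos)]
    refine (hc.isOpen_support).measure_pos _ ⟨γ₀, ?_⟩
    simp [h0]
  refine ⟨(∫ z : ℂ, Real.exp (-1 * ‖z‖ ^ 2) * ‖h z‖ ^ 2) / Real.pi, by positivity,
    fun E hE => ?_⟩
  have hE0 : 0 < E := by linarith
  rw [integral_complexGaussian hE0]
  have he : ∀ z, complexGaussianPDF E z • ‖h z‖ ^ 2
      = (Real.exp (-(1 / E) * ‖z‖ ^ 2) * ‖h z‖ ^ 2) / (Real.pi * E) := fun z => by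
    rw [complexGaussianPDF, smul_eq_mul]
    ring
  simp only [he]
  rw [integral_div, div_div]
  refine div_le_div_of_nonneg_right (integral_mono (hint 1 one_pos) (hint _ (by positivity))
    fun z => ?_) (by positivity)
  refine mul_le_mul_of_nonneg_right (Real.exp_le_exp.2 ?_) (sq_nonneg _)
  have : 1 / E ≤ 1 := (div_le_one hE0).2 hE
  nlinarith [sq_nonneg ‖z‖]

/-! ### The overlaps with displaced vacua -/

/-- The overlap `⟨ψ|D(γ)|0⟩`. -/
def overlap (ψ : ModeState) (γ : ℂ) : ℂ := modeInner ψ (displacement γ vacuum)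

theorem overlap_eq {ψ : ModeState} (hψ : Moderate ψ) (hd : Differentiable ℂ ψ) : overlap ψ
    = fun γ => ((Real.exp (-(‖γ‖ ^ 2 / 2)) : ℝ) : ℂ) * conj (ψ (conj γ)) :=
  funext fun γ => modeInner_displacement_vacuum hψ hd γ

theorem continuous_overlap {ψ : ModeState} (hψ : Moderate ψ) (hd : Differentiable ℂ ψ) :
    Continuous (overlap ψ) := by
  rw [overlap_eq hψ hd]
  exact (by fun_prop : Continuous fun γ : ℂ => ((Real.exp (-(‖γ‖ ^ 2 / 2)) : ℝ) : ℂ)).mul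
    (Complex.continuous_conj.comp (hψ.1.comp Complex.continuous_conj))

theorem exists_norm_overlap_le {ψ : ModeState} (hψ : Moderate ψ) (hd : Differentiable ℂ ψ) :
    ∃ M, ∀ γ, ‖overlap ψ γ‖ ≤ M := by
  rw [overlap_eq hψ hd]
  obtain ⟨-, C, t, hC, -, ht, hb⟩ := hψ
  refine ⟨C + 1, fun γ => ?_⟩
  have h1 := hb (conj γ)
  rw [RCLike.norm_conj] at h1
  rw [norm_mul, Complex.norm_of_nonneg (Real.exp_pos _).le, RCLike.norm_conj]
  refine (abs_le_of_sq_le_sq' ?_ (by positivity)).2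
  rw [mul_pow, ← Real.exp_nat_mul]
  push_cast
  rw [show 2 * -(‖γ‖ ^ 2 / 2) = -‖γ‖ ^ 2 by ring]
  calc Real.exp (-‖γ‖ ^ 2) * ‖ψ (conj γ)‖ ^ 2
      ≤ Real.exp (-‖γ‖ ^ 2) * (C * Real.exp (t * ‖γ‖ ^ 2)) := by gcongr
    _ = C * Real.exp (-((1 - t) * ‖γ‖ ^ 2)) := by
      rw [mul_left_comm, ← Real.exp_add]
      ring_nf
    _ ≤ C * 1 := by
      gcongr
      rw [Real.exp_le_one_iff]
      have : 0 ≤ (1 - t) * ‖γ‖ ^ 2 := mul_nonneg (by linarith) (sq_nonneg _)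
      linarith
    _ ≤ (C + 1) ^ 2 := by nlinarith

theorem overlap_ne_zero {ψ : ModeState} (hψ : Moderate ψ) (hd : Differentiable ℂ ψ) {z : ℂ}
    (hz : ψ z ≠ 0) : overlap ψ (conj z) ≠ 0 := by
  rw [overlap_eq hψ hd]
  simpa using hz

theorem costAlong_toCircuitParams {ψ : ModeState} (hψ : Moderate ψ) {L : ℕ} (k : Fin L)
    (y : Fin L → LayerParams) (t : ℝ) : costAlong ψ k (toCircuitParams y) t
      = layersCost (overlap ψ) (Function.update y k ((y k).1, t, (y k).2.2)) := by
  rw [layersCost]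
  refine Eq.trans ?_ (cost_toCircuitParams hψ (Function.update y k ((y k).1, t, (y k).2.2)))
  rw [costAlong]
  congr 1
  refine Prod.ext ?_ (Prod.ext ?_ ?_) <;> funext i <;> rcases eq_or_ne i k with rfl | hi <;>
    simp_all [toCircuitParams]

theorem hasDerivAt_costAlong {ψ : ModeState} (hψ : Moderate ψ) {L : ℕ} (k : Fin L)
    (x : CircuitParams L) : HasDerivAt (costAlong ψ k x)
      (layersSlope (overlap ψ) k (ofCircuitParams x)) (x.2.1 k) := by
  obtain ⟨u, v, w, hu⟩ := exists_layersCost_update_eq (overlap ψ) k (ofCircuitParams x) (x.1 k)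
  have h1 : costAlong ψ k x = fun t => ‖rotationAmplitude u v w t (x.2.2 k)‖ ^ 2 := by
    funext t
    rw [← (hu t (x.2.2 k)).1]
    exact costAlong_toCircuitParams hψ k (ofCircuitParams x) t
  have h2 := (hu (x.2.1 k) (x.2.2 k)).2
  rw [show (x.1 k, x.2.1 k, x.2.2 k) = ofCircuitParams x k from rfl,
    Function.update_eq_self] at h2
  rw [h1, h2]
  exact hasDerivAt_norm_sq_rotationAmplitude u v w _ _

theorem costGradient_eq {ψ : ModeState} (hψ : Moderate ψ) {L : ℕ} (k : Fin L) :
    costGradient ψ k = fun x => layersSlope (overlap ψ) k (ofCircuitParams x) :=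
  funext fun x => (hasDerivAt_costAlong hψ k x).deriv

theorem continuous_costGradient {ψ : ModeState} (hψ : Moderate ψ) (hd : Differentiable ℂ ψ) {L : ℕ}
    (k : Fin L) : Continuous (costGradient ψ k) := by
  rw [costGradient_eq hψ k]
  exact (continuous_layersSlope (continuous_overlap hψ hd) k).comp continuous_ofCircuitParams

theorem memLp_costGradient {ψ : ModeState} (hψ : Moderate ψ) (hd : Differentiable ℂ ψ) {L : ℕ}
    (k : Fin L) (E : ℝ) : MemLp (costGradient ψ k) 2 (circuitEnsemble E L) := by
  obtain ⟨M, hM⟩ := exists_norm_overlap_le hψ hd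
  refine MemLp.of_bound (continuous_costGradient hψ hd k).aestronglyMeasurable
    ((2 ^ L * M) ^ 2) (ae_of_all _ fun x => ?_)
  rw [costGradient_eq hψ k]
  exact abs_layersSlope_le hM k _

theorem integral_costGradient {ψ : ModeState} (hψ : Moderate ψ) (hd : Differentiable ℂ ψ) {L : ℕ}
    (k : Fin L) (E : ℝ) : ∫ x, costGradient ψ k x ∂circuitEnsemble E L = 0 := by
  obtain ⟨M, hM⟩ := exists_norm_overlap_le hψ hd
  rw [integral_circuitEnsemble (continuous_costGradient hψ hd k), costGradient_eq hψ k]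
  exact integral_layersSlope (continuous_overlap hψ hd) hM k

theorem variance_costGradient {ψ : ModeState} (hψ : Moderate ψ) (hd : Differentiable ℂ ψ) {L : ℕ}
    (k : Fin L) (E : ℝ) : variance (costGradient ψ k) (circuitEnsemble E L)
      = ∫ y, layersSlope (overlap ψ) k y ^ 2 ∂layersLaw (E / L) L := by
  have hc := continuous_costGradient hψ hd k
  rw [variance_of_integral_eq_zero hc.measurable.aemeasurable (integral_costGradient hψ hd k E),
    integral_circuitEnsemble (f := fun x => costGradient ψ k x ^ 2) (hc.pow 2), costGradient_eq hψ k]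
  rfl

theorem exists_le_variance_costGradient {ψ : ModeState} (hψ : Moderate ψ)
    (hd : Differentiable ℂ ψ) {z : ℂ} (hz : ψ z ≠ 0) :
    ∃ c : ℝ, 0 < c ∧ ∀ E : ℝ, 1 ≤ E → ∀ (L : ℕ) (k : Fin L),
      c / E ^ 2 ≤ variance (costGradient ψ k) (circuitEnsemble E L) := by
  obtain ⟨M, hM⟩ := exists_norm_overlap_le hψ hd
  have hc := continuous_overlap hψ hd
  obtain ⟨c, hc0, h⟩ := exists_le_integral_complexGaussian hc hM (overlap_ne_zero hψ hd hz)
  refine ⟨(c / 2) ^ 2 / 18, by positivity, fun E hE L k => ?_⟩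
  have hE0 : 0 < E := by linarith
  rw [variance_costGradient hψ hd]
  have h1 := sq_integral_layersCost_le (v := E / L) hc hM k
  rw [integral_layersCost hc hM hE0 k] at h1
  have h2 : (c / E / 2) ^ 2 ≤ ((∫ β, ‖overlap ψ β‖ ^ 2 ∂complexGaussian E) / 2) ^ 2 := by
    have := h E hE
    gcongr
  have h3 : (c / 2) ^ 2 / 18 / E ^ 2 = (c / E / 2) ^ 2 / 18 := by
    field_simp
  rw [h3]
  linarith

/-! ### Characteristic functions of the circuit states -/

/-- The characteristic functions `⟨Ψₐ|D(ξ)Ψ_b⟩` of the circuit state. -/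
def charFunction {L : ℕ} (y : Fin L → LayerParams) (ξ : ℂ) (a b : Fin 2) : ℂ :=
  modeInner (circuitState y a) (displacement ξ (circuitState y b))

/-- The action of a qubit operator on characteristic functions. -/
def conjugateSymbol (R : Matrix (Fin 2) (Fin 2) ℂ) (χ : Fin 2 → Fin 2 → ℂ) (a b : Fin 2) : ℂ :=
  conj (R a 0) * R b 0 * χ 0 0 + conj (R a 0) * R b 1 * χ 0 1
    + conj (R a 1) * R b 0 * χ 1 0 + conj (R a 1) * R b 1 * χ 1 1

theorem modeInner_combination {F₀ F₁ : ModeState} (h₀ : F₀ ∈ coherentSpan) (h₁ : F₁ ∈ coherentSpan)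
    (ξ c₀ c₁ d₀ d₁ : ℂ) :
    modeInner (c₀ • F₀ + c₁ • F₁) (displacement ξ (d₀ • F₀ + d₁ • F₁))
      = conj c₀ * d₀ * modeInner F₀ (displacement ξ F₀)
        + conj c₀ * d₁ * modeInner F₀ (displacement ξ F₁)
        + conj c₁ * d₀ * modeInner F₁ (displacement ξ F₀)
        + conj c₁ * d₁ * modeInner F₁ (displacement ξ F₁) := by
  have hm : ∀ {F : ModeState} (_ : F ∈ coherentSpan) (c : ℂ), Moderate (c • F) := fun hF c =>
    moderate_of_mem_coherentSpan (Submodule.smul_mem _ _ hF)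
  have hd₀ := displacement_mem_coherentSpan ξ h₀
  have hd₁ := displacement_mem_coherentSpan ξ h₁
  have hleft : ∀ G : ModeState, G ∈ coherentSpan →
      modeInner (c₀ • F₀ + c₁ • F₁) G = conj c₀ * modeInner F₀ G + conj c₁ * modeInner F₁ G :=
    fun G hG => by
      rw [← conj_modeInner, modeInner_add_right (moderate_of_mem_coherentSpan hG) (hm h₀ _)
        (hm h₁ _), modeInner_smul_right, modeInner_smul_right, map_add, map_mul, map_mul,
        conj_modeInner, conj_modeInner]
  rw [displacement_add, displacement_smul, displacement_smul, modeInner_add_right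
    (moderate_of_mem_coherentSpan (Submodule.add_mem _ (Submodule.smul_mem _ _ h₀)
      (Submodule.smul_mem _ _ h₁))) (hm hd₀ _) (hm hd₁ _), modeInner_smul_right,
    modeInner_smul_right, hleft _ hd₀, hleft _ hd₁]
  ring

theorem modeInner_displacement_displacement (a ξ b : ℂ) (F G : ModeState) :
    modeInner (displacement a F) (displacement ξ (displacement b G))
      = weylPhase ξ b * weylPhase (-a) (ξ + b) * modeInner F (displacement (ξ + b - a) G) := by
  have h := modeInner_displacement_right (-a) F (displacement ξ (displacement b G))
  rw [neg_neg] at h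
  rw [← h, displacement_displacement ξ b, displacement_smul, displacement_displacement,
    modeInner_smul_right, modeInner_smul_right, mul_assoc]
  congr 4
  ring

/-- The symplectic character `exp (β ξ̄ - β̄ ξ)`, conjugated. -/
def symplecticPhase (β ξ : ℂ) : ℂ := Complex.exp (conj ξ * β + -ξ * conj β)

theorem symplecticPhase_add (β ξ η : ℂ) :
    symplecticPhase β (ξ + η) = symplecticPhase β ξ * symplecticPhase β η := by
  rw [symplecticPhase, symplecticPhase, symplecticPhase, ← Complex.exp_add, map_add]
  congr 1
  ring

theorem symplecticPhase_neg (β ξ : ℂ) : symplecticPhase β (-ξ) = symplecticPhase (-β) ξ := by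
  rw [symplecticPhase, symplecticPhase, map_neg, map_neg]
  congr 1
  ring

theorem integral_symplecticPhase {v : ℝ} (hv : 0 < v) (ξ : ℂ) :
    ∫ β, symplecticPhase β ξ ∂complexGaussian v = (Real.exp (-(v * ‖ξ‖ ^ 2)) : ℂ) := by
  simp only [symplecticPhase]
  rw [integral_cexp_complexGaussian hv]
  push_cast
  rw [← Complex.mul_conj' ξ]
  congr 1
  ring

section Step

variable {L : ℕ} (y : Fin L → LayerParams) (β : ℂ) (θ φ : ℝ) (ξ : ℂ)

theorem charFunction_addLayer (a b : Fin 2) : charFunction (addLayer y (β, θ, φ)) ξ a b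
    = weylPhase ξ (ecdShift b β) * weylPhase (-ecdShift a β) (ξ + ecdShift b β)
      * conjugateSymbol (qubitRotation θ φ) (charFunction y (ξ + ecdShift b β - ecdShift a β))
        (1 - a) (1 - b) := by
  rw [charFunction, circuitState_succ, circuitState_succ, modeInner_displacement_displacement]
  simp only [addLayer_castSucc, addLayer_last]
  rw [modeInner_combination (circuitState_mem_coherentSpan _ _)
    (circuitState_mem_coherentSpan _ _)]
  rfl

/-- Between equal qubit states the two displacements are conjugate to each other and only produce a
phase in ξ. Between different qubit states (`charFunction_addLayer_zero_one`) the phases cancel and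
ξ is shifted by ±2β. The conditional displacement flips the qubit, so the rotated matrix appears
with indices exchanged. -/
theorem charFunction_addLayer_zero_zero : charFunction (addLayer y (β, θ, φ)) ξ 0 0
    = symplecticPhase β ξ * conjugateSymbol (qubitRotation θ φ) (charFunction y ξ) 1 1 := by
  rw [charFunction_addLayer, add_sub_cancel_right, weylPhase, weylPhase, ← Complex.exp_add,
    symplecticPhase]
  congr 2
  simp only [ecdShift, Matrix.cons_val_zero, map_neg, map_add, neg_neg]
  ring

theorem charFunction_addLayer_one_one : charFunction (addLayer y (β, θ, φ)) ξ 1 1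
    = symplecticPhase (-β) ξ * conjugateSymbol (qubitRotation θ φ) (charFunction y ξ) 0 0 := by
  rw [charFunction_addLayer, add_sub_cancel_right, weylPhase, weylPhase, ← Complex.exp_add,
    symplecticPhase]
  congr 2
  simp only [ecdShift, Matrix.cons_val_one, Matrix.cons_val_fin_one, map_neg, map_add]
  ring

theorem charFunction_addLayer_zero_one : charFunction (addLayer y (β, θ, φ)) ξ 0 1
    = conjugateSymbol (qubitRotation θ φ) (charFunction y (ξ + 2 * β)) 1 0 := by
  rw [charFunction_addLayer, weylPhase, weylPhase, ← Complex.exp_add]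
  simp only [ecdShift, Matrix.cons_val_zero, Matrix.cons_val_one, Matrix.cons_val_fin_one,
    map_add, neg_neg]
  rw [show (ξ * conj β - conj ξ * β) / 2 + (β * (conj ξ + conj β) - conj β * (ξ + β)) / 2 = 0 by
    ring, Complex.exp_zero, one_mul, show ξ + β - -β = ξ + 2 * β by ring]
  rfl

theorem charFunction_addLayer_one_zero : charFunction (addLayer y (β, θ, φ)) ξ 1 0
    = conjugateSymbol (qubitRotation θ φ) (charFunction y (ξ + 2 * -β)) 0 1 := by
  rw [charFunction_addLayer, weylPhase, weylPhase, ← Complex.exp_add]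
  simp only [ecdShift, Matrix.cons_val_zero, Matrix.cons_val_one, Matrix.cons_val_fin_one, map_neg,
    map_add]
  rw [show (ξ * -conj β - conj ξ * -β) / 2 + (-β * (conj ξ + -conj β) - -conj β * (ξ + -β)) / 2 = 0
    by ring, Complex.exp_zero, one_mul, show ξ + -β - β = ξ + 2 * -β by ring]
  rfl

end Step

theorem charFunction_fin_zero (y : Fin 0 → LayerParams) (ξ : ℂ) :
    charFunction y ξ 0 0 = (Real.exp (-(1 / 2) * ‖ξ‖ ^ 2) : ℂ) ∧ charFunction y ξ 0 1 = 0 ∧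
      charFunction y ξ 1 0 = 0 ∧ charFunction y ξ 1 1 = 0 := by
  have h0 : vacuum = fun z => Complex.exp (0 * z) := by
    funext z
    simp [vacuum]
  refine ⟨?_, ?_, ?_, ?_⟩
  · change modeInner vacuum (displacement ξ vacuum) = _
    rw [h0, modeInner_exp]
    push_cast
    congr 1
    rw [map_zero]
    ring
  all_goals simp [charFunction, circuitState_zero, initialState, modeInner, displacement]

theorem exists_eq_addLayer {L : ℕ} (y : Fin (L + 1) → LayerParams) :
    y = addLayer (fun i => y i.castSucc) (y (Fin.last L)) := by
  funext i
  induction i using Fin.lastCases <;> simp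

theorem continuous_charFunction (L : ℕ) (a b : Fin 2) :
    Continuous fun q : (Fin L → LayerParams) × ℂ => charFunction q.1 q.2 a b := by
  induction L generalizing a b with
  | zero =>
    have h := charFunction_fin_zero
    have ha : a = 0 ∨ a = 1 := by omega
    have hb : b = 0 ∨ b = 1 := by omega
    rcases ha with rfl | rfl <;> rcases hb with rfl | rfl
    · simp only [(h _ _).1]
      fun_prop
    · simpa only [(h _ _).2.1] using continuous_const
    · simpa only [(h _ _).2.2.1] using continuous_const
    · simpa only [(h _ _).2.2.2] using continuous_const
  | succ L ih =>
    have he : (fun q : (Fin (L + 1) → LayerParams) × ℂ => charFunction q.1 q.2 a b)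
        = fun q => charFunction (addLayer (fun i => q.1 i.castSucc) ((q.1 (Fin.last L)).1,
          (q.1 (Fin.last L)).2.1, (q.1 (Fin.last L)).2.2)) q.2 a b :=
      funext fun q => by rw [← exists_eq_addLayer]
    rw [he]
    simp only [charFunction_addLayer]
    have hs : ∀ a, Continuous fun q : (Fin (L + 1) → LayerParams) × ℂ =>
        ecdShift a (q.1 (Fin.last L)).1 := fun a => (continuous_ecdShift a).comp (by fun_prop)
    have hR : ∀ a b, Continuous fun q : (Fin (L + 1) → LayerParams) × ℂ =>
        qubitRotation (q.1 (Fin.last L)).2.1 (q.1 (Fin.last L)).2.2 a b := fun a b =>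
      (continuous_qubitRotation a b).comp (by fun_prop : Continuous fun
        q : (Fin (L + 1) → LayerParams) × ℂ => ((q.1 (Fin.last L)).2.1, (q.1 (Fin.last L)).2.2))
    have hR' : ∀ a b, Continuous fun q : (Fin (L + 1) → LayerParams) × ℂ =>
        conj (qubitRotation (q.1 (Fin.last L)).2.1 (q.1 (Fin.last L)).2.2 a b) := fun a b =>
      Complex.continuous_conj.comp (hR a b)
    have hχ : ∀ c d, Continuous fun q : (Fin (L + 1) → LayerParams) × ℂ =>
        charFunction (fun i => q.1 i.castSucc)
          (q.2 + ecdShift b (q.1 (Fin.last L)).1 - ecdShift a (q.1 (Fin.last L)).1) c d :=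
      fun c d => (ih c d).comp ((by fun_prop : Continuous fun
        q : (Fin (L + 1) → LayerParams) × ℂ => fun i : Fin L => q.1 i.castSucc).prodMk
          ((continuous_snd.add (hs b)).sub (hs a)))
    refine ((continuous_weylPhase.comp (continuous_snd.prodMk (hs b))).mul
      (continuous_weylPhase.comp ((hs a).neg.prodMk (continuous_snd.add (hs b))))).mul ?_
    unfold conjugateSymbol
    exact (((((hR' _ _).mul (hR _ _)).mul (hχ _ _)).add (((hR' _ _).mul (hR _ _)).mul (hχ _ _))).add
      (((hR' _ _).mul (hR _ _)).mul (hχ _ _))).add (((hR' _ _).mul (hR _ _)).mul (hχ _ _))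

/-! ### Rotations of characteristic functions -/

section Rotation

variable (θ φ : ℝ) (χ : Fin 2 → Fin 2 → ℂ)

/-- The component of the population difference after a rotation that grows with the angle. -/
def coherencePart : ℂ :=
  Real.cos φ * (-Complex.I * (χ 0 1 - χ 1 0)) + Real.sin φ * -(χ 0 1 + χ 1 0)

theorem exists_qubitRotation_eq : ∃ r r' : ℂ, r * r' = -1 ∧
    r = -Complex.I * Real.cos φ - Real.sin φ ∧ r' = -Complex.I * Real.cos φ + Real.sin φ ∧
    ∀ a b, conjugateSymbol (qubitRotation θ φ) χ a b = conjugateSymbol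
      !![(Real.cos (θ / 2) : ℂ), Real.sin (θ / 2) * r; Real.sin (θ / 2) * r', Real.cos (θ / 2)]
      χ a b ∧ conj (Real.sin (θ / 2) * r) = -(Real.sin (θ / 2) * r') ∧
      conj (Real.sin (θ / 2) * r') = -(Real.sin (θ / 2) * r) := by
  refine ⟨_, _, ?_, rfl, rfl, fun a b => ⟨?_, ?_, ?_⟩⟩
  · have h : (Real.sin φ : ℂ) ^ 2 + (Real.cos φ : ℂ) ^ 2 = 1 := by
      exact_mod_cast congrArg Complex.ofReal (Real.sin_sq_add_cos_sq φ)
    linear_combination (Real.cos φ : ℂ) ^ 2 * Complex.I_mul_I - h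
  · congr 1
    ext i j
    rw [qubitRotation_apply]
    fin_cases i <;> fin_cases j <;> simp [rotationAmplitude, pauliX, pauliY, -mul_eq_mul_left_iff] <;> ring
  · simp only [map_mul, map_sub, map_neg, Complex.conj_ofReal, Complex.conj_I]
    ring
  · simp only [map_mul, map_add, map_neg, Complex.conj_ofReal, Complex.conj_I]
    ring

theorem conjugateSymbol_rotation {c s : ℝ} {r r' : ℂ} (h : conj (s * r) = -(s * r'))
    (h' : conj (s * r') = -(s * r)) :
    conjugateSymbol !![(c : ℂ), s * r; s * r', c] χ 0 0
        = c ^ 2 * χ 0 0 - s ^ 2 * (r * r') * χ 1 1 + c * s * (r * χ 0 1 - r' * χ 1 0) ∧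
      conjugateSymbol !![(c : ℂ), s * r; s * r', c] χ 1 1
        = c ^ 2 * χ 1 1 - s ^ 2 * (r * r') * χ 0 0 - c * s * (r * χ 0 1 - r' * χ 1 0) ∧
      conjugateSymbol !![(c : ℂ), s * r; s * r', c] χ 0 1
        = c ^ 2 * χ 0 1 - s ^ 2 * r' ^ 2 * χ 1 0 + c * s * r' * (χ 0 0 - χ 1 1) ∧
      conjugateSymbol !![(c : ℂ), s * r; s * r', c] χ 1 0
        = c ^ 2 * χ 1 0 - s ^ 2 * r ^ 2 * χ 0 1 - c * s * r * (χ 0 0 - χ 1 1) := by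
  simp only [conjugateSymbol, Matrix.of_apply, Matrix.cons_val_zero, Matrix.cons_val_one,
    Matrix.cons_val_fin_one, h, h', Complex.conj_ofReal]
  refine ⟨?_, ?_, ?_, ?_⟩ <;> ring

theorem cos_half_sq_add_sin_half_sq :
    (Real.cos (θ / 2) : ℂ) ^ 2 + (Real.sin (θ / 2) : ℂ) ^ 2 = 1 := by
  exact_mod_cast congrArg Complex.ofReal (Real.cos_sq_add_sin_sq (θ / 2))

theorem conjugateSymbol_add :
    conjugateSymbol (qubitRotation θ φ) χ 0 0 + conjugateSymbol (qubitRotation θ φ) χ 1 1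
      = χ 0 0 + χ 1 1 := by
  obtain ⟨r, r', hr, -, -, hR⟩ := exists_qubitRotation_eq θ φ χ
  have h := conjugateSymbol_rotation χ (c := Real.cos (θ / 2)) (hR 0 0).2.1 (hR 0 0).2.2
  rw [(hR 0 0).1, (hR 1 1).1, h.1, h.2.1]
  linear_combination (χ 0 0 + χ 1 1) * cos_half_sq_add_sin_half_sq θ
    - (Real.sin (θ / 2) : ℂ) ^ 2 * (χ 0 0 + χ 1 1) * hr

/-- In Bloch coordinates the rotation turns the population difference towards one coherence selected
by φ, while `conjugateSymbol_add` says that the trace is fixed. -/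
theorem conjugateSymbol_sub :
    conjugateSymbol (qubitRotation θ φ) χ 0 0 - conjugateSymbol (qubitRotation θ φ) χ 1 1
      = Real.cos θ * (χ 0 0 - χ 1 1) + Real.sin θ * coherencePart φ χ := by
  obtain ⟨r, r', hr, hr1, hr2, hR⟩ := exists_qubitRotation_eq θ φ χ
  have h := conjugateSymbol_rotation χ (c := Real.cos (θ / 2)) (hR 0 0).2.1 (hR 0 0).2.2
  have e1 : (Real.cos θ : ℂ) = (Real.cos (θ / 2) : ℂ) ^ 2 - (Real.sin (θ / 2) : ℂ) ^ 2 := by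
    have := Real.cos_two_mul' (θ / 2)
    rw [mul_div_cancel₀ θ two_ne_zero] at this
    exact_mod_cast congrArg Complex.ofReal this
  have e2 : (Real.sin θ : ℂ) = 2 * Real.sin (θ / 2) * Real.cos (θ / 2) := by
    have := Real.sin_two_mul (θ / 2)
    rw [mul_div_cancel₀ θ two_ne_zero] at this
    exact_mod_cast congrArg Complex.ofReal this
  have e3 : coherencePart φ χ = r * χ 0 1 - r' * χ 1 0 := by
    rw [coherencePart, hr1, hr2]
    ring
  rw [(hR 0 0).1, (hR 1 1).1, h.1, h.2.1, e1, e2, e3]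
  linear_combination (Real.sin (θ / 2) : ℂ) ^ 2 * (χ 0 0 - χ 1 1) * hr

/-- Rotations preserve the bilinear scalar product of two Bloch vectors, so the transverse part of
the product changes by what its longitudinal part loses. -/
theorem conjugateSymbol_coherence (η : Fin 2 → Fin 2 → ℂ) :
    conjugateSymbol (qubitRotation θ φ) χ 0 1 * conjugateSymbol (qubitRotation θ φ) η 1 0
      + conjugateSymbol (qubitRotation θ φ) χ 1 0 * conjugateSymbol (qubitRotation θ φ) η 0 1
      = χ 0 1 * η 1 0 + χ 1 0 * η 0 1 + (χ 0 0 - χ 1 1) * (η 0 0 - η 1 1) / 2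
        - (conjugateSymbol (qubitRotation θ φ) χ 0 0 - conjugateSymbol (qubitRotation θ φ) χ 1 1)
          * (conjugateSymbol (qubitRotation θ φ) η 0 0
            - conjugateSymbol (qubitRotation θ φ) η 1 1) / 2 := by
  obtain ⟨r, r', hr, hr1, hr2, hR⟩ := exists_qubitRotation_eq θ φ χ
  obtain ⟨q, q', -, hq1, hq2, hR'⟩ := exists_qubitRotation_eq θ φ η
  obtain rfl : q = r := hq1.trans hr1.symm
  obtain rfl : q' = r' := hq2.trans hr2.symm
  have h := conjugateSymbol_rotation χ (c := Real.cos (θ / 2)) (hR 0 0).2.1 (hR 0 0).2.2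
  have h' := conjugateSymbol_rotation η (c := Real.cos (θ / 2)) (hR 0 0).2.1 (hR 0 0).2.2
  simp only [fun a b => (hR a b).1, fun a b => (hR' a b).1]
  simp only [h.1, h.2.1, h.2.2.1, h.2.2.2, h'.1, h'.2.1, h'.2.2.1, h'.2.2.2]
  have hcs := cos_half_sq_add_sin_half_sq θ
  generalize (Real.cos (θ / 2) : ℂ) = c at *
  generalize (Real.sin (θ / 2) : ℂ) = s at *
  clear h h' hR hR'
  -- As qq' = -1, the off-diagonal entries can be divided by their phases, which reduces the
  -- identity to a rotation with real coefficients c and s.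
  have hinv : ∀ a : ℂ, a = -q' * (q * a) ∧ a = -q * (q' * a) := fun a => by
    constructor <;> linear_combination a * hr
  obtain ⟨A, hA⟩ : ∃ A, χ 0 1 = -q' * A := ⟨_, (hinv _).1⟩
  obtain ⟨B, hB⟩ : ∃ B, χ 1 0 = -q * B := ⟨_, (hinv _).2⟩
  obtain ⟨A', hA'⟩ : ∃ A, η 0 1 = -q' * A := ⟨_, (hinv _).1⟩
  obtain ⟨B', hB'⟩ : ∃ B, η 1 0 = -q * B := ⟨_, (hinv _).2⟩
  rw [hA, hB, hA', hB']
  have e01 : ∀ a b z : ℂ, c ^ 2 * (-q' * a) - s ^ 2 * q' ^ 2 * (-q * b) + c * s * q' * z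
      = -q' * (c ^ 2 * a + s ^ 2 * b - c * s * z) := fun a b z => by
    linear_combination (s ^ 2 * q' * b) * hr
  have e10 : ∀ a b z : ℂ, c ^ 2 * (-q * b) - s ^ 2 * q ^ 2 * (-q' * a) - c * s * q * z
      = -q * (c ^ 2 * b + s ^ 2 * a + c * s * z) := fun a b z => by
    linear_combination (s ^ 2 * q * a) * hr
  have ed : ∀ a b x y : ℂ, c ^ 2 * x - s ^ 2 * (q * q') * y + c * s * (q * (-q' * a) - q' * (-q * b))
      - (c ^ 2 * y - s ^ 2 * (q * q') * x - c * s * (q * (-q' * a) - q' * (-q * b)))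
      = (c ^ 2 - s ^ 2) * (x - y) + 2 * c * s * (a - b) := fun a b x y => by
    linear_combination (s ^ 2 * (x - y) - 2 * c * s * (a - b)) * hr
  rw [e01, e01, e10, e10, ed, ed]
  generalize χ 0 0 - χ 1 1 = z
  generalize η 0 0 - η 1 1 = z'
  linear_combination ((c ^ 2 * A + s ^ 2 * B - c * s * z) * (c ^ 2 * B' + s ^ 2 * A' + c * s * z')
    + (c ^ 2 * B + s ^ 2 * A + c * s * z) * (c ^ 2 * A' + s ^ 2 * B' - c * s * z')
    - A * B' - B * A') * hr
    + (z * z' / 2 - A * B' - B * A') * (c ^ 2 + s ^ 2 + 1) * hcs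

end Rotation

/-! ### Bounds on characteristic functions -/

theorem symplecticPhase_zero (β : ℂ) : symplecticPhase β 0 = 1 := by
  simp [symplecticPhase]

/-- Normalization of the circuit state: at ξ = 0 the phases are trivial and rotations preserve the
trace. It yields the bound |χ| ≤ 1, the only source of the sup bounds in the Nash argument. -/
theorem charFunction_self_add {L : ℕ} (y : Fin L → LayerParams) :
    charFunction y 0 0 0 + charFunction y 0 1 1 = 1 := by
  induction L with
  | zero => rw [(charFunction_fin_zero y 0).1, (charFunction_fin_zero y 0).2.2.2]; simp
  | succ L ih =>
    obtain ⟨β, θ, φ, h⟩ : ∃ β θ φ, y = addLayer (fun i => y i.castSucc) (β, θ, φ) :=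
      ⟨_, _, _, exists_eq_addLayer y⟩
    rw [h, charFunction_addLayer_zero_zero, charFunction_addLayer_one_one, symplecticPhase_zero,
      symplecticPhase_zero, one_mul, one_mul, add_comm, conjugateSymbol_add]
    exact ih _

theorem norm_charFunction_le {L : ℕ} (y : Fin L → LayerParams) (ξ : ℂ) (a b : Fin 2) :
    ‖charFunction y ξ a b‖ ≤ 1 := by
  have hm : ∀ a, Moderate (circuitState y a) := fun a =>
    moderate_of_mem_coherentSpan (circuitState_mem_coherentSpan y a)
  have h := norm_modeInner_le (hm a) ((hm b).displacement ξ)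
  rw [modeInner_displacement] at h
  have h1 : (modeInner (circuitState y 0) (circuitState y 0)).re
      + (modeInner (circuitState y 1) (circuitState y 1)).re = 1 := by
    have := congrArg Complex.re (charFunction_self_add y)
    simpa [charFunction, displacement_zero] using this
  have hn : ∀ a, (modeInner (circuitState y a) (circuitState y a)).re ≤ 1 := fun a => by
    have h0 := modeInner_self_re_nonneg (circuitState y 0)
    have h1' := modeInner_self_re_nonneg (circuitState y 1)
    have ha : a = 0 ∨ a = 1 := by omega
    rcases ha with rfl | rfl <;> linarith
  exact h.trans (by linarith [hn a, hn b])

/-! ### Averages over one layer -/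

theorem integral_const_add_trig_mul (k l x y x' y' : ℂ) :
    ∫ θ : ℝ, (k + l * ((Real.cos θ * x + Real.sin θ * y) * (Real.cos θ * x' + Real.sin θ * y')))
      ∂uniformAngle = k + l * ((x * x' + y * y') / 2) := by
  refine Eq.trans ?_ (integral_uniformAngle_trig (k + l * ((x * x' + y * y') / 2)) 0 0
    (l * ((x * x' - y * y') / 2)) (l * ((x * y' + y * x') / 2)) 0 0)
  congr 1
  funext θ
  have h : (Real.sin θ : ℂ) ^ 2 + (Real.cos θ : ℂ) ^ 2 = 1 := by
    exact_mod_cast congrArg Complex.ofReal (Real.sin_sq_add_cos_sq θ)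
  rw [Real.cos_two_mul, Real.sin_two_mul]
  simp only [Complex.real_smul]
  push_cast at h ⊢
  linear_combination (l * y * y') * h

/-- The joint characteristic function of two copies, summed over equal states of the qubits. -/
def parallelPart (χ η : Fin 2 → Fin 2 → ℂ) : ℂ := χ 0 0 * η 0 0 + χ 1 1 * η 1 1

/-- The joint characteristic function of two copies, summed over opposite states of the qubits. -/
def antiparallelPart (χ η : Fin 2 → Fin 2 → ℂ) : ℂ := χ 0 0 * η 1 1 + χ 1 1 * η 0 0

/-- The contribution of the qubit coherences to the joint characteristic function. -/
def crossPart (χ η : Fin 2 → Fin 2 → ℂ) : ℂ := χ 0 1 * η 1 0 + χ 1 0 * η 0 1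

/-- The combination that an average rotation contracts. -/
def defectPart (χ η : Fin 2 → Fin 2 → ℂ) : ℂ :=
  parallelPart χ η - antiparallelPart χ η - crossPart χ η

section Rotation

variable (χ η : Fin 2 → Fin 2 → ℂ)

/-- The mean over θ keeps half of the product of population differences and replaces the other half
by coherences; the mean over φ turns these into the cross part. -/
theorem integral_const_add_population (k l : ℂ) :
    ∫ φ, ∫ θ, (k + l * ((conjugateSymbol (qubitRotation θ φ) χ 0 0
        - conjugateSymbol (qubitRotation θ φ) χ 1 1)
      * (conjugateSymbol (qubitRotation θ φ) η 0 0
        - conjugateSymbol (qubitRotation θ φ) η 1 1))) ∂uniformAngle ∂uniformAngle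
      = k + l * ((χ 0 0 - χ 1 1) * (η 0 0 - η 1 1) + crossPart χ η) / 2 := by
  simp only [conjugateSymbol_sub, integral_const_add_trig_mul]
  simp only [coherencePart]
  have h := integral_const_add_trig_mul (k + l * ((χ 0 0 - χ 1 1) * (η 0 0 - η 1 1) / 2)) (l / 2)
    (-Complex.I * (χ 0 1 - χ 1 0)) (-(χ 0 1 + χ 1 0)) (-Complex.I * (η 0 1 - η 1 0))
    (-(η 0 1 + η 1 0))
  refine Eq.trans ?_ (h.trans ?_)
  · congr 1
    funext φ
    ring
  · rw [crossPart]
    linear_combination (l / 4 * (χ 0 1 - χ 1 0) * (η 0 1 - η 1 0)) * Complex.I_mul_I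

/-- The parallel part is half of (product of traces + product of differences). The mean replaces the
latter product by its average with the cross part, and their discrepancy is the defect, whence the
coefficient 1/4. -/
theorem integral_parallelPart :
    ∫ φ, ∫ θ, parallelPart (conjugateSymbol (qubitRotation θ φ) χ)
      (conjugateSymbol (qubitRotation θ φ) η) ∂uniformAngle ∂uniformAngle
      = parallelPart χ η - defectPart χ η / 4 := by
  refine Eq.trans ?_ ((integral_const_add_population χ η
    ((χ 0 0 + χ 1 1) * (η 0 0 + η 1 1) / 2) (1 / 2)).trans ?_)
  · congr 1
    funext φ
    congr 1
    funext θ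
    rw [← conjugateSymbol_add θ φ χ, ← conjugateSymbol_add θ φ η, parallelPart]
    ring
  · simp only [defectPart, parallelPart, antiparallelPart, crossPart]
    ring

theorem integral_antiparallelPart :
    ∫ φ, ∫ θ, antiparallelPart (conjugateSymbol (qubitRotation θ φ) χ)
      (conjugateSymbol (qubitRotation θ φ) η) ∂uniformAngle ∂uniformAngle
      = antiparallelPart χ η + defectPart χ η / 4 := by
  refine Eq.trans ?_ ((integral_const_add_population χ η
    ((χ 0 0 + χ 1 1) * (η 0 0 + η 1 1) / 2) (-(1 / 2))).trans ?_)
  · congr 1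
    funext φ
    congr 1
    funext θ
    rw [← conjugateSymbol_add θ φ χ, ← conjugateSymbol_add θ φ η, antiparallelPart]
    ring
  · simp only [defectPart, parallelPart, antiparallelPart, crossPart]
    ring

theorem integral_crossPart :
    ∫ φ, ∫ θ, crossPart (conjugateSymbol (qubitRotation θ φ) χ)
      (conjugateSymbol (qubitRotation θ φ) η) ∂uniformAngle ∂uniformAngle
      = crossPart χ η + defectPart χ η / 4 := by
  refine Eq.trans ?_ ((integral_const_add_population χ η
    (crossPart χ η + (χ 0 0 - χ 1 1) * (η 0 0 - η 1 1) / 2) (-(1 / 2))).trans ?_)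
  · congr 1
    funext φ
    congr 1
    funext θ
    rw [crossPart, conjugateSymbol_coherence, crossPart]
    ring
  · simp only [defectPart, parallelPart, antiparallelPart, crossPart]
    ring

end Rotation

/-- The law of β is even, so β may be reversed in the second summand alone. With this choice both
summands carry the same phase or the same shift. -/
theorem integral_layerLaw_add {v : ℝ} (hv : 0 < v) {f g : LayerParams → ℂ} (hf : Continuous f)
    (hg : Continuous g) {C : ℝ} (hfC : ∀ p, ‖f p‖ ≤ C) (hgC : ∀ p, ‖g p‖ ≤ C) :
    ∫ p, (f p + g p) ∂layerLaw v = ∫ β, ∫ φ, ∫ θ, (f (β, θ, φ) + g (-β, θ, φ))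
      ∂uniformAngle ∂uniformAngle ∂complexGaussian v := by
  have hg' : Continuous fun p : LayerParams => g (-p.1, p.2) := by fun_prop
  have e : ∫ p, g p ∂layerLaw v = ∫ p : LayerParams, g (-p.1, p.2) ∂layerLaw v := by
    rw [integral_layerLaw (hg.integrable_of_bounded hgC),
      integral_layerLaw (hg'.integrable_of_bounded fun p => hgC _),
      ← integral_neg_complexGaussian hv]
  rw [integral_add (hf.integrable_of_bounded hfC) (hg.integrable_of_bounded hgC), e,
    ← integral_add (hf.integrable_of_bounded hfC) (hg'.integrable_of_bounded fun p => hgC _),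
    integral_layerLaw (f := fun p => f p + g (-p.1, p.2))
      ((hf.add hg').integrable_of_bounded (C := C + C) fun p =>
      (norm_add_le _ _).trans (add_le_add (hfC _) (hgC _)))]
  congr 1
  funext β
  exact integral_prod_symm (fun q : ℝ × ℝ => f (β, q) + g (-β, q))
    (Continuous.integrable_of_bounded (C := C + C) (by fun_prop) fun p =>
      (norm_add_le _ _).trans (add_le_add (hfC _) (hgC _)))

theorem continuous_addLayer (L : ℕ) :
    Continuous fun q : (Fin L → LayerParams) × LayerParams => addLayer q.1 q.2 := by
  refine continuous_pi fun i => ?_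
  induction i using Fin.lastCases with
  | last =>
    simp only [addLayer_last]
    exact continuous_snd
  | cast i =>
    simp only [addLayer_castSucc]
    fun_prop

theorem continuous_charFunction_mul {L : ℕ} (ξ₁ ξ₂ : ℂ) (a b c d : Fin 2) :
    Continuous fun y : Fin L → LayerParams => charFunction y ξ₁ a b * charFunction y ξ₂ c d :=
  ((continuous_charFunction L a b).comp (continuous_id.prodMk continuous_const)).mul
    ((continuous_charFunction L c d).comp (continuous_id.prodMk continuous_const))

theorem norm_charFunction_mul_le {L : ℕ} (y : Fin L → LayerParams) (ξ₁ ξ₂ : ℂ) (a b c d : Fin 2) :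
    ‖charFunction y ξ₁ a b * charFunction y ξ₂ c d‖ ≤ 1 := by
  rw [norm_mul]
  exact mul_le_one₀ (norm_charFunction_le y ξ₁ a b) (norm_nonneg _) (norm_charFunction_le y ξ₂ c d)

section Layer

variable {v : ℝ} {L : ℕ} (y : Fin L → LayerParams) (ξ₁ ξ₂ : ℂ)

theorem continuous_charFunction_mul_addLayer (a b c d : Fin 2) : Continuous fun p =>
    charFunction (addLayer y p) ξ₁ a b * charFunction (addLayer y p) ξ₂ c d :=
  (continuous_charFunction_mul ξ₁ ξ₂ a b c d).comp
    ((continuous_addLayer L).comp (continuous_const.prodMk continuous_id))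

theorem integral_parallelPart_addLayer (hv : 0 < v) :
    ∫ p, parallelPart (charFunction (addLayer y p) ξ₁) (charFunction (addLayer y p) ξ₂) ∂layerLaw v
      = (Real.exp (-(v * ‖ξ₁ + ξ₂‖ ^ 2)) : ℂ) *
        (parallelPart (charFunction y ξ₁) (charFunction y ξ₂)
          - defectPart (charFunction y ξ₁) (charFunction y ξ₂) / 4) := by
  simp only [parallelPart.eq_1 (charFunction (addLayer _ _) _)]
  rw [integral_layerLaw_add hv (continuous_charFunction_mul_addLayer y ξ₁ ξ₂ 0 0 0 0)
    (continuous_charFunction_mul_addLayer y ξ₁ ξ₂ 1 1 1 1)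
    (fun p => norm_charFunction_mul_le _ _ _ _ _ _ _)
    (fun p => norm_charFunction_mul_le _ _ _ _ _ _ _)]
  have h : ∀ β θ φ, charFunction (addLayer y (β, θ, φ)) ξ₁ 0 0
        * charFunction (addLayer y (β, θ, φ)) ξ₂ 0 0
      + charFunction (addLayer y (-β, θ, φ)) ξ₁ 1 1 * charFunction (addLayer y (-β, θ, φ)) ξ₂ 1 1
      = symplecticPhase β (ξ₁ + ξ₂) * parallelPart
        (conjugateSymbol (qubitRotation θ φ) (charFunction y ξ₁))
        (conjugateSymbol (qubitRotation θ φ) (charFunction y ξ₂)) := fun β θ φ => by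
    rw [charFunction_addLayer_zero_zero, charFunction_addLayer_zero_zero,
      charFunction_addLayer_one_one, charFunction_addLayer_one_one, neg_neg, symplecticPhase_add,
      parallelPart]
    ring
  simp only [h, integral_const_mul, integral_parallelPart, integral_mul_const,
    integral_symplecticPhase hv]

theorem integral_antiparallelPart_addLayer (hv : 0 < v) :
    ∫ p, antiparallelPart (charFunction (addLayer y p) ξ₁) (charFunction (addLayer y p) ξ₂)
        ∂layerLaw v
      = (Real.exp (-(v * ‖ξ₁ - ξ₂‖ ^ 2)) : ℂ) *
        (antiparallelPart (charFunction y ξ₁) (charFunction y ξ₂)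
          + defectPart (charFunction y ξ₁) (charFunction y ξ₂) / 4) := by
  simp only [antiparallelPart.eq_1 (charFunction (addLayer _ _) _)]
  rw [integral_layerLaw_add hv (continuous_charFunction_mul_addLayer y ξ₁ ξ₂ 0 0 1 1)
    (continuous_charFunction_mul_addLayer y ξ₁ ξ₂ 1 1 0 0)
    (fun p => norm_charFunction_mul_le _ _ _ _ _ _ _)
    (fun p => norm_charFunction_mul_le _ _ _ _ _ _ _)]
  have h : ∀ β θ φ, charFunction (addLayer y (β, θ, φ)) ξ₁ 0 0
        * charFunction (addLayer y (β, θ, φ)) ξ₂ 1 1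
      + charFunction (addLayer y (-β, θ, φ)) ξ₁ 1 1 * charFunction (addLayer y (-β, θ, φ)) ξ₂ 0 0
      = symplecticPhase β (ξ₁ - ξ₂) * antiparallelPart
        (conjugateSymbol (qubitRotation θ φ) (charFunction y ξ₁))
        (conjugateSymbol (qubitRotation θ φ) (charFunction y ξ₂)) := fun β θ φ => by
    rw [charFunction_addLayer_zero_zero, charFunction_addLayer_zero_zero,
      charFunction_addLayer_one_one, charFunction_addLayer_one_one, neg_neg, sub_eq_add_neg,
      symplecticPhase_add, symplecticPhase_neg, antiparallelPart]
    ring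
  simp only [h, integral_const_mul, integral_antiparallelPart, integral_mul_const,
    integral_symplecticPhase hv]

theorem integral_crossPart_addLayer (hv : 0 < v) :
    ∫ p, crossPart (charFunction (addLayer y p) ξ₁) (charFunction (addLayer y p) ξ₂) ∂layerLaw v
      = ∫ β, (crossPart (charFunction y (ξ₁ + 2 * β)) (charFunction y (ξ₂ + 2 * -β))
          + defectPart (charFunction y (ξ₁ + 2 * β)) (charFunction y (ξ₂ + 2 * -β)) / 4)
        ∂complexGaussian v := by
  simp only [crossPart.eq_1 (charFunction (addLayer _ _) _)]
  rw [integral_layerLaw_add hv (continuous_charFunction_mul_addLayer y ξ₁ ξ₂ 0 1 1 0)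
    (continuous_charFunction_mul_addLayer y ξ₁ ξ₂ 1 0 0 1)
    (fun p => norm_charFunction_mul_le _ _ _ _ _ _ _)
    (fun p => norm_charFunction_mul_le _ _ _ _ _ _ _)]
  have h : ∀ β θ φ, charFunction (addLayer y (β, θ, φ)) ξ₁ 0 1
        * charFunction (addLayer y (β, θ, φ)) ξ₂ 1 0
      + charFunction (addLayer y (-β, θ, φ)) ξ₁ 1 0 * charFunction (addLayer y (-β, θ, φ)) ξ₂ 0 1
      = crossPart
        (conjugateSymbol (qubitRotation θ φ) (charFunction y (ξ₁ + 2 * β)))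
        (conjugateSymbol (qubitRotation θ φ) (charFunction y (ξ₂ + 2 * -β))) := fun β θ φ => by
    rw [charFunction_addLayer_zero_one, charFunction_addLayer_zero_one,
      charFunction_addLayer_one_zero, charFunction_addLayer_one_zero, neg_neg, crossPart]
    ring
  simp only [h, integral_crossPart]

end Layer

/-! ### Averages over all layers -/

/-- A bilinear expression in characteristic functions at two points, averaged over the circuits. -/
def meanPart (B : (Fin 2 → Fin 2 → ℂ) → (Fin 2 → Fin 2 → ℂ) → ℂ) (v : ℝ) (L : ℕ) (ξ₁ ξ₂ : ℂ) : ℂ :=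
  ∫ y : Fin L → LayerParams, B (charFunction y ξ₁) (charFunction y ξ₂) ∂layersLaw v L

section Regularity

variable {L : ℕ}

theorem continuous_charFunction_comp (a b : Fin 2) {X : Type*} [TopologicalSpace X] {f : X → ℂ}
    (hf : Continuous f) : Continuous fun q : (Fin L → LayerParams) × X =>
      charFunction q.1 (f q.2) a b :=
  (continuous_charFunction L a b).comp (continuous_fst.prodMk (hf.comp continuous_snd))

variable {X : Type*} [TopologicalSpace X] {f g : X → ℂ}

theorem continuous_parallelPart (hf : Continuous f) (hg : Continuous g) :
    Continuous fun q : (Fin L → LayerParams) × X =>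
      parallelPart (charFunction q.1 (f q.2)) (charFunction q.1 (g q.2)) :=
  ((continuous_charFunction_comp 0 0 hf).mul (continuous_charFunction_comp 0 0 hg)).add
    ((continuous_charFunction_comp 1 1 hf).mul (continuous_charFunction_comp 1 1 hg))

theorem continuous_antiparallelPart (hf : Continuous f) (hg : Continuous g) :
    Continuous fun q : (Fin L → LayerParams) × X =>
      antiparallelPart (charFunction q.1 (f q.2)) (charFunction q.1 (g q.2)) :=
  ((continuous_charFunction_comp 0 0 hf).mul (continuous_charFunction_comp 1 1 hg)).add
    ((continuous_charFunction_comp 1 1 hf).mul (continuous_charFunction_comp 0 0 hg))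

theorem continuous_crossPart (hf : Continuous f) (hg : Continuous g) :
    Continuous fun q : (Fin L → LayerParams) × X =>
      crossPart (charFunction q.1 (f q.2)) (charFunction q.1 (g q.2)) :=
  ((continuous_charFunction_comp 0 1 hf).mul (continuous_charFunction_comp 1 0 hg)).add
    ((continuous_charFunction_comp 1 0 hf).mul (continuous_charFunction_comp 0 1 hg))

variable (y : Fin L → LayerParams) (ξ₁ ξ₂ : ℂ)

theorem norm_parallelPart_le : ‖parallelPart (charFunction y ξ₁) (charFunction y ξ₂)‖ ≤ 2 :=
  (norm_add_le _ _).trans ((add_le_add (norm_charFunction_mul_le y ξ₁ ξ₂ _ _ _ _)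
    (norm_charFunction_mul_le y ξ₁ ξ₂ _ _ _ _)).trans_eq one_add_one_eq_two)

theorem norm_antiparallelPart_le :
    ‖antiparallelPart (charFunction y ξ₁) (charFunction y ξ₂)‖ ≤ 2 :=
  (norm_add_le _ _).trans ((add_le_add (norm_charFunction_mul_le y ξ₁ ξ₂ _ _ _ _)
    (norm_charFunction_mul_le y ξ₁ ξ₂ _ _ _ _)).trans_eq one_add_one_eq_two)

theorem norm_crossPart_le : ‖crossPart (charFunction y ξ₁) (charFunction y ξ₂)‖ ≤ 2 :=
  (norm_add_le _ _).trans ((add_le_add (norm_charFunction_mul_le y ξ₁ ξ₂ _ _ _ _)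
    (norm_charFunction_mul_le y ξ₁ ξ₂ _ _ _ _)).trans_eq one_add_one_eq_two)

end Regularity

section Mean

variable {v : ℝ} {L : ℕ} (ξ₁ ξ₂ : ℂ)

theorem integrable_parallelPart : Integrable (fun y : Fin L → LayerParams =>
    parallelPart (charFunction y ξ₁) (charFunction y ξ₂)) (layersLaw v L) :=
  ((continuous_parallelPart (X := Unit) continuous_const continuous_const).comp
    (continuous_id.prodMk (continuous_const (y := ())))).integrable_of_bounded
      fun y => norm_parallelPart_le y ξ₁ ξ₂

theorem integrable_antiparallelPart : Integrable (fun y : Fin L → LayerParams =>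
    antiparallelPart (charFunction y ξ₁) (charFunction y ξ₂)) (layersLaw v L) :=
  ((continuous_antiparallelPart (X := Unit) continuous_const continuous_const).comp
    (continuous_id.prodMk (continuous_const (y := ())))).integrable_of_bounded
      fun y => norm_antiparallelPart_le y ξ₁ ξ₂

theorem integrable_crossPart : Integrable (fun y : Fin L → LayerParams =>
    crossPart (charFunction y ξ₁) (charFunction y ξ₂)) (layersLaw v L) :=
  ((continuous_crossPart (X := Unit) continuous_const continuous_const).comp
    (continuous_id.prodMk (continuous_const (y := ())))).integrable_of_bounded
      fun y => norm_crossPart_le y ξ₁ ξ₂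

theorem integrable_defectPart : Integrable (fun y : Fin L → LayerParams =>
    defectPart (charFunction y ξ₁) (charFunction y ξ₂)) (layersLaw v L) :=
  ((integrable_parallelPart ξ₁ ξ₂).sub (integrable_antiparallelPart ξ₁ ξ₂)).sub
    (integrable_crossPart ξ₁ ξ₂)

theorem meanPart_defectPart : meanPart defectPart v L ξ₁ ξ₂
    = meanPart parallelPart v L ξ₁ ξ₂ - meanPart antiparallelPart v L ξ₁ ξ₂
      - meanPart crossPart v L ξ₁ ξ₂ := by
  simp only [meanPart]
  rw [← integral_sub (integrable_parallelPart ξ₁ ξ₂) (integrable_antiparallelPart ξ₁ ξ₂),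
    ← integral_sub (f := fun y => parallelPart (charFunction y ξ₁) (charFunction y ξ₂)
      - antiparallelPart (charFunction y ξ₁) (charFunction y ξ₂))
      ((integrable_parallelPart ξ₁ ξ₂).sub (integrable_antiparallelPart ξ₁ ξ₂))
      (integrable_crossPart ξ₁ ξ₂)]
  rfl

theorem meanPart_parallelPart_succ (hv : 0 < v) : meanPart parallelPart v (L + 1) ξ₁ ξ₂
    = (Real.exp (-(v * ‖ξ₁ + ξ₂‖ ^ 2)) : ℂ)
      * (meanPart parallelPart v L ξ₁ ξ₂ - meanPart defectPart v L ξ₁ ξ₂ / 4) := by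
  rw [meanPart, integral_layersLaw_succ (integrable_parallelPart ξ₁ ξ₂)]
  simp only [integral_parallelPart_addLayer _ _ _ hv]
  rw [integral_const_mul, integral_sub (integrable_parallelPart ξ₁ ξ₂)
    ((integrable_defectPart ξ₁ ξ₂).div_const 4), integral_div]
  rfl

theorem meanPart_antiparallelPart_succ (hv : 0 < v) : meanPart antiparallelPart v (L + 1) ξ₁ ξ₂
    = (Real.exp (-(v * ‖ξ₁ - ξ₂‖ ^ 2)) : ℂ)
      * (meanPart antiparallelPart v L ξ₁ ξ₂ + meanPart defectPart v L ξ₁ ξ₂ / 4) := by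
  rw [meanPart, integral_layersLaw_succ (integrable_antiparallelPart ξ₁ ξ₂)]
  simp only [integral_antiparallelPart_addLayer _ _ _ hv]
  rw [integral_const_mul, integral_add (integrable_antiparallelPart ξ₁ ξ₂)
    ((integrable_defectPart ξ₁ ξ₂).div_const 4), integral_div]
  rfl

theorem meanPart_crossPart_succ (hv : 0 < v) : meanPart crossPart v (L + 1) ξ₁ ξ₂
    = ∫ β, (meanPart crossPart v L (ξ₁ + 2 * β) (ξ₂ + 2 * -β)
      + meanPart defectPart v L (ξ₁ + 2 * β) (ξ₂ + 2 * -β) / 4) ∂complexGaussian v := by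
  rw [meanPart, integral_layersLaw_succ (integrable_crossPart ξ₁ ξ₂)]
  simp only [integral_crossPart_addLayer _ _ _ hv]
  have h₁ : Continuous fun β : ℂ => ξ₁ + 2 * β := by fun_prop
  have h₂ : Continuous fun β : ℂ => ξ₂ + 2 * -β := by fun_prop
  rw [integral_integral_swap]
  · congr 1
    funext β
    rw [integral_add (integrable_crossPart _ _) ((integrable_defectPart _ _).div_const 4),
      integral_div]
    rfl
  · refine Continuous.integrable_of_bounded (C := 4) ((continuous_crossPart h₁ h₂).add
      ((((continuous_parallelPart h₁ h₂).sub (continuous_antiparallelPart h₁ h₂)).sub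
        (continuous_crossPart h₁ h₂)).div_const 4)) fun q => ?_
    have e₁ := norm_parallelPart_le q.1 (ξ₁ + 2 * q.2) (ξ₂ + 2 * -q.2)
    have e₂ := norm_antiparallelPart_le q.1 (ξ₁ + 2 * q.2) (ξ₂ + 2 * -q.2)
    have e₃ := norm_crossPart_le q.1 (ξ₁ + 2 * q.2) (ξ₂ + 2 * -q.2)
    refine (norm_add_le _ _).trans ?_
    rw [norm_div, defectPart, Complex.norm_ofNat]
    have e₄ := (norm_sub_le (parallelPart (charFunction q.1 (ξ₁ + 2 * q.2))
      (charFunction q.1 (ξ₂ + 2 * -q.2)) - antiparallelPart (charFunction q.1 (ξ₁ + 2 * q.2))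
      (charFunction q.1 (ξ₂ + 2 * -q.2))) (crossPart (charFunction q.1 (ξ₁ + 2 * q.2))
      (charFunction q.1 (ξ₂ + 2 * -q.2)))).trans (add_le_add_left (norm_sub_le _ _) _)
    linarith

end Mean

/-! ### The averaged evolution -/

namespace ExpSum

/-- Gaussian convolution in the plane is multiplication by a Gaussian after a Fourier transform.
Hence averaging the cross part over β corresponds exactly to damping the antiparallel part, with τ =
2v in the variable w = 2‖t‖². -/
theorem integral_eval_hankel {v : ℝ} (hv : 0 < v) (t : ℂ) (f : ExpSum) :
    Integrable (fun β => eval (2 * ‖t + 2 * β‖ ^ 2) (hankel f)) (complexGaussian v) ∧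
    ∫ β, eval (2 * ‖t + 2 * β‖ ^ 2) (hankel f) ∂complexGaussian v
      = eval (2 * ‖t‖ ^ 2) (hankel (damp ⟨2 * v, by positivity⟩ f)) := by
  induction f using Finsupp.induction_linear with
  | zero => simp
  | add f g hf hg =>
    simp only [map_add]
    exact ⟨hf.1.add hg.1, by rw [integral_add hf.1 hg.1, hf.2, hg.2]⟩
  | single s a =>
    have hs := s.2
    have hs' : 0 < 1 / (2 * (s : ℝ)) := by positivity
    have h := integral_exp_norm_add_complexGaussian hv hs' t
    simp only [hankel_single, damp_single, eval_single]
    have he : ∀ β : ℂ, -(1 / (4 * (s : ℝ))) * (2 * ‖t + 2 * β‖ ^ 2)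
        = -(1 / (2 * (s : ℝ))) * ‖t + 2 * β‖ ^ 2 := fun β => by field_simp; ring
    simp only [he]
    refine ⟨(Continuous.integrable_of_bounded (C := 1) (by fun_prop) fun β => ?_).const_mul _, ?_⟩
    · rw [Real.norm_of_nonneg (Real.exp_pos _).le, Real.exp_le_one_iff]
      have := mul_nonneg hs'.le (sq_nonneg ‖t + 2 * β‖)
      linarith
    · rw [integral_const_mul, h]
      have e1 : -(1 / (2 * (s : ℝ)) / (1 + 4 * (1 / (2 * (s : ℝ))) * v)) * ‖t‖ ^ 2
          = -(1 / (4 * ((s : ℝ) + 2 * v))) * (2 * ‖t‖ ^ 2) := by field_simp; ring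
      rw [e1]
      have e2 : 1 / (1 + 4 * (1 / (2 * (s : ℝ))) * v) = (s : ℝ) / (s + 2 * v) := by
        field_simp
        ring
      rw [e2]
      field_simp

end ExpSum

-- The coordinates s and t are adapted to the layer: the parallel factor depends on ξ₁ + ξ₂ = s
-- alone, the antiparallel one on ξ₁ - ξ₂ = 2t alone, and the shifts ±2β of the cross part move t at
-- fixed s. The prefactor exp(-‖s‖²/4) comes from the vacuum and is never changed.
open ExpSum in
theorem meanPart_eq_eval {v : ℝ} (hv : 0 < v) (L : ℕ) (s t : ℂ) :
    meanPart parallelPart v L (s / 2 + t) (s / 2 - t)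
      = ((Real.exp (-(1 / 4) * ‖s‖ ^ 2) * eval (2 * ‖t‖ ^ 2)
        (evolve (Real.exp (-(v * ‖s‖ ^ 2))) ⟨2 * v, by positivity⟩ L).1 : ℝ) : ℂ) ∧
    meanPart antiparallelPart v L (s / 2 + t) (s / 2 - t)
      = ((Real.exp (-(1 / 4) * ‖s‖ ^ 2) * eval (2 * ‖t‖ ^ 2)
        (evolve (Real.exp (-(v * ‖s‖ ^ 2))) ⟨2 * v, by positivity⟩ L).2 : ℝ) : ℂ) ∧
    meanPart crossPart v L (s / 2 + t) (s / 2 - t)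
      = ((Real.exp (-(1 / 4) * ‖s‖ ^ 2) * eval (2 * ‖t‖ ^ 2)
        (hankel (evolve (Real.exp (-(v * ‖s‖ ^ 2))) ⟨2 * v, by positivity⟩ L).2) : ℝ) : ℂ) := by
  set Q := Real.exp (-(v * ‖s‖ ^ 2)) with hQ
  set K := Real.exp (-(1 / 4) * ‖s‖ ^ 2) with hK
  induction L generalizing t with
  | zero =>
    have h := fun ξ => charFunction_fin_zero (fun i => i.elim0) ξ
    have hy : ∀ y : Fin 0 → LayerParams, y = fun i => i.elim0 := fun y => Subsingleton.elim _ _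
    have hm : ∀ B, meanPart B v 0 (s / 2 + t) (s / 2 - t)
        = B (charFunction (fun i : Fin 0 => i.elim0) (s / 2 + t))
          (charFunction (fun i : Fin 0 => i.elim0) (s / 2 - t)) := fun B => by
      rw [meanPart]
      simp only [hy, integral_const, probReal_univ, one_smul]
    simp only [hm, parallelPart, antiparallelPart, crossPart, (h _).1, (h _).2.1, (h _).2.2.1,
      (h _).2.2.2, evolve_zero, ground, eval_single, map_zero]
    refine ⟨?_, by simp, by simp⟩
    rw [mul_zero, add_zero, hK, one_mul, ← Real.exp_add]
    rw [← Complex.ofReal_mul, ← Real.exp_add]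
    congr 2
    have := parallelogram_law_with_norm ℝ (s / 2) t
    rw [norm_div, Complex.norm_ofNat] at this
    nlinarith
  | succ L ih =>
    have hd : ∀ t, meanPart defectPart v L (s / 2 + t) (s / 2 - t)
        = ((K * eval (2 * ‖t‖ ^ 2) (defect (evolve Q ⟨2 * v, by positivity⟩ L)) : ℝ) : ℂ) :=
      fun t => by
        rw [meanPart_defectPart, (ih t).1, (ih t).2.1, (ih t).2.2, defect_apply, map_sub, map_sub]
        push_cast
        ring
    rw [meanPart_parallelPart_succ _ _ hv, meanPart_antiparallelPart_succ _ _ hv,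
      meanPart_crossPart_succ _ _ hv, hd, (ih t).1, (ih t).2.1, evolve_succ, layer_fst, layer_snd,
      rotate_fst, rotate_snd, eval_damp, map_smul, map_sub, map_add, map_smul, smul_eq_mul,
      smul_eq_mul]
    refine ⟨?_, ?_, ?_⟩
    · rw [show s / 2 + t + (s / 2 - t) = s by ring, ← hQ]
      push_cast
      ring
    · rw [show s / 2 + t - (s / 2 - t) = 2 * t by ring, norm_mul, Complex.norm_ofNat]
      rw [show -(v * (2 * ‖t‖) ^ 2) = -(2 * v) * (2 * ‖t‖ ^ 2) by ring]
      push_cast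
      ring
    -- The defect is even under `hankel`, so adding a quarter of it to Hp is the same as applying H
    -- to the rotated p. This keeps the cross part equal to the Hankel transform of the antiparallel
    -- part.
    · have hβ : ∀ β, meanPart crossPart v L (s / 2 + t + 2 * β) (s / 2 - t + 2 * -β)
          + meanPart defectPart v L (s / 2 + t + 2 * β) (s / 2 - t + 2 * -β) / 4
          = ((K * eval (2 * ‖t + 2 * β‖ ^ 2) (hankel
            (rotate (evolve Q ⟨2 * v, by positivity⟩ L)).2) : ℝ) : ℂ) := fun β => by
        rw [show s / 2 + t + 2 * β = s / 2 + (t + 2 * β) by ring,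
          show s / 2 - t + 2 * -β = s / 2 - (t + 2 * β) by ring, hd, (ih _).2.2, rotate_snd,
          map_add, map_smul, hankel_defect (hankel_evolve_fst L), map_add, map_smul, smul_eq_mul]
        push_cast
        ring
      simp only [hβ]
      rw [integral_complex_ofReal, integral_const_mul, (integral_eval_hankel hv t _).2, rotate_snd]

-- The values of the evolution are averages of products of characteristic functions, at most 2 in
-- norm, divided by exp(-‖s‖²/4). For ‖s‖ ≤ 1 this divisor is at least 2/3, which gives the bound 3.
-- Each w > 0 is reached by the real point t = √(w/2).
open ExpSum in
theorem boundedEvolution {v : ℝ} (hv : 0 < v) {s : ℂ} (hs : ‖s‖ ≤ 1) :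
    BoundedEvolution (Real.exp (-(v * ‖s‖ ^ 2))) ⟨2 * v, by positivity⟩ := by
  intro n w hw
  have hK : 2 / 3 ≤ Real.exp (-(1 / 4) * ‖s‖ ^ 2) := by
    have h1 := Real.add_one_le_exp (-(1 / 4) * ‖s‖ ^ 2)
    have h2 : ‖s‖ ^ 2 ≤ 1 := by nlinarith [norm_nonneg s]
    linarith
  set t : ℂ := ((√(w / 2) : ℝ) : ℂ)
  have ht : 2 * ‖t‖ ^ 2 = w := by
    rw [Complex.norm_of_nonneg (Real.sqrt_nonneg _), Real.sq_sqrt (by positivity)]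
    ring
  have h := meanPart_eq_eval hv n s t
  rw [ht] at h
  have hle : ∀ {x : ℝ} {z : ℂ}, z = ((Real.exp (-(1 / 4) * ‖s‖ ^ 2) * x : ℝ) : ℂ) → ‖z‖ ≤ 2 →
      |x| ≤ 3 := fun {x z} hz hb => by
    rw [hz, Complex.norm_real, Real.norm_eq_abs, abs_mul, abs_of_pos (Real.exp_pos _)] at hb
    nlinarith [abs_nonneg x]
  have hm : ∀ {f : (Fin n → LayerParams) → ℂ}, (∀ y, ‖f y‖ ≤ 2) →
      ‖∫ y, f y ∂layersLaw v n‖ ≤ 2 := fun {f} hf => by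
    simpa using norm_integral_le_of_norm_le_const (μ := layersLaw v n) (ae_of_all _ hf)
  exact ⟨hle h.1 (hm fun y => norm_parallelPart_le y _ _),
    hle h.2.1 (hm fun y => norm_antiparallelPart_le y _ _),
    hle h.2.2 (hm fun y => norm_crossPart_le y _ _)⟩

/-! ### Phase space densities of the circuit states -/

/-- The (unnormalised) Husimi density of the mode when the qubit is in the state `a`. -/
def husimi {L : ℕ} (y : Fin L → LayerParams) (a : Fin 2) (z : ℂ) : ℝ :=
  ‖circuitState y a z‖ ^ 2 * bargmannWeight z

theorem continuous_circuitState (L : ℕ) (a : Fin 2) :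
    Continuous fun q : (Fin L → LayerParams) × ℂ => circuitState q.1 a q.2 := by
  induction L generalizing a with
  | zero =>
    have ha : a = 0 ∨ a = 1 := by omega
    rcases ha with rfl | rfl
    · exact continuous_const (y := (1 : ℂ))
    · exact continuous_const (y := (0 : ℂ))
  | succ L ih =>
    simp only [circuitState_succ, displacement, Pi.add_apply, Pi.smul_apply, smul_eq_mul]
    have hl : Continuous fun q : (Fin (L + 1) → LayerParams) × ℂ => q.1 (Fin.last L) :=
      (continuous_apply _).comp continuous_fst
    have hβ : Continuous fun q : (Fin (L + 1) → LayerParams) × ℂ =>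
        ecdShift a (q.1 (Fin.last L)).1 := (continuous_ecdShift a).comp (continuous_fst.comp hl)
    have hr : ∀ b c, Continuous fun q : (Fin (L + 1) → LayerParams) × ℂ =>
        qubitRotation (q.1 (Fin.last L)).2.1 (q.1 (Fin.last L)).2.2 b c := fun b c =>
      (continuous_qubitRotation b c).comp (continuous_snd.comp hl)
    have hg : Continuous fun q : (Fin (L + 1) → LayerParams) × ℂ =>
        ((fun i => q.1 i.castSucc : Fin L → LayerParams),
          q.2 - conj (ecdShift a (q.1 (Fin.last L)).1)) :=
      (continuous_pi fun i => (continuous_apply i.castSucc).comp continuous_fst).prodMk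
        (continuous_snd.sub (Complex.continuous_conj.comp hβ))
    have hs := fun b => (ih b).comp hg
    exact (by fun_prop : Continuous fun q : (Fin (L + 1) → LayerParams) × ℂ =>
      Complex.exp (ecdShift a (q.1 (Fin.last L)).1 * q.2
        - ((‖ecdShift a (q.1 (Fin.last L)).1‖ ^ 2 / 2 : ℝ) : ℂ))).mul
      (((hr _ _).mul (hs 0)).add ((hr _ _).mul (hs 1)))

theorem continuous_husimi (L : ℕ) (a : Fin 2) :
    Continuous fun q : (Fin L → LayerParams) × ℂ => husimi q.1 a q.2 :=
  ((continuous_circuitState L a).norm.pow 2).mul (continuous_bargmannWeight.comp continuous_snd)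

theorem husimi_nonneg {L : ℕ} (y : Fin L → LayerParams) (a : Fin 2) (z : ℂ) : 0 ≤ husimi y a z :=
  mul_nonneg (sq_nonneg _) (bargmannWeight_pos z).le

/-- The kernel of the Weyl expansion of a coherent state. -/
def weylKernel (z ξ : ℂ) : ℂ := (Real.exp (-(1 / 2) * ‖ξ‖ ^ 2) : ℂ) * coherentPhase z ξ

theorem norm_weylKernel (z ξ : ℂ) : ‖weylKernel z ξ‖ = Real.exp (-(1 / 2) * ‖ξ‖ ^ 2) := by
  rw [weylKernel, norm_mul, norm_coherentPhase, mul_one, Complex.norm_real,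
    Real.norm_of_nonneg (Real.exp_pos _).le]

theorem continuous_weylKernel (z : ℂ) : Continuous (weylKernel z) :=
  (by fun_prop : Continuous fun ξ : ℂ => (Real.exp (-(1 / 2) * ‖ξ‖ ^ 2) : ℂ)).mul
    (continuous_coherentPhase z)

theorem weylKernel_mul (z s t : ℂ) : weylKernel z (s / 2 + t) * weylKernel z (s / 2 - t)
    = (Real.exp (-(1 / 4) * ‖s‖ ^ 2) * Real.exp (-1 * ‖t‖ ^ 2) : ℂ) * coherentPhase z s := by
  have h := parallelogram_law_with_norm ℝ (s / 2) t
  rw [norm_div, Complex.norm_ofNat] at h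
  have h1 : (Real.exp (-(1 / 2) * ‖s / 2 + t‖ ^ 2) * Real.exp (-(1 / 2) * ‖s / 2 - t‖ ^ 2) : ℂ)
      = Real.exp (-(1 / 4) * ‖s‖ ^ 2) * Real.exp (-1 * ‖t‖ ^ 2) := by
    rw [← Complex.ofReal_mul, ← Complex.ofReal_mul, ← Real.exp_add, ← Real.exp_add]
    congr 2
    nlinarith
  have h2 : coherentPhase z (s / 2 + t) * coherentPhase z (s / 2 - t) = coherentPhase z s := by
    simp only [coherentPhase]
    rw [← Complex.exp_add]
    congr 1
    simp only [map_add, map_sub, map_div₀, map_ofNat]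
    ring
  rw [← h1, ← h2, weylKernel, weylKernel]
  ring

theorem husimi_eq {L : ℕ} (y : Fin L → LayerParams) (a : Fin 2) (z : ℂ) : (husimi y a z : ℂ)
    = (Real.pi : ℂ)⁻¹ * (Real.pi : ℂ)⁻¹ * ∫ ξ, weylKernel z ξ * charFunction y ξ a a := by
  have h := (conj_mul_eq_integral_modeInner (circuitState_mem_coherentSpan y a)
    (circuitState_mem_coherentSpan y a) z).2
  rw [Complex.conj_mul', ← Complex.ofReal_pow, ← Complex.ofReal_mul] at h
  exact h

theorem husimi_le {L : ℕ} (y : Fin L → LayerParams) (a : Fin 2) (z : ℂ) :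
    husimi y a z ≤ 2 / Real.pi := by
  have h := congrArg norm (husimi_eq y a z)
  rw [Complex.norm_real, Real.norm_of_nonneg (husimi_nonneg y a z), norm_mul, norm_mul, norm_inv,
    Complex.norm_real, Real.norm_of_nonneg Real.pi_pos.le] at h
  have h1 : ‖∫ ξ, weylKernel z ξ * charFunction y ξ a a‖ ≤ Real.pi / (1 / 2) := by
    rw [← integral_exp_neg_mul_sq_norm (by norm_num : (0 : ℝ) < 1 / 2)]
    refine norm_integral_le_of_norm_le (integrable_exp_neg_mul_sq_norm (by norm_num))
      (ae_of_all _ fun ξ => ?_)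
    rw [norm_mul, norm_weylKernel]
    exact mul_le_of_le_one_right (Real.exp_pos _).le (norm_charFunction_le y ξ a a)
  rw [h]
  calc _ ≤ Real.pi⁻¹ * Real.pi⁻¹ * (Real.pi / (1 / 2)) := by gcongr
    _ = 2 / Real.pi := by field_simp

/-! ### Coordinates for pairs of points -/

/-- The substitution has Jacobian of modulus one; it is carried out as two translations with an
exchange of the integrals between them. -/
theorem integral_integral_eq_half_sum_difference {F : ℂ × ℂ → ℂ} (hF : Continuous F) {C : ℝ}
    (hb : ∀ x y, ‖F (x, y)‖ ≤ C * (Real.exp (-(1 / 2) * ‖x‖ ^ 2) * Real.exp (-(1 / 2) * ‖y‖ ^ 2))) :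
    ∫ x, ∫ y, F (x, y) = ∫ p : ℂ × ℂ, F (p.1 / 2 + p.2, p.1 / 2 - p.2) := by
  have hC : 0 ≤ C := by
    have := (norm_nonneg _).trans (hb 0 0)
    simpa using this
  have hi : Integrable fun p : ℂ × ℂ => F (p.1 / 2 + p.2, p.1 / 2 - p.2) := by
    refine (((integrable_exp_neg_mul_sq_norm (by norm_num : (0 : ℝ) < 1 / 4)).mul_prod
      (integrable_exp_neg_mul_sq_norm one_pos)).const_mul C).mono'
      (hF.comp (by fun_prop)).aestronglyMeasurable (ae_of_all _ fun p => (hb _ _).trans_eq ?_)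
    have h := parallelogram_law_with_norm ℝ (p.1 / 2) p.2
    rw [norm_div, Complex.norm_ofNat] at h
    rw [← Real.exp_add, ← Real.exp_add]
    congr 2
    nlinarith
  have hi' : Integrable fun p : ℂ × ℂ => F (p.2, p.1 - p.2) := by
    refine (((integrable_exp_neg_mul_sq_norm (by norm_num : (0 : ℝ) < 1 / 6)).mul_prod
      (integrable_exp_neg_mul_sq_norm (by norm_num : (0 : ℝ) < 1 / 6))).const_mul C).mono'
      (hF.comp (by fun_prop)).aestronglyMeasurable (ae_of_all _ fun p => (hb _ _).trans ?_)
    rw [← Real.exp_add, ← Real.exp_add]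
    refine mul_le_mul_of_nonneg_left (Real.exp_le_exp.2 ?_) hC
    have h : ‖p.1‖ ≤ ‖p.2‖ + ‖p.1 - p.2‖ := by
      simpa using norm_add_le p.2 (p.1 - p.2)
    nlinarith [norm_nonneg p.1, sq_nonneg (‖p.2‖ - ‖p.1 - p.2‖), sq_nonneg ‖p.1 - p.2‖]
  rw [Measure.volume_eq_prod] at hi hi'
  rw [Measure.volume_eq_prod, integral_prod _ hi]
  calc ∫ x, ∫ y, F (x, y) = ∫ x, ∫ s, F (x, s - x) := by
        congr 1
        funext x
        exact (integral_sub_right_eq_self (fun y => F (x, y)) x).symm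
    _ = ∫ s, ∫ x, F (x, s - x) := (integral_integral_swap hi').symm
    _ = _ := by
        congr 1
        funext s
        rw [← integral_add_left_eq_self _ (s / 2)]
        congr 1
        funext t
        congr 2
        ring

/-! ### The averaged square of the density -/

/-- The squares for both qubit states are taken together because it is their sum that is the
parallel part, for which the averaged recursion is closed. -/
theorem sum_husimi_sq_eq {L : ℕ} (y : Fin L → LayerParams) (z : ℂ) :
    ((husimi y 0 z ^ 2 + husimi y 1 z ^ 2 : ℝ) : ℂ) = (Real.pi : ℂ)⁻¹ ^ 4 * ∫ p : ℂ × ℂ,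
      weylKernel z (p.1 / 2 + p.2) * weylKernel z (p.1 / 2 - p.2)
        * parallelPart (charFunction y (p.1 / 2 + p.2)) (charFunction y (p.1 / 2 - p.2)) := by
  have hc : ∀ a b, Continuous fun ξ : ℂ => charFunction y ξ a b := fun a b =>
    (continuous_charFunction L a b).comp (continuous_const.prodMk continuous_id)
  have hk := continuous_weylKernel z
  have hint : ∀ a, Integrable fun ξ => weylKernel z ξ * charFunction y ξ a a := fun a => by
    refine (integrable_exp_neg_mul_sq_norm (by norm_num : (0 : ℝ) < 1 / 2)).mono'
      (hk.mul (hc a a)).aestronglyMeasurable (ae_of_all _ fun ξ => ?_)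
    rw [norm_mul, norm_weylKernel]
    exact mul_le_of_le_one_right (Real.exp_pos _).le (norm_charFunction_le y ξ a a)
  have hF : Continuous fun p : ℂ × ℂ => weylKernel z p.1 * weylKernel z p.2
      * parallelPart (charFunction y p.1) (charFunction y p.2) :=
    ((hk.comp continuous_fst).mul (hk.comp continuous_snd)).mul
      ((((hc 0 0).comp continuous_fst).mul ((hc 0 0).comp continuous_snd)).add
        (((hc 1 1).comp continuous_fst).mul ((hc 1 1).comp continuous_snd)))
  rw [← integral_integral_eq_half_sum_difference (C := 2) hF fun ξ₁ ξ₂ => ?_]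
  · push_cast
    rw [husimi_eq, husimi_eq]
    have h : ∀ ξ₁ : ℂ, ∫ ξ₂, weylKernel z ξ₁ * weylKernel z ξ₂
        * parallelPart (charFunction y ξ₁) (charFunction y ξ₂)
        = weylKernel z ξ₁ * charFunction y ξ₁ 0 0 * (∫ ξ, weylKernel z ξ * charFunction y ξ 0 0)
          + weylKernel z ξ₁ * charFunction y ξ₁ 1 1
            * ∫ ξ, weylKernel z ξ * charFunction y ξ 1 1 := fun ξ₁ => by
      rw [← integral_const_mul, ← integral_const_mul,
        ← integral_add ((hint 0).const_mul _) ((hint 1).const_mul _)]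
      congr 1
      funext ξ₂
      rw [parallelPart]
      ring
    simp only [h]
    rw [integral_add ((hint 0).mul_const _) ((hint 1).mul_const _), integral_mul_const,
      integral_mul_const]
    ring
  · simp only [norm_mul, norm_weylKernel]
    rw [mul_comm]
    exact mul_le_mul_of_nonneg_right (norm_parallelPart_le y ξ₁ ξ₂) (by positivity)

/-- The factor exp(-‖t‖²) left by the Weyl kernels is the ground function at w = 2‖t‖², and the area
element in t is (π/2) dw. So the t-integral is an inner product with the ground pair. -/
theorem ExpSum.integral_exp_mul_eval (f : ExpSum) :
    Integrable (fun t : ℂ => Real.exp (-1 * ‖t‖ ^ 2) * ExpSum.eval (2 * ‖t‖ ^ 2) f) ∧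
    ∫ t : ℂ, Real.exp (-1 * ‖t‖ ^ 2) * ExpSum.eval (2 * ‖t‖ ^ 2) f
      = Real.pi / 2 * ExpSum.form ExpSum.ground.1 f := by
  induction f using Finsupp.induction_linear with
  | zero => simp
  | add f g hf hg =>
    simp only [map_add, mul_add]
    exact ⟨hf.1.add hg.1, by rw [integral_add hf.1 hg.1, hf.2, hg.2]⟩
  | single s a =>
    have hs := s.2
    have hs' : 0 < 1 + 2 * (s : ℝ) := by positivity
    have he : ∀ t : ℂ, Real.exp (-1 * ‖t‖ ^ 2) * ExpSum.eval (2 * ‖t‖ ^ 2) (Finsupp.single s a)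
        = a * Real.exp (-(1 + 2 * (s : ℝ)) * ‖t‖ ^ 2) := fun t => by
      rw [ExpSum.eval_single, mul_left_comm, ← Real.exp_add]
      congr 2
      ring
    simp only [he]
    refine ⟨(integrable_exp_neg_mul_sq_norm hs').const_mul a, ?_⟩
    rw [integral_const_mul, integral_exp_neg_mul_sq_norm hs', ExpSum.ground, ExpSum.form_single]
    field_simp

theorem integrable_weylKernel_mul_parallelPart (v : ℝ) (L : ℕ) (z : ℂ) :
    Integrable (Function.uncurry fun (y : Fin L → LayerParams) (p : ℂ × ℂ) =>
      weylKernel z (p.1 / 2 + p.2) * weylKernel z (p.1 / 2 - p.2)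
        * parallelPart (charFunction y (p.1 / 2 + p.2)) (charFunction y (p.1 / 2 - p.2)))
      ((layersLaw v L).prod (volume.prod volume)) := by
  have hg := ((integrable_exp_neg_mul_sq_norm (by norm_num : (0 : ℝ) < 1 / 4)).mul_prod
    (integrable_exp_neg_mul_sq_norm one_pos)).const_mul 2
  have h₁ : Continuous fun p : ℂ × ℂ => p.1 / 2 + p.2 := by fun_prop
  have h₂ : Continuous fun p : ℂ × ℂ => p.1 / 2 - p.2 := by fun_prop
  have hk : Continuous fun p : ℂ × ℂ => weylKernel z (p.1 / 2 + p.2) * weylKernel z (p.1 / 2 - p.2) :=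
    ((continuous_weylKernel z).comp h₁).mul ((continuous_weylKernel z).comp h₂)
  have hp := continuous_parallelPart (L := L) h₁ h₂
  have hc : Continuous fun q : (Fin L → LayerParams) × (ℂ × ℂ) =>
      weylKernel z (q.2.1 / 2 + q.2.2) * weylKernel z (q.2.1 / 2 - q.2.2)
        * parallelPart (charFunction q.1 (q.2.1 / 2 + q.2.2)) (charFunction q.1 (q.2.1 / 2 - q.2.2)) :=
    (hk.comp continuous_snd).mul hp
  have hm : AEStronglyMeasurable _ ((layersLaw v L).prod (volume.prod volume)) :=
    hc.aestronglyMeasurable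
  refine (hg.comp_snd (layersLaw v L)).mono' hm (ae_of_all _ fun q => ?_)
  have h := congrArg norm (weylKernel_mul z q.2.1 q.2.2)
  rw [norm_mul _ (coherentPhase _ _), norm_coherentPhase, mul_one, ← Complex.ofReal_mul,
    Complex.norm_real, Real.norm_of_nonneg (by positivity)] at h
  rw [Function.uncurry_def, norm_mul, h, mul_comm]
  exact mul_le_mul_of_nonneg_right (norm_parallelPart_le _ _ _) (by positivity)

theorem integral_weylKernel_mul_parallelPart {v : ℝ} (hv : 0 < v) (L : ℕ) (z : ℂ) (p : ℂ × ℂ) :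
    ∫ y : Fin L → LayerParams, weylKernel z (p.1 / 2 + p.2) * weylKernel z (p.1 / 2 - p.2)
      * parallelPart (charFunction y (p.1 / 2 + p.2)) (charFunction y (p.1 / 2 - p.2))
        ∂layersLaw v L
      = coherentPhase z p.1 * Real.exp (-(1 / 2) * ‖p.1‖ ^ 2) * ((Real.exp (-1 * ‖p.2‖ ^ 2)
        * ExpSum.eval (2 * ‖p.2‖ ^ 2) (ExpSum.evolve (Real.exp (-(v * ‖p.1‖ ^ 2)))
          ⟨2 * v, by positivity⟩ L).1 : ℝ) : ℂ) := by
  have h := (meanPart_eq_eval hv L p.1 p.2).1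
  rw [meanPart] at h
  rw [integral_const_mul, h, weylKernel_mul, show -(1 / 2) * ‖p.1‖ ^ 2
    = -(1 / 4) * ‖p.1‖ ^ 2 + -(1 / 4) * ‖p.1‖ ^ 2 by ring, Real.exp_add]
  push_cast
  ring

/-- The phase depending on z has modulus one and is discarded, so the bound is uniform in z. The
prefactor π/2 · π⁻⁴ is simply estimated by 1. -/
theorem integral_husimi_sq_le {v : ℝ} (hv : 0 < v) (L : ℕ) (z : ℂ) {G : ℂ → ℝ} (hG : Integrable G)
    (hb : ∀ s : ℂ, Real.exp (-(1 / 2) * ‖s‖ ^ 2) * |ExpSum.form ExpSum.ground.1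
      (ExpSum.evolve (Real.exp (-(v * ‖s‖ ^ 2))) ⟨2 * v, by positivity⟩ L).1| ≤ G s) :
    ∫ y : Fin L → LayerParams, husimi y 0 z ^ 2 ∂layersLaw v L ≤ ∫ s, G s := by
  have hh : ∀ a, Continuous fun y : Fin L → LayerParams => husimi y a z ^ 2 := fun a =>
    ((continuous_husimi L a).comp (continuous_id.prodMk continuous_const)).pow 2
  have hi : ∀ a, Integrable (fun y : Fin L → LayerParams => husimi y a z ^ 2) (layersLaw v L) :=
    fun a => (hh a).integrable_of_bounded (C := (2 / Real.pi) ^ 2) fun y => by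
      rw [Real.norm_of_nonneg (sq_nonneg _)]
      exact pow_le_pow_left₀ (husimi_nonneg y a z) (husimi_le y a z) 2
  have h1 : ∫ y : Fin L → LayerParams, husimi y 0 z ^ 2 ∂layersLaw v L
      ≤ ∫ y : Fin L → LayerParams, (husimi y 0 z ^ 2 + husimi y 1 z ^ 2) ∂layersLaw v L :=
    integral_mono (hi 0) ((hi 0).add (hi 1)) fun y => le_add_of_nonneg_right (sq_nonneg _)
  refine h1.trans ((le_abs_self _).trans ?_)
  rw [← Real.norm_eq_abs, ← Complex.norm_real, ← integral_complex_ofReal]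
  simp only [sum_husimi_sq_eq]
  have hi' := integrable_weylKernel_mul_parallelPart v L z
  have hk := integral_weylKernel_mul_parallelPart hv L z
  have hs := hi'.integral_prod_right
  rw [integral_const_mul, Measure.volume_eq_prod, integral_integral_swap hi']
  simp only [Function.uncurry_apply_pair] at hs
  simp only [hk] at hs ⊢
  rw [integral_prod _ hs]
  simp only [integral_const_mul, integral_complex_ofReal, (ExpSum.integral_exp_mul_eval _).2]
  have hn : ‖∫ s : ℂ, coherentPhase z s * Real.exp (-(1 / 2) * ‖s‖ ^ 2) * ((Real.pi / 2
      * ExpSum.form ExpSum.ground.1 (ExpSum.evolve (Real.exp (-(v * ‖s‖ ^ 2)))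
        ⟨2 * v, by positivity⟩ L).1 : ℝ) : ℂ)‖ ≤ ∫ s, Real.pi / 2 * G s := by
    refine norm_integral_le_of_norm_le (hG.const_mul _) (ae_of_all _ fun s => ?_)
    rw [norm_mul, norm_mul, norm_coherentPhase, one_mul, Complex.norm_real, Complex.norm_real,
      Real.norm_of_nonneg (Real.exp_pos _).le, Real.norm_eq_abs, abs_mul,
      abs_of_pos (by positivity : 0 < Real.pi / 2), mul_left_comm]
    exact mul_le_mul_of_nonneg_left (hb s) (by positivity)
  rw [integral_const_mul] at hn
  rw [norm_mul, norm_pow, norm_inv, Complex.norm_real, Real.norm_of_nonneg Real.pi_pos.le]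
  have hG0 : 0 ≤ ∫ s, G s := integral_nonneg fun s => le_trans (by positivity) (hb s)
  calc _ ≤ Real.pi⁻¹ ^ 4 * (Real.pi / 2 * ∫ s, G s) := by gcongr
    _ = 1 / (2 * Real.pi ^ 3) * ∫ s, G s := by field_simp
    _ ≤ 1 * ∫ s, G s := by
        gcongr
        rw [div_le_one (by positivity)]
        have : (1 : ℝ) ≤ Real.pi ^ 3 := one_le_pow₀ (by linarith [Real.pi_gt_three])
        linarith
    _ = _ := one_mul _

/-! ### Decay in the total displacement -/

namespace ExpSum

theorem half_min_le_rate {v x y : ℝ} (hv : 0 < v) (hy : 0 ≤ y) (hyx : y ≤ x) (hyv : y ≤ v) :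
    min (2 * y) 1 / 2 ≤ rate (Real.exp (-x)) ⟨2 * v, by positivity⟩ := by
  have hm0 : 0 ≤ min (2 * y) 1 := le_min (by positivity) zero_le_one
  have hm1 := min_le_left (2 * y) 1
  have hm2 := min_le_right (2 * y) 1
  set m := min (2 * y) 1
  refine le_min ?_ (le_min ?_ ?_)
  · rw [← Real.exp_nat_mul, Nat.cast_ofNat]
    have h1 : Real.exp (2 * -x) ≤ Real.exp (-m) := Real.exp_le_exp.2 (by linarith)
    have h2 : Real.exp (-m) * (m + 1) ≤ 1 := by
      calc _ ≤ Real.exp (-m) * Real.exp m := by gcongr; exact Real.add_one_le_exp m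
        _ = 1 := by rw [← Real.exp_add, neg_add_cancel, Real.exp_zero]
    nlinarith [Real.exp_pos (-m)]
  · simp only
    linarith
  · linarith

theorem exp_neg_div_le (n : ℕ) : Real.exp (-(n / 80 : ℝ)) ≤ 80 / (n + 1) := by
  have h1 := Real.add_one_le_exp (n / 80 : ℝ)
  rw [Real.exp_neg, inv_le_comm₀ (Real.exp_pos _) (by positivity), inv_div]
  linarith

theorem exp_neg_le_two_div_sq {x : ℝ} (hx : 0 < x) : Real.exp (-x) ≤ 2 / x ^ 2 := by
  have h1 := Real.quadratic_le_exp_of_nonneg hx.le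
  rw [Real.exp_neg, inv_le_comm₀ (Real.exp_pos _) (by positivity), inv_div]
  linarith

/-- For x ≤ 1/2 the rate is at least x, and Q joins the exponential to give all n + 1 layers. For x
≥ 1/2 the rate is at least 1/2, and exp(-n/80) ≤ 80/(n + 1) is used, keeping exp(-x) for the
integrability in s. -/
theorem exp_mul_exp_rate_le {v x : ℝ} (hv : 0 < v) (hx : 0 ≤ x) (hxv : x ≤ v) (n : ℕ) :
    Real.exp (-x) * Real.exp (-(rate (Real.exp (-x)) ⟨2 * v, by positivity⟩ * n / 40))
      ≤ Real.exp (-(x * (n + 1) / 40)) + 80 / (n + 1) * Real.exp (-x) := by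
  have hr := half_min_le_rate hv hx le_rfl hxv
  set r := rate (Real.exp (-x)) ⟨2 * v, by positivity⟩
  have hn : (0 : ℝ) ≤ n := n.cast_nonneg
  rcases le_total (2 * x) 1 with h | h
  · rw [min_eq_left h, mul_div_cancel_left₀ _ two_ne_zero] at hr
    refine le_add_of_le_of_nonneg ?_ (by positivity)
    rw [← Real.exp_add, Real.exp_le_exp]
    nlinarith
  · rw [min_eq_right h] at hr
    refine le_add_of_nonneg_of_le (Real.exp_pos _).le ?_
    rw [mul_comm]
    refine mul_le_mul_of_nonneg_right (le_trans ?_ (exp_neg_div_le n)) (Real.exp_pos _).le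
    rw [Real.exp_le_exp]
    nlinarith

/-- Here v(n + 1) = E in the application, so two powers of 1/E come from exponentials alone. The
worst case is v ≥ 1/2, where 2/v² times (80/(n + 1))² gives 12800. -/
theorem exp_mul_exp_rate_le_of_le {v x : ℝ} (hv : 0 < v) (hxv : v ≤ x) (n : ℕ) :
    Real.exp (-x) * Real.exp (-(rate (Real.exp (-x)) ⟨2 * v, by positivity⟩ * n / 20))
      ≤ 12800 / (v * (n + 1)) ^ 2 := by
  have hr := half_min_le_rate hv hv.le hxv le_rfl
  set r := rate (Real.exp (-x)) ⟨2 * v, by positivity⟩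
  have hn : (0 : ℝ) ≤ n := n.cast_nonneg
  have hx : Real.exp (-x) ≤ Real.exp (-v) := Real.exp_le_exp.2 (by linarith)
  rcases le_total (2 * v) 1 with h | h
  · rw [min_eq_left h, mul_div_cancel_left₀ _ two_ne_zero] at hr
    have h1 : Real.exp (-x) * Real.exp (-(r * n / 20)) ≤ Real.exp (-(v * (n + 1) / 20)) := by
      rw [← Real.exp_add, Real.exp_le_exp]
      nlinarith
    refine h1.trans ((exp_neg_le_two_div_sq (by positivity)).trans ?_)
    rw [div_pow, div_div_eq_mul_div]
    gcongr
    norm_num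
  · rw [min_eq_right h] at hr
    have h1 : Real.exp (-(r * n / 20)) ≤ Real.exp (-(n / 80 : ℝ)) ^ 2 := by
      rw [← Real.exp_nat_mul, Real.exp_le_exp]
      push_cast
      nlinarith
    calc _ ≤ (2 / v ^ 2) * (80 / (n + 1)) ^ 2 := by
          gcongr
          · exact hx.trans (exp_neg_le_two_div_sq hv)
          · exact h1.trans (pow_le_pow_left₀ (Real.exp_pos _).le (exp_neg_div_le n) 2)
      _ = _ := by
          field_simp
          norm_num

end ExpSum

/-- An integrable bound for the contribution of the total displacement `s`. -/
def displacementBound (A E v : ℝ) (n : ℕ) (s : ℂ) : ℝ :=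
  A / E * (Real.exp (-(E / 40) * ‖s‖ ^ 2) + 80 / (n + 1) * Real.exp (-v * ‖s‖ ^ 2))
    + 12800 / E ^ 2 * Real.exp (-(1 / 2) * ‖s‖ ^ 2)

section Bound

variable {v : ℝ} {n : ℕ}

/-- The three Gaussians integrate to 40π/E, 80π/((n + 1)v) = 80π/E and 2π. -/
theorem integral_displacementBound (hv : 0 < v) {E : ℝ} (hE : v * (n + 1) = E) (A : ℝ) :
    Integrable (displacementBound A E v n) ∧
    ∫ s, displacementBound A E v n s = (120 * A + 25600) * Real.pi / E ^ 2 := by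
  have hE0 : 0 < E := hE ▸ by positivity
  have i₁ := integrable_exp_neg_mul_sq_norm (by positivity : 0 < E / 40)
  have i₂ := (integrable_exp_neg_mul_sq_norm hv).const_mul (80 / (n + 1 : ℝ))
  have i₃ := (integrable_exp_neg_mul_sq_norm (by norm_num : (0 : ℝ) < 1 / 2)).const_mul
    (12800 / E ^ 2)
  refine ⟨((i₁.add i₂).const_mul _).add i₃, ?_⟩
  have h₁₂ := i₁.add i₂
  simp only [Pi.add_def] at h₁₂
  simp only [displacementBound]
  rw [integral_add (h₁₂.const_mul _) i₃, integral_const_mul, integral_add i₁ i₂,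
    integral_const_mul, integral_const_mul, integral_exp_neg_mul_sq_norm hv,
    integral_exp_neg_mul_sq_norm (by positivity), integral_exp_neg_mul_sq_norm (by norm_num)]
  subst hE
  field_simp
  ring

-- For ‖s‖ ≤ 1 the sup bounds hold and the Nash estimate applies; for ‖s‖ ≥ 1 the pure contraction
-- suffices and exp(-‖s‖²/2) provides the integrability.
open ExpSum in
theorem exp_mul_abs_form_le_displacementBound (hv : 0 < v) {E K : ℝ} (hE : v * (n + 1) = E)
    (hK : 0 ≤ K) (hn : (3 / 4) ^ (n + 1) ≤ K / E) (s : ℂ) :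
    Real.exp (-(1 / 2) * ‖s‖ ^ 2) * |form ground.1
      (evolve (Real.exp (-(v * ‖s‖ ^ 2))) ⟨2 * v, by positivity⟩ (n + 1)).1|
        ≤ displacementBound (2 * (4 / 3 * √K + 3000) ^ 2) E v n s := by
  have hE0 : 0 < E := hE ▸ by positivity
  set A := 2 * (4 / 3 * √K + 3000) ^ 2
  have hx : 0 ≤ v * ‖s‖ ^ 2 := by positivity
  have hQ1 : Real.exp (-(v * ‖s‖ ^ 2)) ≤ 1 := Real.exp_le_one_iff.2 (by linarith)
  rcases le_total ‖s‖ 1 with hs | hs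
  · have h := abs_form_ground_evolve_le_of_bounded (boundedEvolution hv hs) (Real.exp_pos _).le hQ1
      n hE0 hK hn (by rw [← hE]; ring)
    have hxv : v * ‖s‖ ^ 2 ≤ v := mul_le_of_le_one_right hv.le (pow_le_one₀ (norm_nonneg s) hs)
    refine le_add_of_le_of_nonneg ?_ (by positivity)
    refine (mul_le_of_le_one_left (abs_nonneg _) (Real.exp_le_one_iff.2 (by nlinarith))).trans
      (h.trans (mul_le_mul_of_nonneg_left ?_ (by positivity)))
    refine (exp_mul_exp_rate_le hv hx hxv n).trans_eq ?_
    congr 2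
    · rw [← hE]
      ring
    · rw [neg_mul]
  · have h := abs_form_ground_evolve_le_exp (τ := ⟨2 * v, by positivity⟩)
      (Real.exp_pos (-(v * ‖s‖ ^ 2))).le hQ1 n
    have hxv : v ≤ v * ‖s‖ ^ 2 := le_mul_of_one_le_right hv.le (one_le_pow₀ hs)
    refine le_add_of_nonneg_of_le (by positivity) ?_
    rw [mul_comm]
    refine mul_le_mul_of_nonneg_right (h.trans ?_) (Real.exp_pos _).le
    rw [← hE]
    exact exp_mul_exp_rate_le_of_le hv hxv n

theorem integral_husimi_sq_le_div {L : ℕ} (hL : L ≠ 0) {E K : ℝ} (hE : 0 < E) (hK : 0 ≤ K)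
    (hn : (3 / 4) ^ L ≤ K / E) (z : ℂ) :
    ∫ y : Fin L → LayerParams, husimi y 0 z ^ 2 ∂layersLaw (E / L) L
      ≤ (240 * (4 / 3 * √K + 3000) ^ 2 + 25600) * Real.pi / E ^ 2 := by
  obtain ⟨n, rfl⟩ := Nat.exists_eq_succ_of_ne_zero hL
  rw [Nat.succ_eq_add_one] at *
  have hv : 0 < E / ((n + 1 : ℕ) : ℝ) := by positivity
  have hEv : E / ((n + 1 : ℕ) : ℝ) * (n + 1) = E := by
    push_cast
    field_simp
  obtain ⟨hi, he⟩ := integral_displacementBound hv hEv (2 * (4 / 3 * √K + 3000) ^ 2)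
  refine (integral_husimi_sq_le hv (n + 1) z hi
    (exp_mul_abs_form_le_displacementBound hv hEv hK hn)).trans_eq (he.trans ?_)
  ring

end Bound

/-! ### The upper bound -/

/-- Half of the Gaussian weight goes to ψ and half to the circuit state, which turns the overlap
into an average of the square root of the Husimi density. Jensen's inequality for x⁴ then yields the
squared density. -/
theorem exists_norm_modeInner_pow_four_le {ψ : ModeState} (hψ : Moderate ψ) :
    ∃ K w : ℝ, 0 ≤ K ∧ 0 < w ∧ ∀ {L : ℕ} (y : Fin L → LayerParams),
      ‖modeInner ψ (circuitState y 0)‖ ^ 4 ≤ K * ∫ z, husimi y 0 z ^ 2 ∂complexGaussian w := by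
  obtain ⟨-, C, t, hC, -, ht1, hb⟩ := hψ
  -- Half of the growth margin of ψ: ‖ψ‖ times the square root of the weight is at most a constant
  -- times exp(-ε‖z‖²), the profile of a complex Gaussian of variance 1/ε.
  have hε : 0 < (1 - t) / 2 := by linarith
  set ε := (1 - t) / 2 with hεdef
  set c := √(C / Real.pi) * (Real.pi * (1 / ε)) with hc
  refine ⟨c ^ 4, 1 / ε, by positivity, by positivity, fun {L} y => ?_⟩
  have hy : Continuous fun z => husimi y 0 z :=
    (continuous_husimi L 0).comp (continuous_const.prodMk continuous_id)
  have hs : Continuous fun z => √(husimi y 0 z) := hy.sqrt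
  have hle : ∀ z, √(husimi y 0 z) ≤ √(2 / Real.pi) := fun z => Real.sqrt_le_sqrt (husimi_le y 0 z)
  have h1 : ‖modeInner ψ (circuitState y 0)‖ ≤ c * ∫ z, √(husimi y 0 z) ∂complexGaussian (1 / ε) := by
    rw [integral_complexGaussian (by positivity), ← integral_const_mul, modeInner_eq]
    have he : ∀ z, c * complexGaussianPDF (1 / ε) z • √(husimi y 0 z)
        = √(C / Real.pi) * (Real.exp (-ε * ‖z‖ ^ 2) * √(husimi y 0 z)) := fun z => by
      rw [complexGaussianPDF, hc, one_div_one_div, smul_eq_mul]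
      field_simp
    simp only [he]
    refine norm_integral_le_of_norm_le (Integrable.const_mul ?_ _) (ae_of_all _ fun z => ?_)
    · refine ((integrable_exp_neg_mul_sq_norm hε).mul_const (√(2 / Real.pi))).mono'
        (by fun_prop : Continuous fun z => Real.exp (-ε * ‖z‖ ^ 2)
          * √(husimi y 0 z)).aestronglyMeasurable (ae_of_all _ fun z => ?_)
      rw [Real.norm_of_nonneg (by positivity)]
      exact mul_le_mul_of_nonneg_left (hle z) (Real.exp_pos _).le
    · have hw := bargmannWeight_pos z
      have hw' : ‖ψ z‖ ^ 2 * bargmannWeight z ≤ C / Real.pi * Real.exp (-ε * ‖z‖ ^ 2) ^ 2 := by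
        calc _ ≤ C * Real.exp (t * ‖z‖ ^ 2) * bargmannWeight z := by gcongr; exact hb z
          _ = C / Real.pi * (Real.exp (t * ‖z‖ ^ 2) * Real.exp (-‖z‖ ^ 2)) := by
            rw [bargmannWeight]
            ring
          _ = _ := by
            rw [← Real.exp_add, ← Real.exp_nat_mul, hεdef]
            congr 2
            push_cast
            ring
      rw [norm_mul, norm_mul, RCLike.norm_conj, Complex.norm_real, Real.norm_of_nonneg hw.le]
      refine le_of_sq_le_sq ?_ (by positivity)
      calc (‖ψ z‖ * ‖circuitState y 0 z‖ * bargmannWeight z) ^ 2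
          = ‖ψ z‖ ^ 2 * bargmannWeight z * husimi y 0 z := by rw [husimi]; ring
        _ ≤ C / Real.pi * Real.exp (-ε * ‖z‖ ^ 2) ^ 2 * husimi y 0 z :=
          mul_le_mul_of_nonneg_right hw' (husimi_nonneg y 0 z)
        _ = _ := by
          rw [mul_pow, mul_pow, Real.sq_sqrt (by positivity), Real.sq_sqrt (husimi_nonneg y 0 z)]
          ring
  have h2 : (∫ z, √(husimi y 0 z) ∂complexGaussian (1 / ε)) ^ 4
      ≤ ∫ z, √(husimi y 0 z) ^ 4 ∂complexGaussian (1 / ε) := by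
    refine ConvexOn.map_integral_le (g := fun x : ℝ => x ^ 4)
      (Even.convexOn_pow (by decide : Even 4)) (by fun_prop) isClosed_univ (by simp) ?_ ?_
    · exact hs.integrable_of_bounded (C := √(2 / Real.pi)) fun z => by
        rw [Real.norm_of_nonneg (Real.sqrt_nonneg _)]
        exact hle z
    · refine Continuous.integrable_of_bounded (C := √(2 / Real.pi) ^ 4) (hs.pow 4) fun z => ?_
      rw [Function.comp_apply, Real.norm_of_nonneg (by positivity)]
      exact pow_le_pow_left₀ (Real.sqrt_nonneg _) (hle z) 4
  have h3 : ∀ z, √(husimi y 0 z) ^ 4 = husimi y 0 z ^ 2 := fun z => by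
    rw [show 4 = 2 * 2 from rfl, pow_mul, Real.sq_sqrt (husimi_nonneg y 0 z)]
  simp only [h3] at h2
  calc _ ≤ (c * ∫ z, √(husimi y 0 z) ∂complexGaussian (1 / ε)) ^ 4 := by gcongr
    _ = c ^ 4 * (∫ z, √(husimi y 0 z) ∂complexGaussian (1 / ε)) ^ 4 := mul_pow _ _ _
    _ ≤ _ := by gcongr

theorem layersCost_overlap {ψ : ModeState} (hψ : Moderate ψ) {L : ℕ} (y : Fin L → LayerParams) :
    layersCost (overlap ψ) y = ‖modeInner ψ (circuitState y 0)‖ ^ 2 := by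
  rw [← displacement_zero (circuitState y 0), modeInner_displacement_circuitState hψ]
  rfl

theorem exists_variance_costGradient_le {ψ : ModeState} (hψ : Moderate ψ)
    (hd : Differentiable ℂ ψ) {K : ℝ} (hK : 0 ≤ K) :
    ∃ C : ℝ, 0 < C ∧ ∀ E : ℝ, 0 < E → ∀ L : ℕ, (3 / 4) ^ L ≤ K / E → ∀ k : Fin L,
      variance (costGradient ψ k) (circuitEnsemble E L) ≤ C / E ^ 2 := by
  obtain ⟨M, hM⟩ := exists_norm_overlap_le hψ hd
  obtain ⟨B, w, hB, hw, h⟩ := exists_norm_modeInner_pow_four_le hψ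
  set D := (240 * (4 / 3 * √K + 3000) ^ 2 + 25600) * Real.pi with hD
  have hD0 : 0 < D := by positivity
  refine ⟨B * D + 1, by positivity, fun E hE L hn k => ?_⟩
  have hL : L ≠ 0 := fun h0 => (h0 ▸ k).elim0
  rw [variance_costGradient hψ hd]
  refine (integral_layersSlope_sq_le (continuous_overlap hψ hd) hM k).trans ?_
  have hc : Continuous fun q : (Fin L → LayerParams) × ℂ => husimi q.1 0 q.2 ^ 2 :=
    (continuous_husimi L 0).pow 2
  have hi : Integrable (Function.uncurry fun (y : Fin L → LayerParams) z => husimi y 0 z ^ 2)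
      ((layersLaw (E / L) L).prod (complexGaussian w)) := by
    refine Continuous.integrable_of_bounded (C := (2 / Real.pi) ^ 2) hc fun q => ?_
    rw [Function.uncurry_def, Real.norm_of_nonneg (sq_nonneg _)]
    exact pow_le_pow_left₀ (husimi_nonneg _ _ _) (husimi_le _ _ _) 2
  calc ∫ y : Fin L → LayerParams, layersCost (overlap ψ) y ^ 2 ∂layersLaw (E / L) L
      ≤ ∫ y : Fin L → LayerParams, B * ∫ z, husimi y 0 z ^ 2 ∂complexGaussian w
          ∂layersLaw (E / L) L := by
        refine integral_mono_of_nonneg (ae_of_all _ fun y => sq_nonneg _)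
          (hi.integral_prod_left.const_mul B) (ae_of_all _ fun y => ?_)
        have := h y
        simp only [layersCost_overlap hψ, ← pow_mul]
        exact this
    _ = B * ∫ z, ∫ y : Fin L → LayerParams, husimi y 0 z ^ 2 ∂layersLaw (E / L) L
          ∂complexGaussian w := by
        rw [integral_const_mul, integral_integral_swap hi]
    _ ≤ B * ∫ _, D / E ^ 2 ∂complexGaussian w :=
        mul_le_mul_of_nonneg_left (integral_mono hi.integral_prod_right (integrable_const _)
          fun z => integral_husimi_sq_le_div hL hE hK hn z) hB
    _ = B * D / E ^ 2 := by
        rw [integral_const, probReal_univ, one_smul, mul_div_assoc B D]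
    _ ≤ _ := by gcongr; linarith

/-! ### Gaussian states and number states -/

/-- The growth exponent is |tanh ζ|, strictly below 1; this is why `Moderate` asks for some t < 1
rather than a fixed one. -/
theorem moderate_squeezedVacuum (ζ : ℝ) : Moderate (squeezedVacuum ζ) := by
  refine ⟨by unfold squeezedVacuum; fun_prop, 1, |Real.tanh ζ|, zero_le_one, abs_nonneg _,
    Real.abs_tanh_lt_one ζ, fun z => ?_⟩
  have h1 : (1 / √(Real.cosh ζ)) ^ 2 ≤ 1 := by
    rw [div_pow, Real.sq_sqrt (Real.cosh_pos ζ).le, one_pow, div_le_one (Real.cosh_pos ζ)]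
    exact Real.one_le_cosh ζ
  rw [squeezedVacuum, norm_mul, mul_pow, Complex.norm_real, Real.norm_eq_abs, sq_abs,
    Complex.norm_exp, ← Real.exp_nat_mul]
  refine mul_le_mul h1 (Real.exp_le_exp.2 ?_) (Real.exp_pos _).le zero_le_one
  have h2 := Complex.re_le_norm (-((Real.tanh ζ : ℝ) : ℂ) * z ^ 2 / 2)
  rw [norm_div, norm_mul, norm_neg, Complex.norm_real, norm_pow, Complex.norm_ofNat,
    Real.norm_eq_abs] at h2
  push_cast at h2 ⊢
  linarith

theorem Moderate.phaseRotation {F : ModeState} (hF : Moderate F) (τ : ℝ) :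
    Moderate (phaseRotation τ F) := by
  obtain ⟨hc, C, t, hC, ht, ht1, hb⟩ := hF
  refine ⟨hc.comp (by fun_prop), C, t, hC, ht, ht1, fun z => (hb _).trans_eq ?_⟩
  rw [norm_mul, Complex.norm_exp]
  simp

theorem moderate_gaussianState (γ : ℂ) (τ ζ : ℝ) : Moderate (gaussianState γ τ ζ) :=
  ((moderate_squeezedVacuum ζ).phaseRotation τ).displacement γ

theorem differentiable_gaussianState (γ : ℂ) (τ ζ : ℝ) : Differentiable ℂ (gaussianState γ τ ζ) := by
  refine differentiable_displacement ?_ γ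
  unfold phaseRotation squeezedVacuum
  fun_prop

theorem gaussianState_ne_zero (γ : ℂ) (τ ζ : ℝ) (z : ℂ) : gaussianState γ τ ζ z ≠ 0 := by
  have h := (Real.sqrt_pos.2 (Real.cosh_pos ζ)).ne'
  refine mul_ne_zero (Complex.exp_ne_zero _) (mul_ne_zero ?_ (Complex.exp_ne_zero _))
  exact_mod_cast one_div_ne_zero h

theorem fockState_apply (n : ℕ) (z : ℂ) :
    fockState n z = z ^ n / ((√(n.factorial : ℝ) : ℝ) : ℂ) := by
  have h : (creation^[n] vacuum) z = z ^ n := by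
    induction n with
    | zero => rfl
    | succ n ih => rw [Function.iterate_succ_apply', creation, ih, pow_succ']
  rw [fockState, h]

theorem differentiable_fockState (n : ℕ) : Differentiable ℂ (fockState n) := by
  rw [funext (fockState_apply n)]
  fun_prop

theorem moderate_fockState (n : ℕ) : Moderate (fockState n) := by
  refine ⟨(differentiable_fockState n).continuous, 2 ^ n, 1 / 2, by positivity, by norm_num,
    by norm_num, fun z => ?_⟩
  have h := Real.pow_div_factorial_le_exp (‖z‖ ^ 2 / 2) (by positivity) n
  rw [fockState_apply, norm_div, norm_pow, Complex.norm_real, div_pow,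
    Real.norm_of_nonneg (Real.sqrt_nonneg _), Real.sq_sqrt (by positivity)]
  calc (‖z‖ ^ n) ^ 2 / (n.factorial : ℝ) = 2 ^ n * ((‖z‖ ^ 2 / 2) ^ n / n.factorial) := by
        rw [div_pow, ← pow_mul, mul_comm n 2, pow_mul]
        field_simp
    _ ≤ 2 ^ n * Real.exp (‖z‖ ^ 2 / 2) := by gcongr
    _ = _ := by ring_nf

theorem fockState_one_ne_zero (n : ℕ) : fockState n 1 ≠ 0 := by
  rw [fockState_apply, one_pow]
  have h := (Real.sqrt_pos.2 (by positivity : (0 : ℝ) < n.factorial)).ne'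
  exact one_div_ne_zero (by exact_mod_cast h)

/-! ### The critical depth -/

/-- The critical depth is the depth at which (4/3)^L reaches κE, so the part of the evolution that
stays in the first component is no larger than 1/(κE). -/
theorem pow_le_of_criticalDepth_le {κ E : ℝ} (hκ : 0 < κ) (hE : 0 < E) {L : ℕ}
    (hL : criticalDepth κ E ≤ L) : (3 / 4 : ℝ) ^ L ≤ 1 / κ / E := by
  rw [criticalDepth, div_le_iff₀ (Real.log_pos (by norm_num)), ← Real.log_pow,
    Real.log_le_log_iff (by positivity) (by positivity)] at hL
  rw [div_div, le_div_iff₀ (by positivity)]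
  calc (3 / 4 : ℝ) ^ L * (κ * E) ≤ (3 / 4 : ℝ) ^ L * (4 / 3) ^ L := by gcongr
    _ = 1 := by rw [← mul_pow]; norm_num

end

theorem theorem2 (ψ : ModeState)
    (hψ : (∃ (γ : ℂ) (τ ζ : ℝ), ψ = gaussianState γ τ ζ) ∨ ∃ n : ℕ, ψ = fockState n) :
    (∀ E : ℝ, 0 < E → ∀ (L : ℕ) (k : Fin L),
      (∀ x : CircuitParams L, DifferentiableAt ℝ (costAlong ψ k x) (x.2.1 k)) ∧
      MemLp (fun x => costGradient ψ k x) 2 (circuitEnsemble E L) ∧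
      ∫ x, costGradient ψ k x ∂(circuitEnsemble E L) = 0) ∧
    (∀ κ : ℝ, 0 < κ → ∃ c C E₀ : ℝ, 0 < c ∧ 0 < C ∧ 0 < E₀ ∧
      ∀ E : ℝ, E₀ ≤ E → ∀ L : ℕ, criticalDepth κ E ≤ (L : ℝ) → ∀ k : Fin L,
        c / E ^ 2 ≤ variance (fun x => costGradient ψ k x) (circuitEnsemble E L) ∧
        variance (fun x => costGradient ψ k x) (circuitEnsemble E L) ≤ C / E ^ 2) := by
  obtain ⟨hm, hd, z, hz⟩ : Moderate ψ ∧ Differentiable ℂ ψ ∧ ∃ z, ψ z ≠ 0 := by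
    rcases hψ with ⟨γ, τ, ζ, rfl⟩ | ⟨n, rfl⟩
    · exact ⟨moderate_gaussianState γ τ ζ, differentiable_gaussianState γ τ ζ, 0,
        gaussianState_ne_zero γ τ ζ 0⟩
    · exact ⟨moderate_fockState n, differentiable_fockState n, 1, fockState_one_ne_zero n⟩
  refine ⟨fun E _ L k => ⟨fun x => (hasDerivAt_costAlong hm k x).differentiableAt,
    memLp_costGradient hm hd k E, integral_costGradient hm hd k E⟩, fun κ hκ => ?_⟩
  obtain ⟨c, hc, hlow⟩ := exists_le_variance_costGradient hm hd hz
  obtain ⟨C, hC, hupp⟩ := exists_variance_costGradient_le hm hd (one_div_pos.2 hκ).le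
  exact ⟨c, C, 1, hc, hC, one_pos, fun E hE L hL k => ⟨hlow E hE L k,
    hupp E (by linarith) L (pow_le_of_criticalDepth_le hκ (by linarith) hL) k⟩⟩
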